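/- Let $k\ge 2$. For a graph $G$ with vertex set $V$ and $\bar u=(u_1,\dots,u_k)\in V^k$, let $\bar u^{j,w}$ denote $\bar u$ with its $j$-th entry replaced by $w$, and put $$C_G^0(\bar u)=\big(\{(i,j)\mid u_i=u_j\},\ \{(i,j)\mid \{u_i,u_j\}\in E(G)\}\big),$$ $$C_G^{i}(\bar u)=\big(C_G^{i-1}(\bar u),\ \{\!\!\{(C_G^{i-1}(\bar u^{1,w}),\dots,C_G^{i-1}(\bar u^{k,w}))\mid w\in V\}\!\!\}\big)\qquad(i\ge 1).$$ The $r$-round $k$-dimensional Weisfeiler–Lehman (WL) algorithm, given graphs $G$ and $H$, reports $G\cong H$ if the multisets $\{\!\!\{C_G^r(\bar u)\mid\bar u\in V(G)^k\}\!\!\}$ and $\{\!\!\{C_H^r(\bar u)\mid\bar u\in V(H)^k\}\!\!\}$ are equal, and $G\not\cong H$ otherwise. In the count-free version all multisets are replaced by sets. An AC-circuit is a circuit with NOT gates and with AND and OR gates of unbounded fan-in; a TC-circuit may in addition contain threshold gates ("at least $t$ of the incoming wires carry 1"). The size of a circuit is its number of gates and wires, its depth the largest number of non-input gates on a path. A family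 $(D_n)_{n\ge 0}$ of circuits is logspace uniform if a deterministic Turing machine with a read-only input tape, finitely many work tapes and a write-only output tape, on input $1^n$, outputs a description of $D_n$ using $O(\log n)$ cells of its work tapes (read $O(1+\log n)$ for $n\le 1$). A function $r\colon\mathbb N\to\mathbb N$ is logspace constructible if such a machine, with the same space bound, computes $1^n\mapsto 1^{r(n)}$. **Theorem.** For every constant $k\ge2$ there is a constant $C$ such that for every function $r\colon\mathbb N\to\mathbb N$ the following holds. 1. There is a family $(D_n)$ of TC-circuits such that for every $n\ge1$ the circuit $D_n$ has depth at most $C\cdot\max(1,r(n))$ and size at most $C\cdot\max(1,r(n))\cdot n^{3k}$ and, given the adjacency matrices of two graphs $G,H$ of order $n$, outputs 1 if and only if the $r(n)$-round $k$-dimensional WL algorithm reports $G\cong H$. If $r$ is logspace constructible, then $(D_n)$ is logspace uniform. 2. There is a family $(D_n)$ of AC-circuits with the same bounds on depth and size for every $n\ge 1$ such that $D_n$, given the adjacency matrices of two graphs $G,H$ of order $n\ge1$, outputs 1 if and only if the count-free $r(n)$-round $k$-dimensional WL algorithm reports $G\cong H$. If $r$ is logspace constructible, then $(D_n)$ is logspace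 uniform. -/

import Mathlib

/-! ## The Weisfeiler-Lehman algorithm -/

namespace WL

/-- The isomorphism type of a `k`-tuple of vertices: the pairs of positions that carry equal
vertices, and the pairs of positions that carry adjacent vertices. -/
def isoType {V : Type} {k : ℕ} (G : SimpleGraph V) (u : Fin k → V) :
    Set (Fin k × Fin k) × Set (Fin k × Fin k) :=
  ({p | u p.1 = u p.2}, {p | G.Adj (u p.1) (u p.2)})

/-- The colors that occur after `i` rounds of the `k`-dimensional algorithm. -/
def Color (k : ℕ) : ℕ → Type
  | 0 => Set (Fin k × Fin k) × Set (Fin k × Fin k)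
  | i + 1 => Color k i × Multiset (Fin k → Color k i)

/-- The colors that occur after `i` rounds of the count-free `k`-dimensional algorithm. -/
def CFColor (k : ℕ) : ℕ → Type
  | 0 => Set (Fin k × Fin k) × Set (Fin k × Fin k)
  | i + 1 => CFColor k i × Set (Fin k → CFColor k i)

/-- The color of the tuple `u` after `i` rounds: the preceding color of `u`, together with the
multiset, over all vertices `w`, of the `k`-tuples of preceding colors of the tuples obtained
from `u` by putting `w` in place of the `j`-th entry (`j = 1, …, k`). -/
def color {V : Type} [Fintype V] {k : ℕ} (G : SimpleGraph V) :
    (i : ℕ) → (Fin k → V) → Color k i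
  | 0, u => isoType G u
  | i + 1, u =>
      (color G i u,
        (Finset.univ : Finset V).val.map fun w j => color G i (Function.update u j w))

/-- The color of the tuple `u` after `i` rounds of the count-free version: as `color`, with a set
in place of the multiset. -/
def cfColor {V : Type} {k : ℕ} (G : SimpleGraph V) : (i : ℕ) → (Fin k → V) → CFColor k i
  | 0, u => isoType G u
  | i + 1, u =>
      (cfColor G i u, Set.range fun w j => cfColor G i (Function.update u j w))

/-- The `r`-round `k`-dimensional algorithm reports `G ≅ H`: the multisets of the colors of all
`k`-tuples after round `r` are equal. -/
def ReportsIso {V W : Type} [Fintype V] [Fintype W] (k r : ℕ)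
    (G : SimpleGraph V) (H : SimpleGraph W) : Prop :=
  (Finset.univ : Finset (Fin k → V)).val.map (color G r) =
    (Finset.univ : Finset (Fin k → W)).val.map (color H r)

/-- The count-free `r`-round `k`-dimensional algorithm reports `G ≅ H`: the sets of the colors of
all `k`-tuples after round `r` are equal. -/
def CFReportsIso {V W : Type} (k r : ℕ) (G : SimpleGraph V) (H : SimpleGraph W) : Prop :=
  Set.range (cfColor (k := k) G r) = Set.range (cfColor (k := k) H r)

end WL

/-! ## Circuits of unbounded fan-in -/

/-- A gate of a circuit with `m` input variables; the natural numbers `j` and the entries of `l`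
are the positions of the gates that feed it. A threshold gate is true if at least `t` of the wires
that enter it carry the value true. -/
inductive Gate (m : ℕ) : Type
  | input (i : Fin m)
  | not (j : ℕ)
  | and (l : List ℕ)
  | or (l : List ℕ)
  | threshold (t : ℕ) (l : List ℕ)

namespace Gate

/-- The gates that feed a gate, one entry for each wire. -/
def preds {m : ℕ} : Gate m → List ℕ
  | input _ => []
  | not j => [j]
  | and l => l
  | or l => l
  | threshold _ l => l

/-- The value of a gate on the input `x`, where `v j` is the value of the gate at position `j`. -/
def eval {m : ℕ} (x : Fin m → Bool) : Gate m → (ℕ → Bool) → Bool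
  | input i, _ => x i
  | not j, v => !(v j)
  | and l, v => l.all v
  | or l, v => l.any v
  | threshold t l, v => decide (t ≤ l.countP v)

/-- The depth of a gate, where `d j` is the depth of the gate at position `j`. Negations count. -/
def depth {m : ℕ} : Gate m → (ℕ → ℕ) → ℕ
  | input _, _ => 0
  | not j, d => d j + 1
  | and l, d => (l.map d).foldr max 0 + 1
  | or l, d => (l.map d).foldr max 0 + 1
  | threshold _ l, d => (l.map d).foldr max 0 + 1

/-- A gate that is not a threshold gate. -/
def IsAC {m : ℕ} : Gate m → Prop
  | threshold _ _ => False
  | _ => True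

end Gate

/-- A circuit (with threshold gates, that is, a TC-circuit) with `m` input variables: a nonempty
list of gates, each of which is fed by earlier gates only. The last gate is the output. -/
structure Circuit (m : ℕ) : Type where
  gates : List (Gate m)
  nonempty : gates ≠ []
  acyclic : ∀ (i : ℕ) (h : i < gates.length), ∀ j ∈ (gates[i]).preds, j < i

namespace Circuit

/-- Computes a quantity for all gates of a list in their order, the quantity of a gate being a
function `f` of the gate and of the quantities of earlier gates. The value `d` for positions that
are not earlier is never used in a circuit. -/
def scan {m : ℕ} {α : Type} (d : α) (f : Gate m → (ℕ → α) → α) (gs : List (Gate m)) : List α :=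
  gs.foldl (fun vs g => vs ++ [f g fun j => vs.getD j d]) []

/-- The output of the circuit on the input `x`. -/
def eval {m : ℕ} (C : Circuit m) (x : Fin m → Bool) : Bool :=
  (scan false (Gate.eval x) C.gates).getLastD false

/-- The depth of a circuit: the largest number of non-input gates on a path. -/
def depth {m : ℕ} (C : Circuit m) : ℕ :=
  (scan 0 Gate.depth C.gates).foldr max 0

/-- The size of a circuit: the number of its gates (inputs included) plus the number of its
wires. -/
def size {m : ℕ} (C : Circuit m) : ℕ :=
  C.gates.length + (C.gates.map fun g => g.preds.length).sum

/-- A circuit without threshold gates. -/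
def IsAC {m : ℕ} (C : Circuit m) : Prop := ∀ g ∈ C.gates, g.IsAC

end Circuit

/-- The finite alphabet in which circuits are described. -/
inductive DescSym : Type
  | input | not | and | or | threshold
  | bit (b : Bool)
  | sep

/-- A natural number in binary, least significant bit first, followed by a separator. -/
def describeNat (a : ℕ) : List DescSym := a.bits.map DescSym.bit ++ [DescSym.sep]

/-- The description of a gate: its kind, followed by its parameters. -/
def Gate.describe {m : ℕ} : Gate m → List DescSym
  | .input i => DescSym.input :: describeNat i
  | .not j => DescSym.not :: describeNat j
  | .and l => DescSym.and :: l.flatMap describeNat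
  | .or l => DescSym.or :: l.flatMap describeNat
  | .threshold t l => DescSym.threshold :: (describeNat t ++ l.flatMap describeNat)

/-- The description of a circuit: the descriptions of its gates, in their order. -/
def Circuit.describe {m : ℕ} (C : Circuit m) : List DescSym := C.gates.flatMap Gate.describe

/-- A pair of graphs of order `n` as an input of length `2 * n ^ 2`: the adjacency matrix of `G`,
row by row, followed by the adjacency matrix of `H`, row by row. -/
noncomputable def graphPairInput {n : ℕ} (G H : SimpleGraph (Fin n)) :
    Fin (2 * (n * n)) → Bool := fun p =>
  open Classical in
  let s : Fin 2 := (finProdFinEquiv.symm p).1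
  let ij : Fin n × Fin n := finProdFinEquiv.symm (finProdFinEquiv.symm p).2
  if s = 0 then decide (G.Adj ij.1 ij.2) else decide (H.Adj ij.1 ij.2)

/-! ## Logarithmic space -/

/-- What the input head scans: an end marker of the input tape, or a letter of the input word. -/
inductive InSym : Type
  | leftEnd
  | letter (b : Bool)
  | rightEnd

/-- A head movement. -/
inductive Move : Type
  | left | stay | right

/-- The effect of a movement on the position of a head on a tape that is infinite to the right;
at the left end a movement to the left has no effect. -/
def Move.apply : Move → ℕ → ℕ
  | left, p => p - 1
  | stay, p => p
  | right, p => p + 1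

/-- A deterministic Turing machine with a read-only two-way input tape (with end markers), finitely
many read-write work tapes, and a write-only output tape with alphabet `Out`. Depending on
the state and on the scanned symbols it either halts (`none`) or determines the next state, the
movement of the input head, for each work tape the symbol to be written and the movement of the
head, and the symbol, if any, to be appended to the output. -/
structure Transducer (Out : Type) : Type 1 where
  State : Type
  Tape : Type
  Sym : Type
  finiteState : Finite State
  finiteTape : Finite Tape
  finiteSym : Finite Sym
  start : State
  blank : Sym
  trans : State → InSym → (Tape → Sym) →
    Option (State × Move × (Tape → Sym × Move) × Option Out)

namespace Transducer

/-- A configuration of a machine. -/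
structure Config {Out : Type} (M : Transducer Out) : Type where
  state : M.State
  inputHead : ℕ
  tape : M.Tape → ℕ → M.Sym
  head : M.Tape → ℕ
  output : List Out

/-- The symbol in cell `p` of the input tape that holds the word `w` in the cells
`1, …, w.length`, between the end markers. -/
def inputSym (w : List Bool) : ℕ → InSym
  | 0 => InSym.leftEnd
  | p + 1 => match w[p]? with
    | some b => InSym.letter b
    | none => InSym.rightEnd

/-- The initial configuration. -/
def init {Out : Type} (M : Transducer Out) : M.Config where
  state := M.start
  inputHead := 0
  tape := fun _ _ => M.blank
  head := fun _ => 0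
  output := []

/-- One step of the machine on the input word `w`; the input head does not leave the part of the
tape between the end markers. -/
def step {Out : Type} (M : Transducer Out) (w : List Bool) (c : M.Config) : Option M.Config :=
  (M.trans c.state (inputSym w c.inputHead) fun t => c.tape t (c.head t)).map
    fun (q, mv, act, o) =>
      { state := q
        inputHead := min (mv.apply c.inputHead) (w.length + 1)
        tape := fun t => Function.update (c.tape t) (c.head t) (act t).1
        head := fun t => (act t).2.apply (c.head t)
        output := c.output ++ o.toList }

/-- On the input word `w` the machine halts with output `v`, and no head on a work tape ever leaves
the first `s` cells of its tape. -/
def ComputesInSpace {Out : Type} (M : Transducer Out) (w : List Bool) (v : List Out) (s : ℕ) :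
    Prop :=
  (∃ c : M.Config, StateTransition.Reaches (M.step w) M.init c ∧ M.step w c = none ∧
    c.output = v) ∧
  ∀ c : M.Config, StateTransition.Reaches (M.step w) M.init c → ∀ t, c.head t < s

end Transducer

/-- The function that maps the unary word `1 ^ n` to the word `f n` is computable in space
`O(log n)`. -/
def LogspaceComputable {Out : Type} (f : ℕ → List Out) : Prop :=
  ∃ (M : Transducer Out) (c : ℕ), ∀ n : ℕ,
    M.ComputesInSpace (List.replicate n true) (f n) (c * (Nat.log 2 n + 1))

/-- The function `1 ^ n ↦ 1 ^ (r n)` is computable in logarithmic space. -/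
def LogspaceConstructible (r : ℕ → ℕ) : Prop :=
  LogspaceComputable fun n => List.replicate (r n) true

/-- A family of circuits is logspace uniform if some machine, given `n` in unary, writes down
the `n`-th circuit in logarithmic space. -/
def LogspaceUniform {m : ℕ → ℕ} (D : (n : ℕ) → Circuit (m n)) : Prop :=
  LogspaceComputable fun n => (D n).describe

/-! Colors are never computed. The circuit only computes, round by round, which pairs of tuples have
equal colors, where the first tuple comes from `G` and the second from `G` or from `H`. In round 0
the isomorphism types are compared. For each later round two multisets with `n` members each have to
be compared, when all that is known is which members are equal.

The key is `map_univ_eq_iff`. Two families `f` and `g` with `m` members each have the same multiset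
of values as soon as every value `f a` occurs in `g` at least as often as in `f`, because the sizes
agree. Now `f a` occurs in `f` exactly `m - #{a' | f a' ≠ f a}` times, so the condition reads `m ≤
#{b | g b = f a} + #{a' | f a' ≠ f a}`. This is a single threshold gate whose threshold does not
depend on the input, fed by comparisons between the families and by negated comparisons inside the
first family; the latter are the reason for the pairs inside `G`. For sets, OR gates in both
directions suffice. Either way a round has depth 4. Since `k` is constant, a round consists of
`O(n^2)` gates and wires for each of the `2 n^(2k)` pairs, and `n^(2k+2) ≤ n^(3k)` as `k ≥ 2`. The
final comparison applies the same criterion to all `n^k` tuples (`eval_network`, `depth_network`,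
`size_network`).

For uniformity, the gates are listed so that nested loops over vertices and rounds visit them in
order, and so that the position of each gate is a polynomial in `n`, `r n` and the loop variables. A
small loop language `Cmd` therefore suffices to print the circuit (`outputs_prog`), with all
arithmetic done by repeated increments. Its programs are compiled to a machine with binary registers
(`Cmd.Ev.sReach`); the values stay polynomial, so logarithmically many cells suffice. The number `r
n` is obtained by running the machine that constructs `r` and counting its output symbols instead of
storing them. It is polynomially bounded because a halting run in logarithmic space repeats no
configuration (`ComputesInSpace.length_le`, `card_core_le`). `logspaceComputable_of_ev` puts this
together. -/

/-! ## Space-bounded runs -/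

/-- The run from one configuration to another, all heads on work tapes staying in the first `s`
cells up to and including the last configuration. -/
inductive Transducer.SReach {Out : Type} (M : Transducer Out) (w : List Bool) (s : ℕ) :
    M.Config → M.Config → Prop
  | refl (c : M.Config) : (∀ t, c.head t < s) → SReach M w s c c
  | head (c c' c'' : M.Config) : (∀ t, c.head t < s) → M.step w c = some c' →
      SReach M w s c' c'' → SReach M w s c c''

namespace Transducer

variable {Out : Type} {M : Transducer Out} {w : List Bool} {s : ℕ}

theorem SReach.trans {a b c : M.Config} (h : M.SReach w s a b) (h' : M.SReach w s b c) :
    M.SReach w s a c := by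
  induction h with
  | refl => exact h'
  | head a b c h₁ h₂ _ ih => exact .head _ _ _ h₁ h₂ (ih h')

theorem SReach.single {a b : M.Config} (ha : ∀ t, a.head t < s) (hb : ∀ t, b.head t < s)
    (h : M.step w a = some b) : M.SReach w s a b :=
  .head _ _ _ ha h (.refl _ hb)

theorem SReach.reaches {a b : M.Config} (h : M.SReach w s a b) :
    StateTransition.Reaches (M.step w) a b := by
  induction h with
  | refl => exact .refl
  | head a b c _ h _ ih => exact .head h ih

/-- By determinism every configuration reachable from `a` lies on the run that ends in the halting
configuration `b`. One explicit run thus certifies the space bound for all reachable configurations.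
-/
theorem SReach.heads {a b : M.Config} (h : M.SReach w s a b) (hb : M.step w b = none)
    {c : M.Config} (hc : StateTransition.Reaches (M.step w) a c) : ∀ t, c.head t < s := by
  induction h with
  | refl a ha =>
    rcases Relation.ReflTransGen.cases_head hc with rfl | ⟨d, hd, _⟩
    · exact ha
    · rw [hb] at hd; cases hd
  | head a b _ ha h _ ih =>
    rcases Relation.ReflTransGen.cases_head hc with rfl | ⟨d, hd, hdc⟩
    · exact ha
    · rw [h] at hd
      cases hd
      exact ih hb hdc

theorem SReach.computesInSpace {b : M.Config} (h : M.SReach w s M.init b)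
    (hb : M.step w b = none) : M.ComputesInSpace w b.output s :=
  ⟨⟨b, h.reaches, hb, rfl⟩, fun _ hc => h.heads hb hc⟩

end Transducer

/-! ## Register machines with an auxiliary transducer -/

/-- An instruction of a register machine with registers in `R` and labels in `Q`: `mark` prepares
the tape, `scan` and `rewind` move the input head, `query` performs one step of the auxiliary
transducer, and the remaining instructions act on registers or produce output. -/
inductive Instr (R Q : Type) : Type
  | mark (q : Q)
  | scan (q₁ q₂ : Q)
  | rewind (q : Q)
  | query (q q₁ q₂ : Q)
  | inc (x : R) (q : Q)
  | clear (x : R) (q : Q)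
  | test (x y : R) (q₁ q₂ : Q)
  | print (x : R) (q : Q)
  | emit (o : DescSym) (q : Q)
  | halt

namespace Instr

/-- Renames the labels. -/
def map {R Q Q' : Type} (f : Q → Q') : Instr R Q → Instr R Q'
  | mark q => mark (f q)
  | scan q₁ q₂ => scan (f q₁) (f q₂)
  | rewind q => rewind (f q)
  | query q q₁ q₂ => query (f q) (f q₁) (f q₂)
  | inc x q => inc x (f q)
  | clear x q => clear x (f q)
  | test x y q₁ q₂ => test x y (f q₁) (f q₂)
  | print x q => print x (f q)
  | emit o q => emit o (f q)
  | halt => halt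

theorem map_map {R Q Q' Q'' : Type} (f : Q → Q') (g : Q' → Q'') (i : Instr R Q) :
    (i.map f).map g = i.map (g ∘ f) := by cases i <;> rfl

end Instr

/-- A cell of the register tape: a mark for the leftmost cell, and a binary digit, if any, for each
register. -/
abbrev Cell (R : Type) : Type := Bool × (R → Option Bool)

/-- What an instruction other than `query` does in a state that executes it: whether the sweep
returns, the next label, the movement of the input head, the new content of the cell, the movement
on the register tape, and the output. -/
def Instr.act {R Q : Type} [DecidableEq R] (q : Q) (i : InSym) (σ : Cell R) :
    Instr R Q → Option (Bool × Q × Move × Cell R × Move × Option DescSym)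
  | mark q' => some (false, q', .right, (true, σ.2), .stay, none)
  | scan q₁ q₂ => match i with
    | .letter _ => some (false, q₁, .right, σ, .stay, none)
    | _ => some (false, q₂, .stay, σ, .stay, none)
  | rewind q' => match i with
    | .leftEnd => some (false, q', .stay, σ, .stay, none)
    | _ => some (false, q, .left, σ, .stay, none)
  | query _ _ _ => none
  | inc x q' =>
    if σ.2 x = some true then
      some (false, q, .stay, (σ.1, Function.update σ.2 x (some false)), .right, none)
    else some (true, q', .stay, (σ.1, Function.update σ.2 x (some true)), .stay, none)
  | clear x q' =>
    if σ.2 x = none then some (true, q', .stay, σ, .stay, none)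
    else some (false, q, .stay, (σ.1, Function.update σ.2 x none), .right, none)
  | test x y q₁ q₂ =>
    if σ.2 x = σ.2 y then
      if σ.2 x = none then some (true, q₁, .stay, σ, .stay, none)
      else some (false, q, .stay, σ, .right, none)
    else some (true, q₂, .stay, σ, .stay, none)
  | print x q' => match σ.2 x with
    | none => some (true, q', .stay, σ, .stay, none)
    | some b => some (false, q, .stay, σ, .right, some (.bit b))
  | emit o q' => some (false, q', .stay, σ, .stay, some o)
  | halt => none

/-- The transition function of `machine`. -/
def machineTrans {R Q : Type} [DecidableEq R] (M : Transducer Bool) (P : Q → Instr R Q)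
    (st : Bool × Q × M.State) (i : InSym) (σ : Option M.Tape → Cell R × M.Sym) :
    Option ((Bool × Q × M.State) × Move × (Option M.Tape → (Cell R × M.Sym) × Move) ×
      Option DescSym) :=
  if st.1 then
    if (σ none).1.1 then some ((false, st.2), .stay, fun t => (σ t, .stay), none)
    else some (st, .stay, fun t => (σ t, t.elim .left fun _ => .stay), none)
  else match P st.2.1 with
    | .query q q₁ q₂ =>
      match M.trans st.2.2 i fun t => (σ (some t)).2 with
      | none => some ((false, q₂, st.2.2), .stay, fun t => (σ t, .stay), none)
      | some (s', mv, a, o) =>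
        some ((false, if o.isSome then q₁ else q, s'), mv, fun t =>
          t.elim (σ none, .stay) fun t => (((σ (some t)).1, (a t).1), (a t).2), none)
    | instr => (instr.act st.2.1 i (σ none).1).map fun r =>
      ((r.1, r.2.1, st.2.2), r.2.2.1, fun t =>
        t.elim ((r.2.2.2.1, (σ none).2), r.2.2.2.2.1) fun t => (σ (some t), .stay), r.2.2.2.2.2)

theorem machineTrans_of_act {R Q : Type} [DecidableEq R] {M : Transducer Bool}
    {P : Q → Instr R Q} {q : Q} {z : M.State} {i : InSym} {σ : Option M.Tape → Cell R × M.Sym}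
    {r : Bool × Q × Move × Cell R × Move × Option DescSym}
    (h : (P q).act q i (σ none).1 = some r) :
    machineTrans M P (false, q, z) i σ = some ((r.1, r.2.1, z), r.2.2.1, fun t =>
        t.elim ((r.2.2.2.1, (σ none).2), r.2.2.2.2.1) fun t => (σ (some t), .stay),
        r.2.2.2.2.2) := by
  simp only [machineTrans, Bool.false_eq_true, if_false]
  generalize P q = i at h ⊢
  cases i <;> first
    | (simp only [Instr.act, reduceCtorEq] at h; done)
    | (simp only [h, Option.map_some])

/-- The transducer that executes the program `P`. It has one tape for all registers, and the tapes
of the auxiliary transducer `M`. In the states with first component `true` the head on the register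
tape returns to the leftmost cell. -/
def machine {R Q : Type} [DecidableEq R] [Finite R] [Finite Q] (M : Transducer Bool)
    (P : Q → Instr R Q) (q₀ : Q) : Transducer DescSym where
  State := Bool × Q × M.State
  Tape := Option M.Tape
  Sym := Cell R × M.Sym
  finiteState := by have := M.finiteState; infer_instance
  finiteTape := by have := M.finiteTape; infer_instance
  finiteSym := by have := M.finiteSym; infer_instance
  start := (false, q₀, M.start)
  blank := ((false, fun _ => none), M.blank)
  trans := machineTrans M P

theorem Transducer.step_of_trans {Out : Type} {M : Transducer Out} {w : List Bool}
    {c c' : M.Config} {q : M.State} {mv : Move} {act : M.Tape → M.Sym × Move} {o : Option Out}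
    (h : M.trans c.state (inputSym w c.inputHead) (fun t => c.tape t (c.head t)) =
      some (q, mv, act, o))
    (h₁ : c'.state = q) (h₂ : c'.inputHead = min (mv.apply c.inputHead) (w.length + 1))
    (h₃ : ∀ t, c'.tape t = Function.update (c.tape t) (c.head t) (act t).1)
    (h₄ : ∀ t, c'.head t = (act t).2.apply (c.head t))
    (h₅ : c'.output = c.output ++ o.toList) : M.step w c = some c' := by
  unfold step
  rw [h]
  obtain ⟨a, b, c, d, e⟩ := c'
  obtain rfl := funext h₃
  obtain rfl := funext h₄
  subst h₁ h₂ h₅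
  rfl

/-! ### Single steps of the register machine -/

namespace machine

variable {R Q : Type} [DecidableEq R] [Finite R] [Finite Q] {M : Transducer Bool}
  {P : Q → Instr R Q} {q₀ : Q} {w : List Bool} {s : ℕ}

/-- A configuration of the machine: `a` is the configuration of the auxiliary transducer,
which shares its input head, `p` is the position on the register tape, and `T` its content. -/
def cfg (P : Q → Instr R Q) (q₀ : Q) (b : Bool) (q : Q) (a : M.Config) (p : ℕ) (T : ℕ → Cell R)
    (o : List DescSym) : (machine M P q₀).Config where
  state := (b, q, a.state)
  inputHead := a.inputHead
  tape := fun t => Option.elim (α := M.Tape) t (fun i => (T i, M.blank))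
    fun t i => ((false, fun _ => none), a.tape t i)
  head := fun t => Option.elim (α := M.Tape) t p a.head
  output := o

theorem cfg_heads {b : Bool} {q : Q} {a : M.Config} {p : ℕ} {T : ℕ → Cell R} {o : List DescSym}
    (ha : ∀ t, a.head t < s) (hp : p < s) : ∀ t, (cfg P q₀ b q a p T o).head t < s
  | none => hp
  | some t => ha t

theorem step_cfg {q : Q} {a : M.Config} {p : ℕ} {T : ℕ → Cell R} {o : List DescSym}
    {b : Bool} {q' : Q} {mv mv' : Move} {cell : Cell R} {o' : Option DescSym}
    (h : (P q).act q (Transducer.inputSym w a.inputHead) (T p) = some (b, q', mv, cell, mv', o')) :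
    (machine M P q₀).step w (cfg P q₀ false q a p T o) =
      some (cfg P q₀ b q' { a with inputHead := min (mv.apply a.inputHead) (w.length + 1) }
        (mv'.apply p) (Function.update T p cell) (o ++ o'.toList)) := by
  refine Transducer.step_of_trans (machineTrans_of_act (σ := fun t =>
    (cfg P q₀ false q a p T o).tape t ((cfg P q₀ false q a p T o).head t)) h) rfl rfl ?_ ?_ rfl
  · rintro (_ | t)
    · change (fun i => (Function.update T p cell i, M.blank)) =
        Function.update (fun i => (T i, M.blank)) p (cell, M.blank)
      funext i
      by_cases hi : i = p
      · subst hi; simp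
      · simp [hi]
    · exact (Function.update_eq_self _ _).symm
  · rintro (_ | t) <;> rfl

/-- The bound on the input head is needed because even a stationary move is clipped at the right end
marker. -/
theorem step_return {q : Q} {a : M.Config} {p : ℕ} {T : ℕ → Cell R} {o : List DescSym}
    (hin : a.inputHead ≤ w.length + 1) :
    (machine M P q₀).step w (cfg P q₀ true q a p T o) =
      some (if (T p).1 then cfg P q₀ false q a p T o else cfg P q₀ true q a (p - 1) T o) := by
  by_cases h : (T p).1 = true
  · rw [if_pos h]
    refine Transducer.step_of_trans (if_pos h) rfl ?_ (fun t => ?_) (fun t => ?_) ?_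
    · simpa [Move.apply, cfg] using hin
    · exact (Function.update_eq_self _ _).symm
    · rfl
    · simp [cfg]
  · rw [if_neg h]
    refine Transducer.step_of_trans (if_neg h) rfl ?_ (fun t => ?_) (fun t => ?_) ?_
    · simpa [Move.apply, cfg] using hin
    · simp [cfg]
    · cases t <;> rfl
    · simp [cfg]

theorem step_halt {q : Q} {a : M.Config} {p : ℕ} {T : ℕ → Cell R} {o : List DescSym}
    (h : P q = .halt) : (machine M P q₀).step w (cfg P q₀ false q a p T o) = none := by
  simp [Transducer.step, machine, machineTrans, cfg, h, Instr.act]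

theorem step_query_none {q q' q₁ q₂ : Q} {a : M.Config} {p : ℕ} {T : ℕ → Cell R}
    {o : List DescSym} (hin : a.inputHead ≤ w.length + 1)
    (hP : P q = .query q' q₁ q₂) (h : M.step w a = none) :
    (machine M P q₀).step w (cfg P q₀ false q a p T o) = some (cfg P q₀ false q₂ a p T o) := by
  unfold Transducer.step at h
  rw [Option.map_eq_none_iff] at h
  refine Transducer.step_of_trans (q := (false, q₂, a.state)) (mv := .stay)
    (act := fun t => ((cfg P q₀ false q a p T o).tape t ((cfg P q₀ false q a p T o).head t), .stay))
    (o := none) ?_ rfl ?_ (fun t => ?_) (fun t => ?_) ?_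
  · simp only [machine, machineTrans, cfg, Bool.false_eq_true, if_false, hP, Option.elim, h]
  · simpa [Move.apply, cfg] using hin
  · simp [cfg]
  · rfl
  · simp [cfg]

/-- The simulated step produces no output of its own. Whether `M` would have written a symbol is
visible only in the next label, which is what allows the symbols to be counted. -/
theorem step_query_some {q q' q₁ q₂ : Q} {a a' : M.Config} {p : ℕ} {T : ℕ → Cell R}
    {o : List DescSym} (hP : P q = .query q' q₁ q₂) (h : M.step w a = some a') :
    ∃ o' : Option Bool, a'.output = a.output ++ o'.toList ∧
    (machine M P q₀).step w (cfg P q₀ false q a p T o) =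
      some (cfg P q₀ false (if o'.isSome then q₁ else q') a' p T o) := by
  unfold Transducer.step at h
  rw [Option.map_eq_some_iff] at h
  obtain ⟨⟨s', mv, act, o'⟩, h, rfl⟩ := h
  refine ⟨o', rfl, ?_⟩
  refine Transducer.step_of_trans (mv := mv) (act := fun t =>
          Option.elim (α := M.Tape) t ((T p, M.blank), Move.stay)
            fun t => (((false, fun _ => none), (act t).1), (act t).2))
    (o := none) ?_ rfl ?_ (fun t => ?_) (fun t => ?_) ?_
  · simp only [machine, machineTrans, cfg, Bool.false_eq_true, if_false, hP, Option.elim, h]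
  · rfl
  · rcases t with _ | t
    · exact (Function.update_eq_self p fun i => (T i, M.blank)).symm
    · change (fun i => ((false, fun _ => none), Function.update (a.tape t) (a.head t) (act t).1 i)) =
        Function.update (fun i => ((false, fun _ => none), a.tape t i)) (a.head t)
          ((false, fun _ => none), (act t).1)
      funext i
      by_cases hi : i = a.head t
      · subst hi; simp
      · simp [hi]
  · cases t <;> rfl
  · simp [cfg]

end machine

/-! ## Execution of single instructions -/

/-- The binary representation of the successor of a number. -/
def incBits : List Bool → List Bool
  | [] => [true]
  | false :: l => true :: l
  | true :: l => false :: incBits l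

theorem bits_succ (n : ℕ) : (n + 1).bits = incBits n.bits := by
  induction n using Nat.strong_induction_on with
  | _ n ih =>
    rcases Nat.even_or_odd' n with ⟨m, rfl | rfl⟩
    · rw [Nat.bit1_bits]
      rcases Nat.eq_zero_or_pos m with rfl | hm
      · simp [incBits]
      · rw [Nat.bit0_bits m hm.ne']; rfl
    · rw [Nat.bit1_bits, show 2 * m + 1 + 1 = 2 * (m + 1) by ring, Nat.bit0_bits _ (by omega),
        ih m (by omega)]
      rfl

namespace machine

/-- The register tape on which cell `i` holds the digit `L x i` of register `x`. -/
def tapeOf {R : Type} (L : R → ℕ → Option Bool) (i : ℕ) : Cell R := (decide (i = 0), fun x => L x i)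

theorem update_tapeOf {R : Type} [DecidableEq R] (L : R → ℕ → Option Bool) (p : ℕ) (x : R)
    (v : Option Bool) :
    Function.update (tapeOf L) p ((tapeOf L p).1, Function.update (tapeOf L p).2 x v) =
      tapeOf (Function.update L x (Function.update (L x) p v)) := by
  funext i
  by_cases hi : i = p
  · subst hi
    simp only [Function.update_self, tapeOf, Prod.mk.injEq, true_and]
    funext y
    by_cases hy : y = x
    · subst hy; simp
    · simp [hy]
  · simp only [Function.update_of_ne hi, tapeOf, Prod.mk.injEq, true_and]
    funext y
    by_cases hy : y = x
    · subst hy; simp [hi]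
    · simp [hy]

variable {R Q : Type} [DecidableEq R] [Finite R] [Finite Q] {M : Transducer Bool}
  {P : Q → Instr R Q} {q₀ : Q} {w : List Bool} {s : ℕ}

theorem step_cfg_stay {q : Q} {a : M.Config} {p : ℕ} {T : ℕ → Cell R} {o : List DescSym}
    {b : Bool} {q' : Q} {mv' : Move} {cell : Cell R} {o' : Option DescSym}
    (hin : a.inputHead ≤ w.length + 1)
    (h : (P q).act q (Transducer.inputSym w a.inputHead) (T p) =
      some (b, q', .stay, cell, mv', o')) :
    (machine M P q₀).step w (cfg P q₀ false q a p T o) =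
      some (cfg P q₀ b q' a (mv'.apply p) (Function.update T p cell) (o ++ o'.toList)) := by
  rw [step_cfg h]
  simp only [Move.apply, min_eq_left hin]

/-- The mark that `tapeOf` puts into cell 0, and nowhere else, is what ends the movement to the
left. -/
theorem sweep_return {q : Q} {a : M.Config} (L : R → ℕ → Option Bool) (o : List DescSym)
    (hin : a.inputHead ≤ w.length + 1) (ha : ∀ t, a.head t < s) {p : ℕ} (hp : p < s) :
    (machine M P q₀).SReach w s (cfg P q₀ true q a p (tapeOf L) o)
      (cfg P q₀ false q a 0 (tapeOf L) o) := by
  induction p with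
  | zero =>
    refine .single (cfg_heads ha hp) (cfg_heads ha hp) ?_
    rw [step_return hin]
    simp [tapeOf]
  | succ p ih =>
    refine .head _ _ _ (cfg_heads ha hp) ?_ (ih (by omega))
    rw [step_return hin]
    simp [tapeOf]

/-- Stated for a sweep that has arrived at cell `p`, so that the carry can be followed by induction
on the digits still to be read: left of `p` the tape already agrees with the target `L'`, and from
`p` on the target holds the successor of what is there. The strict bound in `hs` leaves a cell for a
new leading digit. -/
theorem sweep_inc {q q' : Q} {x : R} (hP : P q = .inc x q') {a : M.Config}
    (hin : a.inputHead ≤ w.length + 1) (ha : ∀ t, a.head t < s) (o : List DescSym)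
    (l : List Bool) (L L' : R → ℕ → Option Bool) (p : ℕ) (hl : ∀ i, L x (p + i) = l[i]?)
    (h₁ : ∀ y, y ≠ x → L' y = L y) (h₂ : ∀ i < p, L' x i = L x i)
    (h₃ : ∀ i, L' x (p + i) = (incBits l)[i]?) (hs : p + l.length < s) :
    (machine M P q₀).SReach w s (cfg P q₀ false q a p (tapeOf L) o)
      (cfg P q₀ false q' a 0 (tapeOf L') o) := by
  -- The carry stops at a digit 0 or behind the last digit; one write then completes the target.
  have halted : ∀ L p, p < s → (∀ y, y ≠ x → L' y = L y) → (∀ i, i ≠ p → L' x i = L x i) →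
      L x p ≠ some true → L' x p = some true →
      (machine M P q₀).SReach w s (cfg P q₀ false q a p (tapeOf L) o)
        (cfg P q₀ false q' a 0 (tapeOf L') o) := by
    intro L p hp h₁ h₂ hx hx'
    have : L' = Function.update L x (Function.update (L x) p (some true)) := by
      funext y
      by_cases hy : y = x
      · subst hy
        funext i
        by_cases hi : i = p
        · subst hi; simp [hx']
        · simp [hi, h₂ i hi]
      · simp [hy, h₁ y hy]
    refine .head _ _ _ (cfg_heads ha hp) (step_cfg_stay (b := true) (q' := q')
      (mv' := .stay) (cell := ((tapeOf L p).1, Function.update (tapeOf L p).2 x (some true)))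
      (o' := none) hin ?_) ?_
    · rw [hP]; simp [Instr.act, tapeOf, hx]
    · rw [update_tapeOf, ← this, Option.toList_none, List.append_nil]
      exact sweep_return L' o hin ha hp
  induction l generalizing L p with
  | nil =>
    have h0 := hl 0
    refine halted L p (by simpa using hs) h₁ (fun i hi => ?_) (by simp at h0; simp [h0]) ?_
    · rcases lt_or_gt_of_ne hi with hi | hi
      · exact h₂ i hi
      · obtain ⟨j, rfl⟩ := Nat.exists_eq_add_of_lt hi
        rw [add_assoc, hl, h₃]; simp [incBits]
    · simpa [incBits] using h₃ 0
  | cons b l ih =>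
    have h0 := hl 0
    simp only [add_zero, List.getElem?_cons_zero] at h0
    simp only [List.length_cons] at hs
    cases b with
    | false =>
      refine halted L p (by omega) h₁ (fun i hi => ?_) (by simp [h0]) ?_
      · rcases lt_or_gt_of_ne hi with hi | hi
        · exact h₂ i hi
        · obtain ⟨j, rfl⟩ := Nat.exists_eq_add_of_lt hi
          rw [add_assoc, hl, h₃]; simp [incBits]
      · simpa [incBits] using h₃ 0
    | true =>
      refine .head _ _ _ (cfg_heads ha (by omega)) (step_cfg_stay (b := false) (q' := q)
        (mv' := .right) (cell := ((tapeOf L p).1, Function.update (tapeOf L p).2 x (some false)))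
        (o' := none) hin ?_) ?_
      · rw [hP]; simp [Instr.act, tapeOf, h0]
      rw [update_tapeOf, Option.toList_none, List.append_nil]
      refine ih _ (p + 1) (fun i => ?_) (fun y hy => ?_) (fun i hi => ?_) (fun i => ?_) (by omega)
      · rw [Function.update_self, Function.update_of_ne (by omega), add_right_comm, add_assoc, hl]
        simp
      · simp [hy, h₁ y hy]
      · rcases eq_or_lt_of_le (Nat.lt_succ_iff.1 hi) with rfl | hi
        · have := h₃ 0; simp [incBits] at this; simp [this]
        · simp [hi.ne, h₂ i hi]
      · rw [add_right_comm, add_assoc, h₃]; simp [incBits]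

/-- The sweep stops at the first empty cell. This erases the whole register because its digits are
contiguous from `p` on and the cells before `p` are already empty. -/
theorem sweep_clear {q q' : Q} {x : R} (hP : P q = .clear x q') {a : M.Config}
    (hin : a.inputHead ≤ w.length + 1) (ha : ∀ t, a.head t < s) (o : List DescSym)
    (l : List Bool) (L L' : R → ℕ → Option Bool) (p : ℕ) (hl : ∀ i, L x (p + i) = l[i]?)
    (h₁ : ∀ y, y ≠ x → L' y = L y) (h₂ : ∀ i < p, L x i = none) (h₃ : ∀ i, L' x i = none)
    (hs : p + l.length < s) :
    (machine M P q₀).SReach w s (cfg P q₀ false q a p (tapeOf L) o)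
      (cfg P q₀ false q' a 0 (tapeOf L') o) := by
  induction l generalizing L p with
  | nil =>
    have : L' = L := by
      funext y
      by_cases hy : y = x
      · subst hy
        funext i
        rcases lt_or_ge i p with hi | hi
        · rw [h₂ i hi, h₃]
        · obtain ⟨j, rfl⟩ := Nat.exists_eq_add_of_le hi
          rw [hl, h₃]; simp
      · exact h₁ y hy
    subst this
    have hp : p < s := by simpa using hs
    refine .head _ _ _ (cfg_heads ha hp) (step_cfg_stay (b := true) (q' := q')
      (mv' := .stay) (cell := tapeOf L' p) (o' := none) hin ?_) ?_
    · rw [hP]; simp [Instr.act, tapeOf, h₃]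
    · rw [Function.update_eq_self, Option.toList_none, List.append_nil]
      exact sweep_return L' o hin ha hp
  | cons b l ih =>
    have h0 := hl 0
    simp only [add_zero, List.getElem?_cons_zero] at h0
    simp only [List.length_cons] at hs
    refine .head _ _ _ (cfg_heads ha (by omega)) (step_cfg_stay (b := false) (q' := q)
      (mv' := .right) (cell := ((tapeOf L p).1, Function.update (tapeOf L p).2 x none))
      (o' := none) hin ?_) ?_
    · rw [hP]; simp [Instr.act, tapeOf, h0]
    rw [update_tapeOf, Option.toList_none, List.append_nil]
    refine ih _ (p + 1) (fun i => ?_) (fun y hy => ?_) (fun i hi => ?_) (by omega)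
    · rw [Function.update_self, Function.update_of_ne (by omega), add_right_comm, add_assoc, hl]
      simp
    · simp [hy, h₁ y hy]
    · rcases eq_or_lt_of_le (Nat.lt_succ_iff.1 hi) with rfl | hi
      · simp
      · simp [hi.ne, h₂ i hi]

theorem sweep_print {q q' : Q} {x : R} (hP : P q = .print x q') {a : M.Config}
    (hin : a.inputHead ≤ w.length + 1) (ha : ∀ t, a.head t < s)
    (L : R → ℕ → Option Bool) (l : List Bool) (o : List DescSym) (p : ℕ)
    (hl : ∀ i, L x (p + i) = l[i]?) (hs : p + l.length < s) :
    (machine M P q₀).SReach w s (cfg P q₀ false q a p (tapeOf L) o)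
      (cfg P q₀ false q' a 0 (tapeOf L) (o ++ l.map DescSym.bit)) := by
  induction l generalizing p o with
  | nil =>
    have hp : p < s := by simpa using hs
    have h0 := hl 0
    simp only [add_zero, List.getElem?_nil] at h0
    refine .head _ _ _ (cfg_heads ha hp) (step_cfg_stay (b := true) (q' := q')
      (mv' := .stay) (cell := tapeOf L p) (o' := none) hin ?_) ?_
    · rw [hP]; simp [Instr.act, tapeOf, h0]
    · rw [Function.update_eq_self, Option.toList_none, List.append_nil]
      simpa [Move.apply] using sweep_return L o hin ha hp
  | cons b l ih =>
    have h0 := hl 0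
    simp only [add_zero, List.getElem?_cons_zero] at h0
    simp only [List.length_cons] at hs
    refine .head _ _ _ (cfg_heads ha (by omega)) (step_cfg_stay (b := false) (q' := q)
      (mv' := .right) (cell := tapeOf L p) (o' := some (.bit b)) hin ?_) ?_
    · rw [hP]; simp [Instr.act, tapeOf, h0]
    rw [Function.update_eq_self]
    have := ih (o ++ [.bit b]) (p + 1) (fun i => by rw [add_right_comm, add_assoc, hl]; simp)
      (by omega)
    simpa [Move.apply] using this

/-- The comparison ends at the first difference, hence at the latest behind the last digit of `x`.
Only the length of the first register has to be bounded. -/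
theorem sweep_test {q q₁ q₂ : Q} {x y : R} (hP : P q = .test x y q₁ q₂) {a : M.Config}
    (hin : a.inputHead ≤ w.length + 1) (ha : ∀ t, a.head t < s)
    (L : R → ℕ → Option Bool) (o : List DescSym) (l l' : List Bool) (p : ℕ)
    (hl : ∀ i, L x (p + i) = l[i]?) (hl' : ∀ i, L y (p + i) = l'[i]?) (hs : p + l.length < s) :
    (machine M P q₀).SReach w s (cfg P q₀ false q a p (tapeOf L) o)
      (cfg P q₀ false (if l = l' then q₁ else q₂) a 0 (tapeOf L) o) := by
  have halted : ∀ p q', p < s →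
      (P q).act q (Transducer.inputSym w a.inputHead) (tapeOf L p) =
        some (true, q', .stay, tapeOf L p, .stay, none) →
      (machine M P q₀).SReach w s (cfg P q₀ false q a p (tapeOf L) o)
        (cfg P q₀ false q' a 0 (tapeOf L) o) := by
    intro p q' hp h
    refine .head _ _ _ (cfg_heads ha hp) (step_cfg_stay hin h) ?_
    rw [Function.update_eq_self, Option.toList_none, List.append_nil]
    exact sweep_return L o hin ha hp
  have h0 := hl 0
  have h0' := hl' 0
  rw [add_zero] at h0 h0'
  induction l generalizing l' p with
  | nil =>
    refine halted p _ (by simpa using hs) ?_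
    rw [hP]
    cases l' <;> simp_all [Instr.act, tapeOf]
  | cons b l ih =>
    simp only [List.length_cons] at hs
    rcases l' with _ | ⟨b', l'⟩
    · refine halted p _ (by omega) ?_
      rw [hP]; simp_all [Instr.act, tapeOf]
    · by_cases hb : b = b'
      · subst hb
        refine .head _ _ _ (cfg_heads ha (by omega)) (step_cfg_stay (b := false) (q' := q)
          (mv' := .right) (cell := tapeOf L p) (o' := none) hin ?_) ?_
        · rw [hP]; simp_all [Instr.act, tapeOf]
        rw [Function.update_eq_self, Option.toList_none, List.append_nil]
        have hx : ∀ i, L x (p + 1 + i) = l[i]? := fun i => by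
          rw [add_right_comm, add_assoc, hl]; simp
        have hy : ∀ i, L y (p + 1 + i) = l'[i]? := fun i => by
          rw [add_right_comm, add_assoc, hl']; simp
        have := ih l' (p + 1) hx hy (by omega) (by simpa using hx 0) (by simpa using hy 0)
        simpa [Move.apply] using this
      · refine halted p _ (by omega) ?_
        rw [hP]; simp_all [Instr.act, tapeOf]

/-- A configuration between two instructions, where the registers have the values `ρ`. -/
def conf (P : Q → Instr R Q) (q₀ q : Q) (a : M.Config) (ρ : R → ℕ) (o : List DescSym) :
    (machine M P q₀).Config :=
  cfg P q₀ false q a 0 (tapeOf fun x i => (ρ x).bits[i]?) o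

section

variable {q q' q₁ q₂ : Q} {x y : R} {a : M.Config} {ρ : R → ℕ}

theorem run_inc (hP : P q = .inc x q') (hin : a.inputHead ≤ w.length + 1)
    (ha : ∀ t, a.head t < s) (hρ : (ρ x).size < s) (o : List DescSym) :
    (machine M P q₀).SReach w s (conf P q₀ q a ρ o)
      (conf P q₀ q' a (Function.update ρ x (ρ x + 1)) o) := by
  refine sweep_inc hP hin ha o (ρ x).bits _ _ 0 (fun i => by simp) (fun y hy => ?_)
    (fun i hi => absurd hi (by omega)) (fun i => ?_) (by simpa [Nat.size_eq_bits_len] using hρ)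
  · simp [hy]
  · simp [bits_succ]

theorem run_clear (hP : P q = .clear x q') (hin : a.inputHead ≤ w.length + 1)
    (ha : ∀ t, a.head t < s) (hρ : (ρ x).size < s) (o : List DescSym) :
    (machine M P q₀).SReach w s (conf P q₀ q a ρ o)
      (conf P q₀ q' a (Function.update ρ x 0) o) := by
  refine sweep_clear hP hin ha o (ρ x).bits _ _ 0 (fun i => by simp) (fun y hy => ?_)
    (fun i hi => absurd hi (by omega)) (fun i => ?_) (by simpa [Nat.size_eq_bits_len] using hρ)
  · simp [hy]
  · simp

theorem run_print (hP : P q = .print x q') (hin : a.inputHead ≤ w.length + 1)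
    (ha : ∀ t, a.head t < s) (hρ : (ρ x).size < s) (o : List DescSym) :
    (machine M P q₀).SReach w s (conf P q₀ q a ρ o)
      (conf P q₀ q' a ρ (o ++ (ρ x).bits.map DescSym.bit)) :=
  sweep_print hP hin ha _ (ρ x).bits o 0 (fun i => by simp)
    (by simpa [Nat.size_eq_bits_len] using hρ)

theorem bits_injective : Function.Injective Nat.bits := fun m n h => by
  have := congrArg (fun l => Nat.ofDigits 2 (l.map fun b => cond b 1 0)) h
  simpa only [← Nat.digits_two_eq_bits, Nat.ofDigits_digits] using this

theorem run_test (hP : P q = .test x y q₁ q₂) (hin : a.inputHead ≤ w.length + 1)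
    (ha : ∀ t, a.head t < s) (hρ : (ρ x).size < s) (o : List DescSym) :
    (machine M P q₀).SReach w s (conf P q₀ q a ρ o)
      (conf P q₀ (if ρ x = ρ y then q₁ else q₂) a ρ o) := by
  have := sweep_test (q₀ := q₀) hP hin ha (fun x i => (ρ x).bits[i]?) o (ρ x).bits (ρ y).bits 0
    (fun i => by simp) (fun i => by simp) (by simpa [Nat.size_eq_bits_len] using hρ)
  simp only [bits_injective.eq_iff] at this
  exact this

theorem run_emit {o' : DescSym} (hP : P q = .emit o' q') (hin : a.inputHead ≤ w.length + 1)
    (ha : ∀ t, a.head t < s) (hs : 0 < s) (o : List DescSym) :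
    (machine M P q₀).SReach w s (conf P q₀ q a ρ o) (conf P q₀ q' a ρ (o ++ [o'])) := by
  refine .single (cfg_heads ha hs) (cfg_heads ha hs) ?_
  refine (step_cfg_stay (b := false) (q' := q') (mv' := .stay) (o' := some o')
    (cell := tapeOf (fun x i => (ρ x).bits[i]?) 0) hin ?_).trans ?_
  · rw [hP]; rfl
  · rw [Function.update_eq_self]; rfl

end

end machine

/-! ## A loop language -/

/-- Programs over immutable variables, which are numbered by the loops that bind them, and one
accumulator. The loop `loop y c` runs `c` with a new variable that ranges over the numbers below
the value of `y`; `flush` writes the accumulator in binary and clears it. -/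
inductive Cmd : Type
  | skip
  | emit (o : DescSym)
  | inc
  | flush
  | seq (c d : Cmd)
  | ifEq (x y : ℕ) (c d : Cmd)
  | loop (y : ℕ) (c : Cmd)

namespace Cmd

/-- `Ev c env a o a'`: the program `c` with values `env` of the variables and value `a` of the
accumulator writes `o` and ends with value `a'` of the accumulator. -/
inductive Ev : Cmd → List ℕ → ℕ → List DescSym → ℕ → Prop
  | skip (env : List ℕ) (a : ℕ) : Ev .skip env a [] a
  | emit (o : DescSym) (env : List ℕ) (a : ℕ) : Ev (.emit o) env a [o] a
  | inc (env : List ℕ) (a : ℕ) : Ev .inc env a [] (a + 1)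
  | flush (env : List ℕ) (a : ℕ) : Ev .flush env a (a.bits.map .bit) 0
  | seq {c d : Cmd} {env : List ℕ} {a a' a'' : ℕ} {o o' : List DescSym} :
      Ev c env a o a' → Ev d env a' o' a'' → Ev (.seq c d) env a (o ++ o') a''
  | ifEq {x y v v' : ℕ} {c d : Cmd} {env : List ℕ} {a a' : ℕ} {o : List DescSym} :
      env[x]? = some v → env[y]? = some v' → Ev (if v = v' then c else d) env a o a' →
      Ev (.ifEq x y c d) env a o a'
  | loop {y b : ℕ} {c : Cmd} {env : List ℕ} (f : ℕ → ℕ) (o : ℕ → List DescSym) :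
      env[y]? = some b → (∀ i < b, Ev c (env ++ [i]) (f i) (o i) (f (i + 1))) →
      Ev (.loop y c) env (f 0) ((List.range b).flatMap o) (f b)

/-- The nesting depth of the loops. -/
def depth : Cmd → ℕ
  | seq c d => max c.depth d.depth
  | ifEq _ _ c d => max c.depth d.depth
  | loop _ c => c.depth + 1
  | _ => 0

/-- A bound for the number of increments, if the values of the variables are at most `B`. -/
def work (B : ℕ) : Cmd → ℕ
  | inc => 1
  | seq c d => c.work B + d.work B
  | ifEq _ _ c d => c.work B + d.work B
  | loop _ c => B * c.work B
  | _ => 0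

theorem loop_bound {f : ℕ → ℕ} {b W : ℕ} (h : ∀ i < b, f (i + 1) ≤ f i + W) :
    ∀ i ≤ b, f i ≤ f 0 + i * W := by
  intro i hi
  induction i with
  | zero => simp
  | succ i ih =>
    have := h i hi
    have := ih (by omega)
    rw [Nat.succ_mul]; omega

/-- Only `inc` raises the accumulator, so it is enough to count increments. With `exists_work_le`
the accumulator stays polynomial and its binary representation logarithmic. -/
theorem Ev.le_work {B : ℕ} {c : Cmd} {env : List ℕ} {a a' : ℕ} {o : List DescSym}
    (h : Ev c env a o a') (hB : ∀ v ∈ env, v ≤ B) : a' ≤ a + c.work B := by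
  induction h with
  | skip | emit | inc => simp [work]
  | flush => simp
  | seq _ _ ih ih' =>
    have := ih hB
    have := ih' hB
    simp only [work]; omega
  | @ifEq x y v v' c d _ _ _ _ _ _ _ ih =>
    have := ih hB
    simp only [work]
    split_ifs at this <;> omega
  | @loop y b c env f o hy _ ih =>
    have hb : b ≤ B := hB b (List.mem_of_getElem? hy)
    refine (loop_bound (fun i hi => ih i hi ?_) b le_rfl).trans
      (Nat.add_le_add_left (Nat.mul_le_mul_right _ hb) _)
    intro v hv
    rcases List.mem_append.1 hv with hv | hv
    · exact hB v hv
    · rw [List.mem_singleton.1 hv]; omega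

theorem exists_work_le (c : Cmd) : ∃ d, ∀ B, c.work B ≤ (B + 2) ^ d := by
  -- The base is `B + 2` and not `B` so that it is at least 2: both summands are at most `(B + 2) ^
  -- (d + e)`, and one more factor absorbs the sum.
  have hadd : ∀ {x y B d e : ℕ}, x ≤ (B + 2) ^ d → y ≤ (B + 2) ^ e → x + y ≤ (B + 2) ^ (d + e + 1) :=
    fun {x y B d e} hx hy => by
      have h1 : (B + 2) ^ d ≤ (B + 2) ^ (d + e) := Nat.pow_le_pow_right (by omega) (by omega)
      have h2 : (B + 2) ^ e ≤ (B + 2) ^ (d + e) := Nat.pow_le_pow_right (by omega) (by omega)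
      rw [pow_succ]
      nlinarith [Nat.zero_le (B * (B + 2) ^ (d + e))]
  induction c with
  | skip | emit | flush => exact ⟨0, fun B => by simp [work]⟩
  | inc => exact ⟨0, fun B => by simp [work]⟩
  | seq c d hc hd =>
    obtain ⟨x, hx⟩ := hc
    obtain ⟨y, hy⟩ := hd
    exact ⟨x + y + 1, fun B => hadd (hx B) (hy B)⟩
  | ifEq _ _ c d hc hd =>
    obtain ⟨x, hx⟩ := hc
    obtain ⟨y, hy⟩ := hd
    exact ⟨x + y + 1, fun B => hadd (hx B) (hy B)⟩
  | loop _ c hc =>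
    obtain ⟨x, hx⟩ := hc
    refine ⟨x + 1, fun B => ?_⟩
    rw [pow_succ, mul_comm]
    exact Nat.mul_le_mul (Nat.le_add_right B 2) (hx B)

/-! ## Compilation -/

/-- The labels of the compiled program. -/
def Lab : Cmd → Type
  | flush => Bool
  | seq c d => c.Lab ⊕ d.Lab
  | ifEq _ _ c d => Option (c.Lab ⊕ d.Lab)
  | loop _ c => Fin 3 ⊕ c.Lab
  | _ => Unit

instance finite_lab (c : Cmd) : Finite c.Lab := by
  induction c with
  | skip | emit | inc => exact inferInstanceAs (Finite Unit)
  | flush => exact inferInstanceAs (Finite Bool)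
  | seq c d _ _ => exact inferInstanceAs (Finite (c.Lab ⊕ d.Lab))
  | ifEq _ _ c d _ _ => exact inferInstanceAs (Finite (Option (c.Lab ⊕ d.Lab)))
  | loop _ c _ => exact inferInstanceAs (Finite (Fin 3 ⊕ c.Lab))

/-- The label where the execution starts. -/
def entry : (c : Cmd) → c.Lab
  | skip => ()
  | emit _ => ()
  | inc => ()
  | flush => false
  | seq c _ => .inl c.entry
  | ifEq _ _ _ _ => none
  | loop _ _ => .inl 0

/-- The instructions, where `none` stands for the exit, variable `x` is kept in register `ν x`,
the accumulator in register `r`, and `m` is the number of variables bound outside. -/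
def code {R : Type} (ν : ℕ → R) (r : R) : (c : Cmd) → ℕ → c.Lab → Instr R (Option c.Lab)
  | skip, _, _ => .test r r none none
  | emit o, _, _ => .emit o none
  | inc, _, _ => .inc r none
  | flush, _, false => .print r (some true)
  | flush, _, true => .clear r none
  | seq c d, m, .inl l => (c.code ν r m l).map fun q => some (q.elim (.inr d.entry) .inl)
  | seq _ d, m, .inr l => (d.code ν r m l).map (Option.map .inr)
  | ifEq x y c d, _, none => .test (ν x) (ν y) (some (some (.inl c.entry)))
      (some (some (.inr d.entry)))
  | ifEq _ _ c _, m, some (.inl l) => (c.code ν r m l).map (Option.map fun l => some (.inl l))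
  | ifEq _ _ _ d, m, some (.inr l) => (d.code ν r m l).map (Option.map fun l => some (.inr l))
  | loop _ _, m, .inl 0 => .clear (ν m) (some (.inl 1))
  | loop y c, m, .inl 1 => .test (ν m) (ν y) none (some (.inr c.entry))
  | loop _ _, m, .inl 2 => .inc (ν m) (some (.inl 1))
  | loop _ c, m, .inr l => (c.code ν r (m + 1) l).map fun q => some (q.elim (.inl 2) .inr)

/-- The program `P` contains the compiled program, with labels renamed by `φ`, and exit `e`. -/
def Emb {R Q : Type} (ν : ℕ → R) (r : R) (P : Q → Instr R Q) (c : Cmd) (m : ℕ) (φ : c.Lab → Q)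
    (e : Q) : Prop :=
  ∀ l, P (φ l) = (c.code ν r m l).map fun q => q.elim e φ

/-- The registers hold the values of the variables and of the accumulator, and all values are at
most `D`. -/
structure Holds {R : Type} (ν : ℕ → R) (r : R) (D : ℕ) (env : List ℕ) (a : ℕ) (ρ : R → ℕ) :
    Prop where
  var : ∀ x v, env[x]? = some v → ρ (ν x) = v
  acc : ρ r = a
  le : ∀ y, ρ y ≤ D

/-! ### Correctness of the compilation -/

section

variable {R Q : Type} {M : Transducer Bool} {P : Q → Instr R Q} {q₀ : Q} {w : List Bool} {s : ℕ}
  {ν : ℕ → R} {r : R} {K D B : ℕ}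

theorem Holds.update_acc [DecidableEq R] {env : List ℕ} {a a' : ℕ} {ρ : R → ℕ} (h : Holds ν r D env a ρ)
    (hr : ∀ x < K, ν x ≠ r) (hK : env.length ≤ K) (ha : a' ≤ D) :
    Holds ν r D env a' (Function.update ρ r a') where
  var x v hx := by
    have hlt : x < env.length := by
      by_contra hlt
      rw [List.getElem?_eq_none (by omega)] at hx
      cases hx
    rw [Function.update_of_ne (hr x (by omega))]
    exact h.var x v hx
  acc := by simp
  le y := by
    by_cases hy : y = r
    · subst hy; simpa using ha
    · simpa [hy] using h.le y

theorem Holds.update_var [DecidableEq R] {env : List ℕ} {a i : ℕ} {ρ : R → ℕ} (h : Holds ν r D env a ρ)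
    (hν : ∀ x < K, ∀ y < K, ν x = ν y → x = y) (hr : ∀ x < K, ν x ≠ r) (hK : env.length < K)
    (hi : i ≤ D) : Holds ν r D (env ++ [i]) a (Function.update ρ (ν env.length) i) where
  var x v hx := by
    rw [List.getElem?_append] at hx
    split_ifs at hx with hlt
    · rw [Function.update_of_ne fun he => by have := hν _ (by omega) _ hK he; omega]
      exact h.var x v hx
    · have h0 : x = env.length := by
        by_contra h0
        rw [List.getElem?_eq_none (by simp; omega)] at hx
        cases hx
      subst h0
      simpa using hx
  acc := by
    rw [Function.update_of_ne (hr _ hK).symm]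
    exact h.acc
  le y := by
    by_cases hy : y = ν env.length
    · subst hy; simpa using hi
    · simpa [hy] using h.le y

/-- Registers beyond the environment are constrained only by the common bound `D`, so a loop
variable may keep a stale value after its loop has ended. -/
theorem Holds.of_append {env l : List ℕ} {a : ℕ} {ρ : R → ℕ} (h : Holds ν r D (env ++ l) a ρ) :
    Holds ν r D env a ρ where
  var x v hx := h.var x v (by
    rw [List.getElem?_append_left]
    · exact hx
    · by_contra hlt
      rw [List.getElem?_eq_none (by omega)] at hx
      cases hx)
  acc := h.acc
  le := h.le

-- Induction on the evaluation. The embedding `φ` and the exit `e` vary, since a subprogram sits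
-- inside the larger program with the continuation as its exit. The configuration `a` of the
-- auxiliary transducer is fixed, because compiled code contains neither queries nor movements of
-- the input head. The condition `hK` provides a separate register for each nested loop, and `hW`
-- keeps all values below `D`, hence all sweeps within `s` cells.
open machine in
theorem Ev.sReach [DecidableEq R] [Finite R] [Finite Q] {a : M.Config}
    (hin : a.inputHead ≤ w.length + 1) (ha : ∀ t, a.head t < s)
    (hν : ∀ x < K, ∀ y < K, ν x = ν y → x = y) (hr : ∀ x < K, ν x ≠ r) (hD : D.size < s)
    {c : Cmd} {env : List ℕ} {v v' : ℕ} {o : List DescSym} (h : Ev c env v o v')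
    (φ : c.Lab → Q) (e : Q) (hP : Emb ν r P c env.length φ e) (hK : env.length + c.depth ≤ K)
    (hB : ∀ x ∈ env, x ≤ B) (hW : v + c.work B ≤ D) (ρ : R → ℕ) (hρ : Holds ν r D env v ρ)
    (out : List DescSym) :
    ∃ ρ', Holds ν r D env v' ρ' ∧
      (machine M P q₀).SReach w s (conf P q₀ (φ c.entry) a ρ out) (conf P q₀ e a ρ' (out ++ o)) := by
  have size : ∀ {ρ : R → ℕ} {env : List ℕ} {v : ℕ}, Holds ν r D env v ρ → ∀ x, (ρ x).size < s :=
    fun h x => (Nat.size_le_size (h.le x)).trans_lt hD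
  induction h generalizing e ρ out with
  | skip env v =>
    refine ⟨ρ, hρ, ?_⟩
    -- `skip` is compiled to a comparison of the accumulator with itself, both of whose targets are
    -- the exit.
    have := run_test (q₀ := q₀) (hP ()) hin ha (size hρ r) out
    simpa [entry] using this
  | emit o env v =>
    exact ⟨ρ, hρ, run_emit (hP ()) hin ha (by omega) out⟩
  | inc env v =>
    refine ⟨_, hρ.update_acc hr hK (a' := v + 1) hW, ?_⟩
    have := run_inc (q₀ := q₀) (hP ()) hin ha (size hρ r) out
    rw [hρ.acc] at this
    simpa [entry] using this
  | flush env v =>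
    refine ⟨_, hρ.update_acc hr hK (Nat.zero_le D), ?_⟩
    have := run_print (q₀ := q₀) (hP false) hin ha (size hρ r) out
    rw [hρ.acc] at this
    exact this.trans (run_clear (hP true) hin ha (size hρ r) _)
  | @seq c d env v v' v'' o o' h h' ih ih' =>
    simp only [depth, work] at hK hW
    have hle := h.le_work hB
    obtain ⟨ρ₁, hρ₁, h₁⟩ := ih (fun l => φ (.inl l)) (φ (.inr d.entry)) (fun l => by
      refine (hP (.inl l)).trans ?_
      rw [code, Instr.map_map]
      congr 1; funext q; cases q <;> rfl) (by omega) hB (by omega) ρ hρ out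
    obtain ⟨ρ₂, hρ₂, h₂⟩ := ih' (fun l => φ (.inr l)) e (fun l => by
      refine (hP (.inr l)).trans ?_
      rw [code, Instr.map_map]
      congr 1; funext q; cases q <;> rfl) (by omega) hB (by omega) ρ₁ hρ₁ (out ++ o)
    refine ⟨ρ₂, hρ₂, ?_⟩
    rw [← List.append_assoc]
    exact h₁.trans h₂
  | @ifEq x y u u' c d env v v' o hx hy h ih =>
    simp only [depth, work] at hK hW
    have ht := run_test (q₀ := q₀) (hP none) hin ha (size hρ _) out
    rw [hρ.var x u hx, hρ.var y u' hy] at ht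
    -- The type of labels in the induction hypothesis depends on the conditional command. Naming the
    -- command first allows substituting the branch that is taken.
    generalize hg : (if u = u' then c else d) = g at h ih
    by_cases huv : u = u'
    · rw [if_pos huv] at hg ht
      subst hg
      obtain ⟨ρ₁, hρ₁, h₁⟩ := ih (fun l => φ (some (.inl l))) e (fun l => by
        refine (hP (some (.inl l))).trans ?_
        rw [code, Instr.map_map]
        congr 1; funext q; cases q <;> rfl) (by omega) hB (by omega) ρ hρ out
      exact ⟨ρ₁, hρ₁, ht.trans h₁⟩
    · rw [if_neg huv] at hg ht
      subst hg
      obtain ⟨ρ₁, hρ₁, h₁⟩ := ih (fun l => φ (some (.inr l))) e (fun l => by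
        refine (hP (some (.inr l))).trans ?_
        rw [code, Instr.map_map]
        congr 1; funext q; cases q <;> rfl) (by omega) hB (by omega) ρ hρ out
      exact ⟨ρ₁, hρ₁, ht.trans h₁⟩
  | @loop y b c env f o hy h ih =>
    simp only [depth, work] at hK hW
    have hbB : b ≤ B := hB b (List.mem_of_getElem? hy)
    have hbD : b ≤ D := by rw [← hρ.var y b hy]; exact hρ.le _
    have henv : ∀ i < b, ∀ x ∈ env ++ [i], x ≤ B := by
      intro i hi x hx
      rcases List.mem_append.1 hx with hx | hx
      · exact hB x hx
      · rw [List.mem_singleton.1 hx]; omega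
    have hf := loop_bound fun i hi => (h i hi).le_work (henv i hi)
    -- Loop invariant at the label of the test: `i` iterations have been completed and the loop
    -- variable has the value `i`.
    have key : ∀ i ≤ b, ∃ ρ', Holds ν r D (env ++ [i]) (f i) ρ' ∧
        (machine M P q₀).SReach w s (conf P q₀ (φ (.inl 0)) a ρ out)
          (conf P q₀ (φ (.inl 1)) a ρ' (out ++ (List.range i).flatMap o)) := by
      intro i hi
      induction i with
      | zero =>
        refine ⟨_, hρ.update_var hν hr (by omega) (Nat.zero_le D), ?_⟩
        rw [List.range_zero, List.flatMap_nil, List.append_nil]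
        exact run_clear (q₀ := q₀) (hP (.inl 0)) hin ha (size hρ _) out
      | succ i ihi =>
        obtain ⟨ρ₁, hρ₁, h₁⟩ := ihi (by omega)
        have hlen : (env ++ [i])[env.length]? = some i := by simp
        have ht := run_test (q₀ := q₀) (hP (.inl 1)) hin ha (size hρ₁ _)
          (out ++ (List.range i).flatMap o)
        rw [hρ₁.var _ i hlen, hρ₁.of_append.var y b hy, if_neg (by omega)] at ht
        -- The `i` completed iterations and the current one are `i + 1 ≤ b ≤ B` in number, so
        -- together they fit into the budget `B * c.work B` of the loop.
        have hw : f i + c.work B ≤ D := by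
          have h1 := hf i (by omega)
          have h2 : (i + 1) * c.work B ≤ B * c.work B := Nat.mul_le_mul_right _ (by omega)
          rw [Nat.succ_mul] at h2
          omega
        obtain ⟨ρ₂, hρ₂, h₂⟩ := ih i (by omega) (fun l => φ (.inr l)) (φ (.inl 2)) (fun l => by
          refine (hP (.inr l)).trans ?_
          rw [code, Instr.map_map, List.length_append]
          congr 1; funext q; cases q <;> rfl)
          (by simp only [List.length_append, List.length_singleton]; omega) (henv i (by omega)) hw
          ρ₁ hρ₁ (out ++ (List.range i).flatMap o)
        have h₃ := run_inc (q₀ := q₀) (hP (.inl 2)) hin ha (size hρ₂ _)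
          (out ++ (List.range i).flatMap o ++ o i)
        rw [hρ₂.var _ i hlen] at h₃
        refine ⟨_, hρ₂.of_append.update_var hν hr (by omega) (show i + 1 ≤ D by omega), ?_⟩
        rw [List.range_succ, List.flatMap_append, ← List.append_assoc, List.flatMap_singleton]
        exact h₁.trans (ht.trans (h₂.trans h₃))
    obtain ⟨ρ₁, hρ₁, h₁⟩ := key b le_rfl
    refine ⟨ρ₁, hρ₁.of_append, h₁.trans ?_⟩
    have ht := run_test (q₀ := q₀) (hP (.inl 1)) hin ha (size hρ₁ _)
      (out ++ (List.range b).flatMap o)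
    rwa [hρ₁.var _ b (by simp), hρ₁.of_append.var y b hy, if_pos rfl] at ht

end

end Cmd

/-! ## The output of a machine that runs in logarithmic space has polynomial length -/

namespace Transducer

variable {Out : Type} {M : Transducer Out} {w : List Bool} {s : ℕ}

/-- Two configurations agree, except possibly for the output. -/
structure Config.Agree (a b : M.Config) : Prop where
  state : a.state = b.state
  inputHead : a.inputHead = b.inputHead
  tape : a.tape = b.tape
  head : a.head = b.head

theorem Config.Agree.step_eq_none {a b : M.Config} (h : a.Agree b) :
    M.step w a = none ↔ M.step w b = none := by
  unfold step
  rw [Option.map_eq_none_iff, Option.map_eq_none_iff, h.state, h.inputHead, h.tape, h.head]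

theorem Config.Agree.step {a b a' b' : M.Config} (h : a.Agree b) (ha : M.step w a = some a')
    (hb : M.step w b = some b') : a'.Agree b' := by
  unfold Transducer.step at ha hb
  rw [h.state, h.inputHead, h.tape, h.head] at ha
  rw [Option.map_eq_some_iff] at ha hb
  obtain ⟨x, hx, rfl⟩ := ha
  obtain ⟨y, hy, rfl⟩ := hb
  rw [hx] at hy
  cases hy
  exact ⟨rfl, by simp only, by simp only, rfl⟩

theorem exists_steps {a b : M.Config} (h : StateTransition.Reaches (M.step w) a b) :
    ∃ (T : ℕ) (c : ℕ → M.Config), c 0 = a ∧ c T = b ∧ ∀ i < T, M.step w (c i) = some (c (i + 1)) := by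
  induction h with
  | refl => exact ⟨0, fun _ => a, rfl, rfl, fun i hi => absurd hi (by omega)⟩
  | @tail b d _ hd ih =>
    obtain ⟨T, c, h0, hT, hc⟩ := ih
    refine ⟨T + 1, fun i => if i ≤ T then c i else d, by simpa using h0, by simp, fun i hi => ?_⟩
    rcases Nat.lt_succ_iff_lt_or_eq.1 hi with hi | rfl
    · simpa [hi.le, Nat.succ_le_iff, hi] using hc i hi
    · simpa [hT] using hd

theorem length_output_step {a b : M.Config} (h : M.step w a = some b) :
    b.output.length ≤ a.output.length + 1 := by
  unfold step at h
  rw [Option.map_eq_some_iff] at h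
  obtain ⟨x, -, rfl⟩ := h
  rcases x with ⟨_, _, _, _ | _⟩ <;> simp

theorem output_le_of_step {a b : M.Config} (h : M.step w a = some b) :
    a.output.length ≤ b.output.length := by
  unfold step at h
  rw [Option.map_eq_some_iff] at h
  obtain ⟨x, -, rfl⟩ := h
  simp

theorem inputHead_le_of_step {a b : M.Config} (h : M.step w a = some b) :
    b.inputHead ≤ w.length + 1 := by
  unfold step at h
  rw [Option.map_eq_some_iff] at h
  obtain ⟨x, -, rfl⟩ := h
  exact min_le_right _ _

/-- The part of a configuration, without the output, that lies in the first `s` cells. -/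
abbrev Core (M : Transducer Out) (n s : ℕ) : Type :=
  M.State × Fin (n + 2) × (M.Tape → Fin s × (Fin s → M.Sym))

/-- Two configurations of a halting run cannot agree up to output, since the behavior from then on
would be the same. The number of configurations on the run is therefore bounded by the number of
cores, and each step writes at most one symbol. -/
theorem ComputesInSpace.length_le {v : List Out} (h : M.ComputesInSpace w v s) :
    v.length ≤ Nat.card (M.Core w.length s) := by
  have := M.finiteState
  have := M.finiteTape
  have := M.finiteSym
  obtain ⟨⟨b, hb, hhalt, rfl⟩, hs⟩ := h
  obtain ⟨T, c, h0, hT, hc⟩ := exists_steps hb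
  have hreach : ∀ i ≤ T, StateTransition.Reaches (M.step w) M.init (c i) := by
    intro i hi
    induction i with
    | zero => rw [h0]; exact .refl
    | succ i ih => exact (ih (by omega)).tail (hc i hi)
  have hhead : ∀ i ≤ T, ∀ t, (c i).head t < s := fun i hi => hs _ (hreach i hi)
  have hin : ∀ i ≤ T, (c i).inputHead < w.length + 2 := by
    intro i hi
    rcases i with _ | i
    · rw [h0]; simp [init]
    · exact Nat.lt_succ_of_le (inputHead_le_of_step (hc i hi))
  -- No head reaches cell `s`, so everything beyond stays blank and restricting the tapes to `s`
  -- cells loses no information.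
  have htape : ∀ i ≤ T, ∀ t, ∀ p, s ≤ p → (c i).tape t p = M.blank := by
    intro i hi
    induction i with
    | zero => rw [h0]; intros; rfl
    | succ i ih =>
      intro t p hp
      have h1 := hc i hi
      unfold step at h1
      rw [Option.map_eq_some_iff] at h1
      obtain ⟨x, -, hx⟩ := h1
      rw [← hx]
      have := hhead i (by omega) t
      simp only
      rw [Function.update_of_ne (by omega)]
      exact ih (by omega) t p hp
  have hout : ∀ i ≤ T, (c i).output.length ≤ i := by
    intro i hi
    induction i with
    | zero => rw [h0]; simp [init]
    | succ i ih =>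
      have := length_output_step (hc i hi)
      have := ih (by omega)
      omega
  -- Agreement at `i < j` persists when both indices are shifted by `T - j`. The configuration with
  -- index `i + (T - j) < T` would then have to halt, although it has a successor.
  have noAgree : ∀ i j, i < j → j ≤ T → ¬ (c i).Agree (c j) := by
    intro i j hij hjT hagree
    have hd : ∀ d, j + d ≤ T → (c (i + d)).Agree (c (j + d)) := by
      intro d hd
      induction d with
      | zero => exact hagree
      | succ d ih => exact (ih (by omega)).step (hc (i + d) (by omega)) (hc (j + d) (by omega))
    have h1 := (hd (T - j) (by omega)).step_eq_none (w := w)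
    rw [show j + (T - j) = T by omega, hT, hc _ (by omega)] at h1
    exact absurd (h1.2 hhalt) (by simp)
  let core : Fin (T + 1) → M.Core w.length s := fun i =>
    ((c i).state, ⟨(c i).inputHead, hin i (by omega)⟩, fun t =>
      (⟨(c i).head t, hhead i (by omega) t⟩, fun p => (c i).tape t p))
  have hagree : ∀ i j, core i = core j → (c i).Agree (c j) := by
    intro i j hij
    simp only [core, Prod.mk.injEq, Fin.mk.injEq, funext_iff] at hij
    refine ⟨hij.1, hij.2.1, funext fun t => funext fun p => ?_, funext fun t => (hij.2.2 t).1⟩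
    by_cases hp : p < s
    · exact (hij.2.2 t).2 ⟨p, hp⟩
    · rw [htape i (by omega) t p (by omega), htape j (by omega) t p (by omega)]
  have hinj : Function.Injective core := by
    intro i j hij
    by_contra hne
    rcases lt_or_gt_of_ne (fun h => hne (Fin.ext h) : (i : ℕ) ≠ j) with h | h
    · exact noAgree i j h (by omega) (hagree i j hij)
    · exact noAgree j i h (by omega) (hagree j i hij.symm)
  have := Nat.card_le_card_of_injective core hinj
  rw [Nat.card_eq_fintype_card, Fintype.card_fin] at this
  have h2 := hout T le_rfl
  rw [hT] at h2
  omega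

theorem card_core_le (M : Transducer Out) (c : ℕ) :
    ∃ d, ∀ n, Nat.card (M.Core n (c * (Nat.log 2 n + 1))) ≤ 2 ^ (d * (Nat.log 2 n + 1)) := by
  have := M.finiteState
  have := M.finiteTape
  have := M.finiteSym
  -- The summands belong to the factors for the state, for the `n + 2` positions of the input head,
  -- and for the heads and contents of the work tapes. Each factor is bounded by a power of 2 whose
  -- exponent is a multiple of `l`, mostly by `x < 2 ^ x`.
  refine ⟨Nat.card M.State + 2 + (c + Nat.card M.Sym * c) * Nat.card M.Tape, fun n => ?_⟩
  set l := Nat.log 2 n + 1 with hl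
  have h1 : Nat.card (M.Core n (c * l)) =
      Nat.card M.State * ((n + 2) * (c * l * Nat.card M.Sym ^ (c * l)) ^ Nat.card M.Tape) := by
    simp only [Core, Nat.card_prod, Nat.card_fun, Nat.card_eq_fintype_card, Fintype.card_fin]
  have hn : n + 2 ≤ 2 ^ (2 * l) := by
    have h2 : n < 2 ^ l := Nat.lt_pow_succ_log_self (by norm_num) n
    have h3 : 2 ≤ 2 ^ l := by
      calc 2 = 2 ^ 1 := rfl
        _ ≤ 2 ^ l := Nat.pow_le_pow_right (by norm_num) (by omega)
    rw [two_mul, pow_add]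
    nlinarith
  have hst : Nat.card M.State ≤ 2 ^ (Nat.card M.State * l) :=
    (Nat.lt_two_pow_self).le.trans
      (Nat.pow_le_pow_right (by norm_num) (Nat.le_mul_of_pos_right _ (by omega)))
  have hsy : c * l * Nat.card M.Sym ^ (c * l) ≤ 2 ^ ((c + Nat.card M.Sym * c) * l) := by
    rw [add_mul, pow_add, mul_assoc (Nat.card M.Sym), pow_mul 2 (Nat.card M.Sym)]
    exact Nat.mul_le_mul Nat.lt_two_pow_self.le (Nat.pow_le_pow_left Nat.lt_two_pow_self.le _)
  calc Nat.card (M.Core n (c * l))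
      ≤ 2 ^ (Nat.card M.State * l) * (2 ^ (2 * l) *
        (2 ^ ((c + Nat.card M.Sym * c) * l)) ^ Nat.card M.Tape) := by
        rw [h1]
        exact Nat.mul_le_mul hst (Nat.mul_le_mul hn (Nat.pow_le_pow_left hsy _))
    _ = _ := by
        rw [← pow_mul, ← pow_add, ← pow_add]
        congr 1; ring

end Transducer

/-! ## Programs run in logarithmic space -/

/-- The labels of the program that loads the length of the input and the output length of the
auxiliary transducer into registers and then runs a given program. -/
inductive LoadLab (L : Type) : Type
  | mark | scan | incLength | rewind | query | incOutput | halt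
  | main (l : L)

namespace LoadLab

instance {L : Type} [Finite L] : Finite (LoadLab L) :=
  Finite.of_injective (β := Fin 7 ⊕ L) (fun
    | mark => .inl 0 | scan => .inl 1 | incLength => .inl 2 | rewind => .inl 3 | query => .inl 4
    | incOutput => .inl 5 | halt => .inl 6 | main l => .inr l) (by
    intro a b h
    cases a <;> cases b <;> simp_all)

/-- The instructions of the loading program. -/
def code {K : ℕ} (ν : ℕ → Option (Fin K)) (c : Cmd) : LoadLab c.Lab → Instr (Option (Fin K)) (LoadLab c.Lab)
  | mark => .mark scan
  | scan => .scan incLength rewind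
  | incLength => .inc (ν 0) scan
  | rewind => .rewind query
  | query => .query query incOutput (main c.entry)
  | incOutput => .inc (ν 1) query
  | halt => .halt
  | main l => (c.code ν none 2 l).map fun q => q.elim halt main

end LoadLab

theorem Transducer.inputSym_replicate {n i : ℕ} (h : i < n) :
    Transducer.inputSym (List.replicate n true) (i + 1) = .letter true := by
  simp [Transducer.inputSym, h]

theorem Transducer.inputSym_replicate_end (n : ℕ) :
    Transducer.inputSym (List.replicate n true) (n + 1) = .rightEnd := by
  simp [Transducer.inputSym]

theorem Transducer.inputHead_le_of_reaches {Out : Type} {M : Transducer Out} {w : List Bool}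
    {a : M.Config} (h : StateTransition.Reaches (M.step w) M.init a) :
    a.inputHead ≤ w.length + 1 := by
  rcases Relation.ReflTransGen.cases_tail h with rfl | ⟨b, -, hb⟩
  · exact Nat.zero_le _
  · exact Transducer.inputHead_le_of_step hb

open machine in
theorem machine.run_move {R Q : Type} [DecidableEq R] [Finite R] [Finite Q] {M : Transducer Bool}
    {P : Q → Instr R Q} {q₀ : Q} {w : List Bool} {s : ℕ} {q q' : Q} {a : M.Config} {mv : Move}
    (hP : ∀ σ, (P q).act q (Transducer.inputSym w a.inputHead) σ =
      some (false, q', mv, σ, .stay, none)) {i : ℕ} (hi : i = min (mv.apply a.inputHead) (w.length + 1))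
    (ha : ∀ t, a.head t < s) (hs : 0 < s) (ρ : R → ℕ) (o : List DescSym) :
    (machine M P q₀).SReach w s (conf P q₀ q a ρ o)
      (conf P q₀ q' { a with inputHead := i } ρ o) := by
  refine .single (cfg_heads ha hs) (cfg_heads (a := { a with inputHead := i }) ha hs) ?_
  refine (step_cfg (hP _)).trans ?_
  rw [Function.update_eq_self, Option.toList_none, List.append_nil, ← hi]
  rfl

/-! ### The loading phase: the input length and the value of `r` enter registers -/

namespace LoadLab

open machine

variable {M : Transducer Bool} {K : ℕ} {ν : ℕ → Option (Fin K)} {c : Cmd} {n s : ℕ}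

/-- The content of the registers of the loading program. -/
def regs (ν : ℕ → Option (Fin K)) (n j : ℕ) : Option (Fin K) → ℕ :=
  Function.update (Function.update (fun _ => 0) (ν 0) n) (ν 1) j

theorem regs_inc_fst (h : ν 0 ≠ ν 1) (n : ℕ) :
    Function.update (regs ν n 0) (ν 0) (regs ν n 0 (ν 0) + 1) = regs ν (n + 1) 0 := by
  have : regs ν n 0 (ν 0) = n := by simp [regs, h]
  rw [this, regs, Function.update_comm h.symm, Function.update_idem]
  rfl

theorem regs_inc_snd (n j : ℕ) :
    Function.update (regs ν n j) (ν 1) (regs ν n j (ν 1) + 1) = regs ν n (j + 1) := by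
  simp [regs]

theorem regs_le {n j D : ℕ} (hn : n ≤ D) (hj : j ≤ D) (y : Option (Fin K)) : regs ν n j y ≤ D := by
  simp only [regs, Function.update_apply]
  split_ifs <;> omega

theorem sReach_scan (hs : n.size < s) (hν : ν 0 ≠ ν 1) (hM : ∀ t, (M.init).head t < s) :
    ∀ i ≤ n, (machine M (code ν c) mark).SReach (List.replicate n true) s
      (machine M (code ν c) mark).init
      (conf (code ν c) mark scan { M.init with inputHead := i + 1 } (regs ν i 0) []) := by
  intro i hi
  have hregs : regs ν 0 0 = fun _ => 0 := by
    simp only [regs]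
    rw [Function.update_eq_self_iff.2, Function.update_eq_self_iff.2] <;> simp
  induction i with
  | zero =>
    -- The blank tape carries no mark in cell 0, so the initial configuration is not of the form
    -- `conf`; the first instruction repairs this.
    have hinit : (machine M (code ν c) mark).init =
        cfg (code ν c) mark false mark M.init 0 (fun _ => (false, fun _ => none)) [] := by
      unfold Transducer.init cfg
      congr 1 <;> (funext t; cases t <;> rfl)
    rw [hinit]
    refine .single (cfg_heads hM (by omega))
      (cfg_heads (a := { M.init with inputHead := 0 + 1 }) hM (by omega)) ?_
    refine (step_cfg (b := false) (q' := scan) (mv := .right) (mv' := .stay)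
      (cell := (true, fun _ => none)) (o' := none) rfl).trans ?_
    have : Function.update (fun _ => (false, fun _ => none)) 0 (true, fun _ => none) =
        tapeOf fun (x : Option (Fin K)) i => (regs ν 0 0 x).bits[i]? := by
      rw [hregs]
      funext i
      by_cases h : i = 0
      · subst h; simp [tapeOf]
      · simp [tapeOf, h]
    rw [this]
    have hmin : min (Move.right.apply (M.init).inputHead) ((List.replicate n true).length + 1) =
        0 + 1 := by simp [Move.apply, Transducer.init]
    rw [hmin]
    rfl
  | succ i ih =>
    refine (ih (by omega)).trans ?_
    refine (run_move (a := { M.init with inputHead := i + 1 }) (q' := incLength) (mv := .right)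
      (i := i + 1 + 1) (fun σ => ?_) ?_ hM
      (by omega) _ _).trans ?_
    · rw [Transducer.inputSym_replicate (by omega)]
      rfl
    · simp [Move.apply]; omega
    · rw [← regs_inc_fst hν]
      refine run_inc (P := code ν c) (q := incLength) (a := { M.init with inputHead := i + 1 + 1 }) rfl
        (by rw [List.length_replicate]; simp only; omega) hM ?_ []
      exact (Nat.size_le_size (regs_le (show i ≤ n by omega) (Nat.zero_le n) _)).trans_lt hs

/-- The auxiliary transducer uses the same input head, which has to be back at the left end before
`M` can be run from its initial configuration. -/
theorem sReach_rewind (hs : 0 < s) (hM : ∀ t, (M.init).head t < s) :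
    ∀ i ≤ n + 1, (machine M (code ν c) mark).SReach (List.replicate n true) s
      (conf (code ν c) mark rewind { M.init with inputHead := i } (regs ν n 0) [])
      (conf (code ν c) mark query M.init (regs ν n 0) []) := by
  intro i hi
  induction i with
  | zero =>
    exact run_move (a := { M.init with inputHead := 0 }) (mv := .stay) (i := 0) (fun σ => rfl)
      (by simp [Move.apply]) hM hs _ _
  | succ i ih =>
    refine (run_move (a := { M.init with inputHead := i + 1 }) (q' := rewind) (mv := .left) (i := i)
      (fun σ => ?_) ?_ hM hs _ _).trans
      (ih (by omega))
    · simp only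
      rcases Nat.lt_or_ge i n with h | h
      · rw [Transducer.inputSym_replicate h]; rfl
      · obtain rfl : i = n := by omega
        rw [Transducer.inputSym_replicate_end]; rfl
    · simp [Move.apply]; omega

/-- The run of `M` is simulated step by step while a register counts its output; the output itself
may be too long to be stored. The induction goes backwards from the halting configuration, and the
monotonicity of the output length in the first conclusion bounds the counter by its final value. -/
theorem sReach_query {b : M.Config} (hn : n.size < s) (hb : b.output.length.size < s)
    (hM : ∀ a, StateTransition.Reaches (M.step (List.replicate n true)) M.init a →
      ∀ t, a.head t < s)
    (hhalt : M.step (List.replicate n true) b = none) {a : M.Config}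
    (hab : StateTransition.Reaches (M.step (List.replicate n true)) a b)
    (ha : StateTransition.Reaches (M.step (List.replicate n true)) M.init a) :
    a.output.length ≤ b.output.length ∧
    (machine M (code ν c) mark).SReach (List.replicate n true) s
      (conf (code ν c) mark query a (regs ν n a.output.length) [])
      (conf (code ν c) mark (main c.entry) b (regs ν n b.output.length) []) := by
  have hs : 0 < s := by omega
  induction hab using Relation.ReflTransGen.head_induction_on with
  | refl =>
    refine ⟨le_rfl, .single (cfg_heads (hM _ ha) hs) (cfg_heads (hM _ ha) hs) ?_⟩
    exact step_query_none (Transducer.inputHead_le_of_reaches ha) rfl hhalt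
  | @head a a' h _ ih =>
    have ha' := ha.tail h
    obtain ⟨hle, hreach⟩ := ih ha'
    refine ⟨(Transducer.output_le_of_step h).trans hle, ?_⟩
    obtain ⟨o', ho', hstep⟩ := step_query_some (P := code ν c) (q₀ := mark) (q := query)
      (T := tapeOf fun x i => (regs ν n a.output.length x).bits[i]?) (p := 0) (o := []) rfl h
    refine .trans (.single (cfg_heads (hM _ ha) hs) (cfg_heads (hM _ ha') hs) hstep) ?_
    cases o' with
    | none =>
      rw [Option.toList_none, List.append_nil] at ho'
      rw [ho'] at hreach
      exact hreach
    | some v =>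
      refine .trans ?_ hreach
      have hlen : a'.output.length = a.output.length + 1 := by simp [ho']
      rw [hlen, ← regs_inc_snd]
      refine run_inc (P := code ν c) (q := incOutput) rfl (Transducer.inputHead_le_of_reaches ha') (hM _ ha') ?_ []
      rcases le_total n b.output.length with h' | h'
      · exact (Nat.size_le_size (regs_le h' (by omega) _)).trans_lt hb
      · exact (Nat.size_le_size (regs_le le_rfl (by omega) _)).trans_lt hn

end LoadLab

-- The inputs `n` and `r n` of the program are at most `2 ^ O(log n)`, the latter by `length_le` and
-- `card_core_le`. The program multiplies the exponent only by a constant, so all registers have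
-- logarithmic length.
open machine LoadLab in
theorem logspaceComputable_of_ev {r : ℕ → ℕ} (hr : LogspaceConstructible r) (c : Cmd)
    (f : ℕ → List DescSym) (h : ∀ n, ∃ a, c.Ev [n, r n] 0 (f n) a) : LogspaceComputable f := by
  obtain ⟨M, c₀, hM⟩ := hr
  obtain ⟨d, hd⟩ := M.card_core_le c₀
  obtain ⟨e, he⟩ := c.exists_work_le
  -- Two registers for `n` and `r n`, one for each level of nested loops, and `none` for the
  -- accumulator.
  let ν : ℕ → Option (Fin (c.depth + 2)) := fun x => some (Fin.ofNat _ x)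
  have hν : ∀ x < c.depth + 2, ∀ y < c.depth + 2, ν x = ν y → x = y := by
    intro x hx y hy hxy
    simp only [ν, Option.some.injEq, Fin.ofNat, Fin.mk.injEq] at hxy
    rwa [Nat.mod_eq_of_lt hx, Nat.mod_eq_of_lt hy] at hxy
  have hν' : ∀ x < c.depth + 2, ν x ≠ none := by simp [ν]
  have hν01 : ν 0 ≠ ν 1 := fun h => absurd (hν 0 (by omega) 1 (by omega) h) (by omega)
  -- The product bounds the length of the registers, the summand 1 makes this bound strict, and `c₀`
  -- accounts for the work tapes of `M`.
  refine ⟨machine M (code ν c) mark, (d + 2) * (e + 1) + 1 + c₀, fun n => ?_⟩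
  set l := Nat.log 2 n + 1 with hl
  set s := ((d + 2) * (e + 1) + 1 + c₀) * l with hs
  have hcomp := hM n
  have hlen := hcomp.length_le
  simp only [List.length_replicate] at hlen
  replace hlen := hlen.trans (hd n)
  set B := max n (r n) with hB
  have hBl : B + 2 ≤ 2 ^ ((d + 2) * l) := by
    have h1 : n < 2 ^ l := Nat.lt_pow_succ_log_self (by norm_num) n
    have h2 : B ≤ 2 ^ ((d + 1) * l) := max_le
      (h1.le.trans (Nat.pow_le_pow_right (by norm_num) (Nat.le_mul_of_pos_left _ (by omega))))
      (hlen.trans (Nat.pow_le_pow_right (by norm_num) (Nat.mul_le_mul_right _ (by omega))))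
    have h3 : 2 ^ ((d + 1) * l + 1) ≤ 2 ^ ((d + 2) * l) :=
      Nat.pow_le_pow_right (by norm_num) (by nlinarith)
    have h4 : 2 ^ 1 ≤ 2 ^ ((d + 1) * l) := Nat.pow_le_pow_right (by norm_num) (by nlinarith)
    rw [pow_succ] at h3
    omega
  set D := B + c.work B with hD
  have hDs : D.size < s := by
    have h1 : D < 2 ^ ((d + 2) * (e + 1) * l) := by
      calc D ≤ B + (B + 2) ^ e := Nat.add_le_add_left (he B) B
        _ < (B + 2) ^ (e + 1) := by
          have : 1 ≤ (B + 2) ^ e := Nat.one_le_pow _ _ (by omega)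
          rw [pow_succ]; nlinarith
        _ ≤ (2 ^ ((d + 2) * l)) ^ (e + 1) := Nat.pow_le_pow_left hBl _
        _ = _ := by rw [← pow_mul]; congr 1; ring
    have h2 := Nat.size_le.2 h1
    have h3 : s = (d + 2) * (e + 1) * l + l + c₀ * l := by rw [hs]; ring
    omega
  have hnD : n ≤ D := (le_max_left n (r n)).trans (Nat.le_add_right _ _)
  have hrD : r n ≤ D := (le_max_right n (r n)).trans (Nat.le_add_right _ _)
  have hns := (Nat.size_le_size hnD).trans_lt hDs
  have hrs := (Nat.size_le_size hrD).trans_lt hDs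
  obtain ⟨⟨b, hb, hhalt, hout⟩, hheads⟩ := hcomp
  have hbl : b.output.length = r n := by rw [hout, List.length_replicate]
  have hheads' : ∀ a, StateTransition.Reaches (M.step (List.replicate n true)) M.init a →
      ∀ t, a.head t < s := fun a ha t =>
    (hheads a ha t).trans_le (Nat.mul_le_mul_right _ (by omega))
  have hinit := hheads' _ .refl
  have h1 := sReach_scan (c := c) hns hν01 hinit n le_rfl
  have h2 : (machine M (code ν c) mark).SReach (List.replicate n true) s
      (conf (code ν c) mark scan { M.init with inputHead := n + 1 } (regs ν n 0) [])
      (conf (code ν c) mark rewind { M.init with inputHead := n + 1 } (regs ν n 0) []) :=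
    run_move (a := { M.init with inputHead := n + 1 }) (mv := .stay) (i := n + 1)
      (fun σ => by simp only; rw [Transducer.inputSym_replicate_end]; rfl)
      (by simp [Move.apply]) hinit (by omega) _ _
  have h3 := sReach_rewind (c := c) (ν := ν) (n := n) (show 0 < s by omega) hinit (n + 1) le_rfl
  have h4 := (sReach_query (c := c) (ν := ν) hns (by rwa [hbl]) hheads' hhalt hb .refl).2
  rw [hbl] at h4
  obtain ⟨a, ha⟩ := h n
  have hmem : ∀ v ∈ [n, r n], v ≤ B := by simp [hB]
  have hρ : Cmd.Holds ν none D [n, r n] 0 (regs ν n (r n)) := by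
    refine ⟨fun x v hx => ?_, ?_, regs_le hnD hrD⟩
    · rcases x with _ | _ | x
      · simpa [regs, hν01] using hx
      · simpa [regs] using hx
      · simp at hx
    · simp [regs, ν]
  obtain ⟨ρ, -, h5⟩ := ha.sReach (M := M) (P := code ν c) (q₀ := mark) (K := c.depth + 2) (D := D)
    (B := B) (r := none)
    (Transducer.inputHead_le_of_reaches hb) (hheads' b hb) hν hν' hDs main halt (fun l => rfl)
    (by simp; omega) hmem (by omega) (regs ν n (r n)) hρ []
  have h6 := ((((h1.trans h2).trans h3).trans h4).trans h5)
  have := h6.computesInSpace (step_halt rfl)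
  simpa [conf, cfg] using this

/-! ## Listings -/

/-- An enumeration of a type: a list of all elements, and the position of each of them. -/
class Listing (α : Type) where
  list : List α
  idx : α → ℕ
  map_idx : list.map idx = List.range list.length
  mem_list : ∀ a, a ∈ list

namespace Listing

variable {α β : Type} [Listing α] [Listing β]

/-- The number of elements. -/
def card (α : Type) [Listing α] : ℕ := (list (α := α)).length

theorem idx_getElem (i : ℕ) (h : i < (list (α := α)).length) : idx ((list (α := α))[i]) = i := by
  have h1 : ((list (α := α)).map idx)[i]? = (List.range (list (α := α)).length)[i]? := by
    rw [map_idx]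
  simpa [h] using h1

theorem exists_getElem (a : α) : ∃ h : idx a < (list (α := α)).length, (list (α := α))[idx a] = a := by
  obtain ⟨i, hi, rfl⟩ := List.getElem_of_mem (mem_list a)
  rw [idx_getElem]
  exact ⟨hi, rfl⟩

theorem idx_lt (a : α) : idx a < card α := (exists_getElem a).1

theorem nodup_list : (list (α := α)).Nodup :=
  List.Nodup.of_map idx (by rw [map_idx]; exact List.nodup_range)

theorem countP_list [Fintype α] (p : α → Bool) :
    (list (α := α)).countP p = (Finset.univ.filter fun a => p a = true).card := by
  classical
  have : (Finset.univ : Finset α) = (list (α := α)).toFinset := by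
    ext a; simp [mem_list a]
  rw [this, ← List.toFinset_filter, List.toFinset_card_of_nodup (nodup_list.filter _),
    List.countP_eq_length_filter]

instance (n : ℕ) : Listing (Fin n) where
  list := List.finRange n
  idx := Fin.val
  map_idx := by simp
  mem_list := List.mem_finRange

instance : Listing Unit where
  list := [()]
  idx _ := 0
  map_idx := rfl
  mem_list _ := by simp

theorem range_mul_flatMap (a b : ℕ) :
    List.range (a * b) = (List.range a).flatMap fun i => (List.range b).map fun j => i * b + j := by
  induction a with
  | zero => simp
  | succ a ih => rw [Nat.succ_mul, List.range_add, ih, List.range_succ, List.flatMap_append]; simp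

/-- This is the order in which two nested loops visit the pairs, and the position is polynomial in
the positions of the components. Uniformity rests on both facts. -/
instance : Listing (α × β) where
  list := (list (α := α)).flatMap fun a => (list (α := β)).map fun b => (a, b)
  idx p := idx p.1 * card β + idx p.2
  map_idx := by
    have h : ∀ a : α, ((list (α := β)).map fun b => (a, b)).map
        (fun p : α × β => idx p.1 * card β + idx p.2) =
        (List.range (card β)).map fun j => idx a * card β + j := by
      intro a
      rw [card, ← map_idx, List.map_map, List.map_map]
      rfl
    rw [List.map_flatMap]
    simp only [h]
    have h2 : ((list (α := α)).flatMap fun a => (list (α := β)).map fun b => (a, b)).length =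
        (list (α := α)).length * card β := by
      simp [List.length_flatMap, card]
    rw [h2, range_mul_flatMap, ← map_idx (α := α), List.flatMap_map]
  mem_list p := by simp [mem_list]

instance : Listing (α ⊕ β) where
  list := (list (α := α)).map .inl ++ (list (α := β)).map .inr
  idx := Sum.elim idx fun b => card α + idx b
  map_idx := by
    rw [List.map_append, List.map_map, List.map_map, Sum.elim_comp_inl, Sum.elim_comp_inr,
      List.length_append, List.length_map, List.length_map, List.range_add, map_idx,
      ← map_idx (α := β), List.map_map]
    rfl
  mem_list p := by cases p <;> simp [mem_list]

/-- Transport of a listing along a bijection. -/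
@[reducible] def ofEquiv {γ : Type} (e : α ≃ γ) : Listing γ where
  list := (list (α := α)).map e
  idx c := idx (e.symm c)
  map_idx := by rw [List.map_map, List.length_map, ← map_idx]; congr 1; funext a; simp
  mem_list c := by rw [List.mem_map]; exact ⟨e.symm c, mem_list _, by simp⟩

/-- Tuples are listed with the last entry running fastest. -/
@[reducible] def tuple (α : Type) [Listing α] : (k : ℕ) → Listing (Fin k → α)
  | 0 => ofEquiv (Equiv.ofUnique Unit (Fin 0 → α))
  | k + 1 =>
    have := tuple α k
    ofEquiv (((Equiv.prodComm _ _).trans (Fin.snocEquiv fun _ => α)))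

instance (k : ℕ) : Listing (Fin k → α) := tuple α k

theorem list_tuple_zero : (list : List (Fin 0 → α)) = [Fin.elim0] := by
  change [_] = _
  congr 1

theorem list_tuple_succ (k : ℕ) : (list : List (Fin (k + 1) → α)) =
    (list : List (Fin k → α)).flatMap fun u => (list : List α).map fun a => Fin.snoc u a := by
  change List.map _ (List.flatMap _ _) = _
  rw [List.map_flatMap]
  simp only [List.map_map]
  rfl

theorem idx_tuple_succ (k : ℕ) (u : Fin (k + 1) → α) :
    idx u = idx (fun j => u (Fin.castSucc j)) * card α + idx (u (Fin.last k)) := rfl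

theorem card_fin (n : ℕ) : card (Fin n) = n := by simp [card, list]
theorem card_unit : card Unit = 1 := rfl
theorem card_prod : card (α × β) = card α * card β := by
  simp [card, list, List.length_flatMap]
theorem card_sum : card (α ⊕ β) = card α + card β := by simp [card, list]
theorem card_tuple (k : ℕ) : card (Fin k → α) = card α ^ k := by
  induction k with
  | zero => rfl
  | succ k ih =>
    have : card (Fin (k + 1) → α) = card (Fin k → α) * card α := by
      simp only [card, list_tuple_succ]
      simp [List.length_flatMap]
    rw [this, ih, pow_succ]

theorem idx_fin {n : ℕ} (i : Fin n) : idx i = i := rfl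
theorem idx_prod (a : α) (b : β) : idx (a, b) = idx a * card β + idx b := rfl
theorem idx_inl (a : α) : idx (Sum.inl a : α ⊕ β) = idx a := rfl
theorem idx_inr (b : β) : idx (Sum.inr b : α ⊕ β) = card α + idx b := rfl

theorem idx_prod_lt_right (a : α) {b b' : β} (h : idx b < idx b') : idx (a, b) < idx (a, b') := by
  rw [idx_prod, idx_prod]; omega

theorem idx_inl_lt_inr (a : α) (b : β) : idx (Sum.inl a : α ⊕ β) < idx (Sum.inr b : α ⊕ β) := by
  have := idx_lt a
  rw [idx_inl, idx_inr]; omega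

end Listing

/-! ## Circuits with listed gates -/

/-- By acyclicity the default `d` is never read, so a relation that passes from the predecessors to
the gate holds everywhere. It is applied to values, with equality, and to depths, with `≤`. -/
theorem Circuit.scan_rel {m : ℕ} {α : Type} (d : α) (f : Gate m → (ℕ → α) → α)
    (Rel : ℕ → α → Prop) (gs : List (Gate m))
    (hacyc : ∀ (i : ℕ) (h : i < gs.length), ∀ j ∈ (gs[i]).preds, j < i)
    (h : ∀ (i : ℕ) (hi : i < gs.length) (v : ℕ → α),
      (∀ j ∈ (gs[i]).preds, Rel j (v j)) → Rel i (f gs[i] v)) :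
    (scan d f gs).length = gs.length ∧ ∀ i < gs.length, Rel i ((scan d f gs).getD i d) := by
  induction gs using List.reverseRecOn with
  | nil => simp [scan]
  | append_singleton gs g ih =>
    have hscan : scan d f (gs ++ [g]) = scan d f gs ++ [f g fun j => (scan d f gs).getD j d] := by
      simp [scan]
    have hget : ∀ (i : ℕ) (hi : i < gs.length), (gs ++ [g])[i]'(by simp; omega) = gs[i] :=
      fun i hi => List.getElem_append_left hi
    obtain ⟨hl, hr⟩ := ih (fun i hi => by
        have := hacyc i (by simp; omega); rwa [hget i hi] at this) (fun i hi => by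
        have := h i (by simp; omega); rwa [hget i hi] at this)
    refine ⟨by rw [hscan]; simp [hl], fun i hi => ?_⟩
    rw [hscan]
    rcases Nat.lt_succ_iff_lt_or_eq.1 (by simpa using hi : i < gs.length + 1) with hi | rfl
    · rw [List.getD_append _ _ _ _ (by omega)]
      exact hr i hi
    · rw [List.getD_append_right _ _ _ _ (by omega), hl, Nat.sub_self, List.getD_cons_zero]
      have hg : (gs ++ [g])[gs.length]'(by simp) = g := by simp
      have h1 := h gs.length (by simp)
      have h2 := hacyc gs.length (by simp)
      rw [hg] at h1 h2
      exact h1 _ fun j hj => hr j (h2 j hj)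

/-- Gates with positions given by a listing. -/
structure Network (m : ℕ) (α : Type) [Listing α] : Type where
  gate : α → Gate m
  preds : α → List α
  map_preds : ∀ a, (preds a).map Listing.idx = (gate a).preds
  lt : ∀ a, ∀ b ∈ preds a, Listing.idx b < Listing.idx a
  out : α
  idx_out : Listing.idx out + 1 = Listing.card α

namespace Network

open Listing

variable {m : ℕ} {α : Type} [Listing α] (N : Network m α)

/-- The circuit that consists of the gates of the network. -/
def circuit : Circuit m where
  gates := (list (α := α)).map N.gate
  nonempty := by
    have := List.ne_nil_of_mem (mem_list N.out)
    simpa using this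
  acyclic i h j hj := by
    rw [List.length_map] at h
    rw [List.getElem_map, ← N.map_preds, List.mem_map] at hj
    obtain ⟨b, hb, rfl⟩ := hj
    have := N.lt _ b hb
    rwa [idx_getElem] at this

theorem circuit_rel {γ : Type} (d : γ) (f : Gate m → (ℕ → γ) → γ) (Rel : α → γ → Prop)
    (h : ∀ a (v : ℕ → γ), (∀ b ∈ N.preds a, Rel b (v (idx b))) → Rel a (f (N.gate a) v)) :
    (Circuit.scan d f N.circuit.gates).length = card α ∧
      ∀ a, Rel a ((Circuit.scan d f N.circuit.gates).getD (idx a) d) := by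
  have hlen : N.circuit.gates.length = card α := by simp [circuit, card]
  obtain ⟨h1, h2⟩ := Circuit.scan_rel d f (fun i x => ∀ a, idx a = i → Rel a x) N.circuit.gates
    N.circuit.acyclic (fun i hi v hv a ha => by
      subst ha
      obtain ⟨h3, h4⟩ := exists_getElem a
      have h5 : N.circuit.gates[idx a] = N.gate a := by
        simp [circuit, h4]
      rw [h5] at hv ⊢
      exact h a v fun b hb => hv (idx b) (by rw [← N.map_preds]; exact List.mem_map_of_mem hb) b rfl)
  exact ⟨h1.trans hlen, fun a => h2 (idx a) (by rw [hlen]; exact idx_lt a) a rfl⟩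

theorem eval_circuit (x : Fin m → Bool) (val : α → Bool)
    (h : ∀ a (v : ℕ → Bool), (∀ b ∈ N.preds a, v (idx b) = val b) → (N.gate a).eval x v = val a) :
    N.circuit.eval x = val N.out := by
  obtain ⟨h1, h2⟩ := N.circuit_rel false (Gate.eval x) (fun a v => v = val a) h
  rw [← h2, Circuit.eval]
  have h3 := N.idx_out
  rw [List.getLastD_eq_getLast?, List.getLast?_eq_getElem?, h1, ← h3, Nat.add_sub_cancel,
    List.getD_eq_getElem?_getD]

/-- A gate other than an input has depth at least 1 even if no wire enters it, hence the requirement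
of a positive level. -/
theorem depth_circuit (lev : α → ℕ) (L : ℕ) (hL : ∀ a, lev a ≤ L)
    (h : ∀ a, (∀ b ∈ N.preds a, lev b < lev a) ∧
      ((∃ i, N.gate a = .input i) ∨ 0 < lev a)) :
    N.circuit.depth ≤ L := by
  obtain ⟨h1, h2⟩ := N.circuit_rel 0 Gate.depth (fun a v => v ≤ lev a) (fun a v hv => by
    obtain ⟨h3, h4⟩ := h a
    have key : ∀ l : List ℕ, l = (N.preds a).map idx → 0 < lev a →
        (l.map v).foldr max 0 + 1 ≤ lev a := by
      rintro l rfl h0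
      have : ∀ l : List α, (∀ b ∈ l, b ∈ N.preds a) →
          ((l.map idx).map v).foldr max 0 < lev a := by
        intro l hl
        induction l with
        | nil => simpa using h0
        | cons b l ih =>
          have := hv b (hl b (by simp))
          have := h3 b (hl b (by simp))
          have := ih fun b hb => hl b (by simp [hb])
          simp only [List.map_cons, List.foldr_cons]
          omega
      exact this _ fun b hb => hb
    have hp := N.map_preds a
    cases hg : N.gate a with
    | input i => simp [Gate.depth]
    | not j =>
      rw [hg] at hp
      have h5 := hv
      cases hpa : N.preds a with
      | nil => rw [hpa] at hp; simp [Gate.preds] at hp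
      | cons b l =>
        rw [hpa] at hp
        simp only [Gate.preds, List.map_cons, List.cons.injEq] at hp
        have := hv b (by simp [hpa])
        have := h3 b (by simp [hpa])
        rw [← hp.1]
        simp only [Gate.depth]
        omega
    | and l | or l | threshold t l =>
      rw [hg] at hp
      simp only [hg, reduceCtorEq, exists_false, false_or] at h4
      exact key l hp.symm h4)
  rw [Circuit.depth]
  have h3 : ∀ v ∈ Circuit.scan 0 Gate.depth N.circuit.gates, v ≤ L := by
    intro v hv
    obtain ⟨i, hi, rfl⟩ := List.getElem_of_mem hv
    rw [h1] at hi
    have h4 := h2 ((list (α := α))[i])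
    rw [idx_getElem i hi, List.getD_eq_getElem _ _ (by omega)] at h4
    exact h4.trans (hL _)
  generalize Circuit.scan 0 Gate.depth N.circuit.gates = l at h3
  induction l with
  | nil => simp
  | cons v l ih =>
    simp only [List.foldr_cons]
    exact max_le (h3 v (by simp)) (ih fun v hv => h3 v (by simp [hv]))

theorem size_circuit :
    N.circuit.size = ((list (α := α)).map fun a => 1 + (N.preds a).length).sum := by
  have : ∀ a, (N.gate a).preds.length = (N.preds a).length := fun a => by
    rw [← N.map_preds, List.length_map]
  rw [Circuit.size, circuit]
  simp only [List.map_map, List.length_map]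
  rw [List.sum_map_add]
  simp [Function.comp_def, this]

theorem describe_circuit : N.circuit.describe = (list (α := α)).flatMap fun a => (N.gate a).describe := by
  simp [Circuit.describe, circuit, List.flatMap_map]

end Network

/-! ## The network of the Weisfeiler-Lehman algorithm -/

namespace WL

open Listing

/-- Tuples of vertices. -/
abbrev Tup (k n : ℕ) : Type := Fin k → Fin n

/-- A tuple of the first graph, and a tuple of the graph with the given number. -/
abbrev Pair (k n : ℕ) : Type := Fin 2 × Tup k n × Tup k n

/-- The entries of the two adjacency matrices. -/
abbrev Entry (n : ℕ) : Type := Fin 2 × Fin n × Fin n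

/-- The auxiliary gates for a pair of tuples in a round: comparison of two substitutions in the
tuples, comparison of two substitutions in the first tuple, its negation, a test for each
vertex that is substituted in the first tuple, and a test for each vertex that is substituted in the
second tuple. -/
abbrev Aux (n : ℕ) : Type :=
  (Fin n × Fin n) ⊕ (Fin n × Fin n) ⊕ (Fin n × Fin n) ⊕ Fin n ⊕ Fin n

/-- The gates of a round. -/
abbrev Round (k n : ℕ) : Type := (Pair k n × Aux n) ⊕ Pair k n

/-- The gates for the final comparison. -/
abbrev Final (k n : ℕ) : Type := (Tup k n × Tup k n) ⊕ Tup k n ⊕ Tup k n ⊕ Unit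

/-- The gates: the inputs, their negations, the comparisons of adjacencies, the initial comparisons
of tuples, the rounds, and the final comparison. -/
abbrev Addr (k n r : ℕ) : Type :=
  Entry n ⊕ Entry n ⊕ (Pair k n × Fin k × Fin k × Fin 3) ⊕ Pair k n ⊕ (Fin r × Round k n) ⊕ Final k n

/-! ### Positions, wires and levels of the gates -/

namespace Addr

variable {k n r : ℕ}

abbrev entry (p : Entry n) : Addr k n r := .inl p
abbrev negEntry (p : Entry n) : Addr k n r := .inr (.inl p)
abbrev adjCmp (x : Pair k n) (i j : Fin k) (c : Fin 3) : Addr k n r :=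
  .inr (.inr (.inl (x, i, j, c)))
abbrev initial (x : Pair k n) : Addr k n r := .inr (.inr (.inr (.inl x)))
abbrev round (i : Fin r) (a : Round k n) : Addr k n r := .inr (.inr (.inr (.inr (.inl (i, a)))))
abbrev final (a : Final k n) : Addr k n r := .inr (.inr (.inr (.inr (.inr a))))
abbrev subst (i : Fin r) (x : Pair k n) (w w' : Fin n) : Addr k n r :=
  round i (.inl (x, .inl (w, w')))
abbrev substFst (i : Fin r) (x : Pair k n) (w w' : Fin n) : Addr k n r :=
  round i (.inl (x, .inr (.inl (w, w'))))
abbrev negSubstFst (i : Fin r) (x : Pair k n) (w w' : Fin n) : Addr k n r :=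
  round i (.inl (x, .inr (.inr (.inl (w, w')))))
abbrev testFst (i : Fin r) (x : Pair k n) (w : Fin n) : Addr k n r :=
  round i (.inl (x, .inr (.inr (.inr (.inl w)))))
abbrev testSnd (i : Fin r) (x : Pair k n) (w : Fin n) : Addr k n r :=
  round i (.inl (x, .inr (.inr (.inr (.inr w)))))
abbrev negFinal (u u' : Tup k n) : Addr k n r := final (.inl (u, u'))
abbrev finalFst (u : Tup k n) : Addr k n r := final (.inr (.inl u))
abbrev finalSnd (u : Tup k n) : Addr k n r := final (.inr (.inr (.inl u)))
abbrev out : Addr k n r := final (.inr (.inr (.inr ())))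

/-- The comparison of the colors of a pair of tuples after `i` rounds. -/
def cmp (i : Fin (r + 1)) (x : Pair k n) : Addr k n r :=
  Fin.cases (motive := fun _ => Addr k n r) (initial x) (fun i => round i (.inr x)) i

/-- The comparisons stand at the end of the block of each round, and the initial comparisons stand
directly before the first block, as if they ended a preceding one. One formula therefore serves all
`i`, and a program that refers to the previous round needs no case distinction. -/
theorem idx_cmp (i : Fin (r + 1)) (x : Pair k n) : idx (cmp i x) =
    card (Entry n) + (card (Entry n) + (card (Pair k n × Fin k × Fin k × Fin 3) +
      (i * card (Round k n) + idx x))) := by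
  induction i using Fin.cases with
  | zero => simp only [cmp, Fin.cases_zero, idx_inr, idx_inl, Fin.val_zero]; ring
  | succ i =>
    simp only [cmp, Fin.cases_succ, idx_inr, idx_inl, Fin.val_succ, idx_prod, idx_fin, card_sum,
      card_prod]
    ring

theorem idx_cmp_castSucc_lt (i : Fin r) (x : Pair k n) (a : Round k n) :
    idx (cmp i.castSucc x) < idx (round i a) := by
  have h1 := idx_lt x
  rw [idx_cmp]
  simp only [idx_inr, idx_inl, idx_prod, idx_fin, Fin.val_castSucc]
  omega

theorem idx_cmp_lt_final (x : Pair k n) (a : Final k n) :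
    idx (cmp (Fin.last r) x) < idx (final a : Addr k n r) := by
  have h1 := idx_lt x
  rw [idx_cmp]
  simp only [idx_inr, Fin.val_last, card_prod (α := Fin r), card_fin]
  omega

/-- The gates that feed a gate. The flag `tc` tells whether the algorithm counts. -/
def preds (tc : Bool) : Addr k n r → List (Addr k n r)
  | .inl _ => []
  | .inr (.inl p) => [entry p]
  | .inr (.inr (.inl ((s, u, v), i, j, c))) =>
    match c with
    | 0 => [entry (0, u i, u j), entry (s, v i, v j)]
    | 1 => [negEntry (0, u i, u j), negEntry (s, v i, v j)]
    -- The equality pattern does not depend on the graphs, so it is built into the wiring: an OR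
    -- gate without wires is false.
    | 2 => if (u i = u j ↔ v i = v j) then [adjCmp (s, u, v) i j 0, adjCmp (s, u, v) i j 1] else []
  | .inr (.inr (.inr (.inl x))) => (list (α := Fin k × Fin k)).map fun p => adjCmp x p.1 p.2 2
  | .inr (.inr (.inr (.inr (.inl (i, a))))) =>
    match a with
    | .inl ((s, u, v), .inl (w, w')) => (list (α := Fin k)).map fun j =>
      cmp i.castSucc (s, Function.update u j w, Function.update v j w')
    -- The gate depends only on `u`; it is repeated for all `s` and `v` to keep the addresses
    -- uniform, which the size bound can afford.
    | .inl ((_, u, _), .inr (.inl (w, w'))) => (list (α := Fin k)).map fun j =>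
      cmp i.castSucc (0, Function.update u j w, Function.update u j w')
    | .inl (x, .inr (.inr (.inl (w, w')))) => [substFst i x w w']
    | .inl (x, .inr (.inr (.inr (.inl w)))) =>
      ((list (α := Fin n)).map fun w' => subst i x w w') ++
        if tc then (list (α := Fin n)).map fun w' => negSubstFst i x w w' else []
    | .inl (x, .inr (.inr (.inr (.inr w)))) => (list (α := Fin n)).map fun w' => subst i x w' w
    | .inr x => cmp i.castSucc x ::
      (((list (α := Fin n)).map fun w => testFst i x w) ++
        (list (α := Fin n)).map fun w => testSnd i x w)
  | .inr (.inr (.inr (.inr (.inr a)))) =>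
    match a with
    | .inl (u, u') => [cmp (Fin.last r) (0, u, u')]
    | .inr (.inl u) => ((list (α := Tup k n)).map fun v => cmp (Fin.last r) (1, u, v)) ++
      if tc then (list (α := Tup k n)).map fun u' => negFinal u u' else []
    | .inr (.inr (.inl v)) => (list (α := Tup k n)).map fun u => cmp (Fin.last r) (1, u, v)
    | .inr (.inr (.inr ())) => ((list (α := Tup k n)).map fun u => finalFst u) ++
      (list (α := Tup k n)).map fun v => finalSnd v

/-- The input gates come first and in the order of the input bits, so the same expression yields the
position of the gate and the number of its bit. -/
theorem idx_entry (p : Entry n) :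
    (idx (entry p : Addr k n r)) = finProdFinEquiv (p.1, finProdFinEquiv (p.2.1, p.2.2)) := by
  obtain ⟨s, a, b⟩ := p
  simp only [idx_inl, idx_prod, idx_fin, card_prod, card_fin, finProdFinEquiv_apply_val]
  ring

/-- The gate, given the positions of the gates that feed it. -/
def kind (tc : Bool) : Addr k n r → List ℕ → Gate (2 * (n * n))
  | .inl (s, a, b), _ => .input (finProdFinEquiv (s, finProdFinEquiv (a, b)))
  | .inr (.inl _), l => .not (l.headD 0)
  | .inr (.inr (.inl (_, _, _, c))), l => if c = 2 then .or l else .and l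
  | .inr (.inr (.inr (.inl _))), l => .and l
  | .inr (.inr (.inr (.inr (.inl (_, a))))), l =>
    match a with
    | .inl (_, .inl _) => .and l
    | .inl (_, .inr (.inl _)) => .and l
    | .inl (_, .inr (.inr (.inl _))) => .not (l.headD 0)
    -- The threshold is the constant `n` because the multiplicity on the side of `u` enters through
    -- the negated wires.
    | .inl (_, .inr (.inr (.inr (.inl _)))) => if tc then .threshold n l else .or l
    | .inl (_, .inr (.inr (.inr (.inr _)))) => .or l
    | .inr _ => .and l
  | .inr (.inr (.inr (.inr (.inr a)))), l =>
    match a with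
    | .inl _ => .not (l.headD 0)
    | .inr (.inl _) => if tc then .threshold (n ^ k) l else .or l
    | .inr (.inr (.inl _)) => .or l
    | .inr (.inr (.inr ())) => .and l

/-- The level of a gate, which bounds its depth. -/
def level : Addr k n r → ℕ
  | .inl _ => 0
  | .inr (.inl _) => 1
  | .inr (.inr (.inl (_, _, _, c))) => if c = 2 then 3 else 2
  | .inr (.inr (.inr (.inl _))) => 4
  | .inr (.inr (.inr (.inr (.inl (i, a))))) =>
    match a with
    | .inl (_, .inl _) => 4 * i + 5
    | .inl (_, .inr (.inl _)) => 4 * i + 5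
    | .inl (_, .inr (.inr (.inl _))) => 4 * i + 6
    | .inl (_, .inr (.inr (.inr (.inl _)))) => 4 * i + 7
    | .inl (_, .inr (.inr (.inr (.inr _)))) => 4 * i + 7
    | .inr _ => 4 * i + 8
  | .inr (.inr (.inr (.inr (.inr a)))) =>
    match a with
    | .inl _ => 4 * r + 5
    | .inr (.inl _) => 4 * r + 6
    | .inr (.inr (.inl _)) => 4 * r + 6
    | .inr (.inr (.inr ())) => 4 * r + 7

theorem level_cmp (i : Fin (r + 1)) (x : Pair k n) : level (cmp i x) = 4 * i + 4 := by
  induction i using Fin.cases with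
  | zero => rfl
  | succ i => simp only [cmp, Fin.cases_succ, level, Fin.val_succ]; ring

theorem level_le (a : Addr k n r) : level a ≤ 4 * r + 7 := by
  rcases a with _ | _ | ⟨_, _, _, c⟩ | _ | ⟨i, ⟨_, _ | _ | _ | _ | _⟩ | _⟩ | _ | _ | _ | _ <;>
    simp only [level] <;> first | omega | (split_ifs <;> omega)

/-- Positions and levels both follow the order of evaluation. The former give acyclicity; the
latter, which grow by four per round, bound the depth. -/
theorem lt_of_mem_preds {tc : Bool} {a b : Addr k n r} (h : b ∈ preds tc a) :
    idx b < idx a ∧ level b < level a := by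
  have hin : ∀ {p q : Aux n} {i : Fin r} {x : Pair k n}, idx p < idx q →
      idx (round i (.inl (x, p))) < idx (round i (.inl (x, q)) : Addr k n r) := by
    intro p q i x hpq
    have := idx_prod_lt_right x hpq
    have := idx_prod_lt_right (β := Round k n) i (b := .inl (x, p)) (b' := .inl (x, q)) this
    simp only [idx_inr, idx_inl] at *
    omega
  have hout : ∀ {p : Aux n} {i : Fin r} {x : Pair k n},
      idx (round i (.inl (x, p))) < idx (round i (.inr x) : Addr k n r) := by
    intro p i x
    have := idx_prod_lt_right (β := Round k n) i (idx_inl_lt_inr (x, p) x)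
    simp only [idx_inr, idx_inl] at *
    omega
  have hfin : ∀ {p q : Final k n}, idx p < idx q →
      idx (final p : Addr k n r) < idx (final q : Addr k n r) := by
    intro p q hpq
    simp only [idx_inr] at *
    omega
  have hadj : ∀ {x : Pair k n} {i j : Fin k} {c d : Fin 3}, c < d →
      idx (adjCmp x i j c : Addr k n r) < idx (adjCmp x i j d : Addr k n r) := by
    intro x i j c d hcd
    simp only [idx_inr, idx_inl, idx_prod, idx_fin]
    have : (c : ℕ) < d := hcd
    omega
  rcases a with _ | p | ⟨⟨s, u, v⟩, i, j, c⟩ | x |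
    ⟨i, ⟨⟨s, u, v⟩, ⟨w, w'⟩ | ⟨w, w'⟩ | ⟨w, w'⟩ | w | w⟩ | x⟩ | ⟨u, u'⟩ | u | u | _
  · simp [preds] at h
  · simp only [preds, List.mem_singleton] at h
    subst h
    exact ⟨idx_inl_lt_inr _ _, by simp [level]⟩
  · fin_cases c
    · simp only [preds, List.mem_cons, List.not_mem_nil, or_false] at h
      rcases h with rfl | rfl <;> exact ⟨idx_inl_lt_inr _ _, by simp [level]⟩
    · simp only [preds, List.mem_cons, List.not_mem_nil, or_false] at h
      rcases h with rfl | rfl <;> refine ⟨?_, by simp [level]⟩ <;>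
        exact Nat.add_lt_add_left (idx_inl_lt_inr _ _) _
    · simp only [preds] at h
      split_ifs at h
      · simp only [List.mem_cons, List.not_mem_nil, or_false] at h
        rcases h with rfl | rfl
        · exact ⟨hadj (by decide), by simp [level]⟩
        · exact ⟨hadj (by decide), by simp [level]⟩
      · simp at h
  · simp only [preds, List.mem_map] at h
    obtain ⟨p, -, rfl⟩ := h
    refine ⟨?_, by simp [level]⟩
    exact Nat.add_lt_add_left (Nat.add_lt_add_left (idx_inl_lt_inr _ _) _) _
  · simp only [preds, List.mem_map] at h
    obtain ⟨p, -, rfl⟩ := h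
    exact ⟨idx_cmp_castSucc_lt _ _ _, by rw [level_cmp]; simp [level]⟩
  · simp only [preds, List.mem_map] at h
    obtain ⟨p, -, rfl⟩ := h
    exact ⟨idx_cmp_castSucc_lt _ _ _, by rw [level_cmp]; simp [level]⟩
  · simp only [preds, List.mem_singleton] at h
    subst h
    exact ⟨hin (Nat.add_lt_add_left (idx_inl_lt_inr _ _) _), by simp [level]⟩
  · simp only [preds, List.mem_append, List.mem_map] at h
    rcases h with ⟨p, -, rfl⟩ | h
    · exact ⟨hin (idx_inl_lt_inr _ _), by simp [level]⟩
    · split_ifs at h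
      · obtain ⟨p, -, rfl⟩ := List.mem_map.1 h
        exact ⟨hin (Nat.add_lt_add_left (Nat.add_lt_add_left (idx_inl_lt_inr _ _) _) _),
          by simp [level]⟩
      · simp at h
  · simp only [preds, List.mem_map] at h
    obtain ⟨p, -, rfl⟩ := h
    exact ⟨hin (idx_inl_lt_inr _ _), by simp [level]⟩
  · simp only [preds, List.mem_cons, List.mem_append, List.mem_map] at h
    rcases h with rfl | ⟨p, -, rfl⟩ | ⟨p, -, rfl⟩
    · exact ⟨idx_cmp_castSucc_lt _ _ _, by rw [level_cmp]; simp [level]⟩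
    · exact ⟨hout, by simp [level]⟩
    · exact ⟨hout, by simp [level]⟩
  · simp only [preds, List.mem_singleton] at h
    subst h
    exact ⟨idx_cmp_lt_final _ _, by rw [level_cmp]; simp [level]⟩
  · simp only [preds, List.mem_append, List.mem_map] at h
    rcases h with ⟨p, -, rfl⟩ | h
    · exact ⟨idx_cmp_lt_final _ _, by rw [level_cmp]; simp [level]⟩
    · split_ifs at h
      · obtain ⟨p, -, rfl⟩ := List.mem_map.1 h
        exact ⟨hfin (idx_inl_lt_inr _ _), by simp [level]⟩
      · simp at h
  · simp only [preds, List.mem_map] at h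
    obtain ⟨p, -, rfl⟩ := h
    exact ⟨idx_cmp_lt_final _ _, by rw [level_cmp]; simp [level]⟩
  · simp only [preds, List.mem_append, List.mem_map] at h
    rcases h with ⟨p, -, rfl⟩ | ⟨p, -, rfl⟩
    · exact ⟨hfin (Nat.add_lt_add_left (idx_inl_lt_inr _ _) _), by simp [level]⟩
    · exact ⟨hfin (Nat.add_lt_add_left (Nat.add_lt_add_left (idx_inl_lt_inr _ _) _) _),
        by simp [level]⟩

end Addr

/-- The network of the algorithm with `r` rounds. -/
def network (tc : Bool) (k n r : ℕ) : Network (2 * (n * n)) (Addr k n r) where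
  gate a := Addr.kind tc a ((Addr.preds tc a).map idx)
  preds := Addr.preds tc
  map_preds a := by
    rcases a with _ | p | ⟨⟨s, u, v⟩, i, j, c⟩ | x |
      ⟨i, ⟨⟨s, u, v⟩, ⟨w, w'⟩ | ⟨w, w'⟩ | ⟨w, w'⟩ | w | w⟩ | x⟩ | ⟨u, u'⟩ | u | u | _
    case inr.inr.inl => simp only [Addr.kind]; split_ifs <;> rfl
    all_goals first | rfl | (simp only [Addr.kind]; split_ifs <;> rfl)
  lt a b h := (Addr.lt_of_mem_preds h).1
  out := Addr.out
  idx_out := by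
    simp only [idx_inr, card_sum, card_unit]
    simp only [idx]
    omega

theorem depth_network (tc : Bool) (k n r : ℕ) : (network tc k n r).circuit.depth ≤ 4 * r + 7 := by
  refine (network tc k n r).depth_circuit Addr.level _ Addr.level_le fun a =>
    ⟨fun b hb => (Addr.lt_of_mem_preds hb).2, ?_⟩
  rcases a with ⟨s, a, b⟩ | p | ⟨⟨s, u, v⟩, i, j, c⟩ | x |
    ⟨i, ⟨⟨s, u, v⟩, ⟨w, w'⟩ | ⟨w, w'⟩ | ⟨w, w'⟩ | w | w⟩ | x⟩ | ⟨u, u'⟩ | u | u | _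
  case inl => exact .inl ⟨_, rfl⟩
  all_goals right; simp only [Addr.level]
  all_goals first | omega | (split_ifs <;> omega)

theorem isAC_network (k n r : ℕ) : (network false k n r).circuit.IsAC := by
  intro g hg
  obtain ⟨a, -, rfl⟩ := List.mem_map.1 hg
  rcases a with ⟨s, a, b⟩ | p | ⟨⟨s, u, v⟩, i, j, c⟩ | x |
    ⟨i, ⟨⟨s, u, v⟩, ⟨w, w'⟩ | ⟨w, w'⟩ | ⟨w, w'⟩ | w | w⟩ | x⟩ | ⟨u, u'⟩ | u | u | _
  case inr.inr.inl =>
    simp only [network, Addr.kind]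
    split_ifs <;> trivial
  all_goals trivial

end WL

/-! ## The value of the network -/

namespace WL

open Listing

variable {k n r : ℕ}

open Classical in
/-- The relations `eqv i` on pairs of tuples satisfy the recursion that the network evaluates. -/
structure Refines (tc : Bool) (adj : Fin 2 → Fin n → Fin n → Prop) (eqv : ℕ → Pair k n → Prop) :
    Prop where
  zero : ∀ s u v, eqv 0 (s, u, v) ↔
    ∀ i j, (u i = u j ↔ v i = v j) ∧ (adj 0 (u i) (u j) ↔ adj s (v i) (v j))
  succ : ∀ i s u v, eqv (i + 1) (s, u, v) ↔ eqv i (s, u, v) ∧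
    (∀ w, if tc then
        n ≤ (Finset.univ.filter fun w' =>
            ∀ j, eqv i (s, Function.update u j w, Function.update v j w')).card +
          (Finset.univ.filter fun w' =>
            ¬ ∀ j, eqv i (0, Function.update u j w, Function.update u j w')).card
      else ∃ w', ∀ j, eqv i (s, Function.update u j w, Function.update v j w')) ∧
    ∀ w', ∃ w, ∀ j, eqv i (s, Function.update u j w, Function.update v j w')

open Classical in
/-- The values of the gates. -/
noncomputable def Addr.val (tc : Bool) (adj : Fin 2 → Fin n → Fin n → Prop)
    (eqv : ℕ → Pair k n → Prop) : Addr k n r → Bool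
  | .inl (s, a, b) => decide (adj s a b)
  | .inr (.inl (s, a, b)) => !decide (adj s a b)
  | .inr (.inr (.inl ((s, u, v), i, j, c))) =>
    match c with
    | 0 => decide (adj 0 (u i) (u j) ∧ adj s (v i) (v j))
    | 1 => decide (¬ adj 0 (u i) (u j) ∧ ¬ adj s (v i) (v j))
    | 2 => decide ((u i = u j ↔ v i = v j) ∧ (adj 0 (u i) (u j) ↔ adj s (v i) (v j)))
  | .inr (.inr (.inr (.inl x))) => decide (eqv 0 x)
  | .inr (.inr (.inr (.inr (.inl (i, a))))) =>
    match a with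
    | .inl ((s, u, v), .inl (w, w')) =>
      decide (∀ j, eqv i (s, Function.update u j w, Function.update v j w'))
    | .inl ((_, u, _), .inr (.inl (w, w'))) =>
      decide (∀ j, eqv i (0, Function.update u j w, Function.update u j w'))
    | .inl ((_, u, _), .inr (.inr (.inl (w, w')))) =>
      decide (¬ ∀ j, eqv i (0, Function.update u j w, Function.update u j w'))
    | .inl ((s, u, v), .inr (.inr (.inr (.inl w)))) => decide (if tc then
        n ≤ (Finset.univ.filter fun w' =>
            ∀ j, eqv i (s, Function.update u j w, Function.update v j w')).card +
          (Finset.univ.filter fun w' =>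
            ¬ ∀ j, eqv i (0, Function.update u j w, Function.update u j w')).card
      else ∃ w', ∀ j, eqv i (s, Function.update u j w, Function.update v j w'))
    | .inl ((s, u, v), .inr (.inr (.inr (.inr w)))) =>
      decide (∃ w', ∀ j, eqv i (s, Function.update u j w', Function.update v j w))
    | .inr x => decide (eqv (i + 1) x)
  | .inr (.inr (.inr (.inr (.inr a)))) =>
    match a with
    | .inl (u, u') => decide (¬ eqv r (0, u, u'))
    | .inr (.inl u) => decide (if tc then
        n ^ k ≤ (Finset.univ.filter fun v => eqv r (1, u, v)).card +
          (Finset.univ.filter fun u' => ¬ eqv r (0, u, u')).card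
      else ∃ v, eqv r (1, u, v))
    | .inr (.inr (.inl v)) => decide (∃ u, eqv r (1, u, v))
    | .inr (.inr (.inr ())) => decide ((∀ u, if tc then
        n ^ k ≤ (Finset.univ.filter fun v => eqv r (1, u, v)).card +
          (Finset.univ.filter fun u' => ¬ eqv r (0, u, u')).card
      else ∃ v, eqv r (1, u, v)) ∧ ∀ v, ∃ u, eqv r (1, u, v))

theorem Addr.val_cmp (tc : Bool) (adj : Fin 2 → Fin n → Fin n → Prop) (eqv : ℕ → Pair k n → Prop)
    (i : Fin (r + 1)) (x : Pair k n) :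
    Addr.val tc adj eqv (Addr.cmp i x) = true ↔ eqv i x := by
  induction i using Fin.cases with
  | zero => simp [Addr.cmp, Addr.val]
  | succ i => simp [Addr.cmp, Addr.val]

-- By `eval_circuit` it suffices to check, gate by gate, that the intended value results from the
-- intended values of the predecessors. Colors enter only through the recursion `Refines`, so both
-- versions of the algorithm are covered.
open Classical in
theorem eval_network (tc : Bool) (adj : Fin 2 → Fin n → Fin n → Prop) (eqv : ℕ → Pair k n → Prop)
    (h : Refines tc adj eqv) (x : Fin (2 * (n * n)) → Bool)
    (hx : ∀ s a b, x (finProdFinEquiv (s, finProdFinEquiv (a, b))) = decide (adj s a b)) :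
    (network tc k n r).circuit.eval x = true ↔ ((∀ u, if tc then
        n ^ k ≤ (Finset.univ.filter fun v => eqv r (1, u, v)).card +
          (Finset.univ.filter fun u' => ¬ eqv r (0, u, u')).card
      else ∃ v, eqv r (1, u, v)) ∧ ∀ v, ∃ u, eqv r (1, u, v)) := by
  rw [(network tc k n r).eval_circuit x (Addr.val tc adj eqv)]
  · exact decide_eq_true_iff
  intro a v hv
  change ∀ b ∈ Addr.preds tc a, _ at hv
  change (Addr.kind tc a ((Addr.preds tc a).map idx)).eval x v = _
  have hall : ((Addr.preds tc a).map idx).all v = (Addr.preds tc a).all (Addr.val tc adj eqv) := by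
    rw [Bool.eq_iff_iff]
    simp only [List.all_eq_true, List.mem_map, forall_exists_index, and_imp,
      forall_apply_eq_imp_iff₂]
    exact forall₂_congr fun b hb => by rw [hv b hb]
  have hany : ((Addr.preds tc a).map idx).any v = (Addr.preds tc a).any (Addr.val tc adj eqv) := by
    rw [Bool.eq_iff_iff]
    simp only [List.any_eq_true, List.mem_map, exists_exists_and_eq_and]
    exact exists_congr fun b => and_congr_right fun hb => by rw [hv b hb]
  have hcount : ((Addr.preds tc a).map idx).countP v =
      (Addr.preds tc a).countP (Addr.val tc adj eqv) := by
    rw [List.countP_map]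
    exact List.countP_congr fun b hb => by simp [hv b hb]
  rcases a with ⟨s, a, b⟩ | p | ⟨⟨s, u, v⟩, i, j, c⟩ | x |
    ⟨i, ⟨⟨s, u, v⟩, ⟨w, w'⟩ | ⟨w, w'⟩ | ⟨w, w'⟩ | w | w⟩ | x⟩ | ⟨u, u'⟩ | u | u | _
  · exact hx s a b
  · have := hv (Addr.entry p) (by simp [Addr.preds])
    simp [Addr.kind, Addr.preds, Gate.eval, this, Addr.val]
  · fin_cases c
    · simp only [Addr.kind, Gate.eval] at *
      refine hall.trans ?_
      simp [Addr.preds, Addr.val]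
    · simp only [Addr.kind, Gate.eval] at *
      refine hall.trans ?_
      simp [Addr.preds, Addr.val]
    · simp only [Addr.kind, Gate.eval] at *
      refine hany.trans ?_
      simp only [Addr.preds, Addr.val]
      split_ifs with h1
      · by_cases h2 : adj 0 (u i) (u j) <;> by_cases h3 : adj s (v i) (v j) <;>
          simp [h1, h2, h3, Addr.val]
      · simp [h1]
  · refine hall.trans ?_
    obtain ⟨s, u, v⟩ := x
    rw [Bool.eq_iff_iff]
    simp [Addr.preds, Addr.val, mem_list, h.zero]
  · refine hall.trans ?_
    rw [Bool.eq_iff_iff]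
    simp only [Addr.preds, List.all_map, List.all_eq_true, mem_list, forall_const,
      Function.comp_apply, Addr.val_cmp]
    simp [Addr.val]
  · refine hall.trans ?_
    rw [Bool.eq_iff_iff]
    simp only [Addr.preds, List.all_map, List.all_eq_true, mem_list, forall_const,
      Function.comp_apply, Addr.val_cmp]
    simp [Addr.val]
  · have := hv (Addr.substFst i (s, u, v) w w') (by simp [Addr.preds])
    simp only [Addr.kind, Addr.preds, Gate.eval, List.map_cons, List.headD_cons, this, Addr.val]
    rw [decide_not]
  · cases tc
    · refine hany.trans ?_
      rw [Bool.eq_iff_iff]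
      simp [Addr.preds, Addr.val, mem_list]
    · simp only [Addr.kind, Gate.eval, if_true] at *
      rw [hcount]
      simp [Addr.preds, Addr.val, List.countP_append, List.countP_map, countP_list]
  · refine hany.trans ?_
    rw [Bool.eq_iff_iff]
    simp [Addr.preds, Addr.val, mem_list]
  · refine hall.trans ?_
    obtain ⟨s, u, v⟩ := x
    rw [Bool.eq_iff_iff]
    simp only [Addr.preds, List.all_cons, Bool.and_eq_true, Addr.val_cmp]
    simp [Addr.val, mem_list, h.succ]
  · have := hv (Addr.cmp (Fin.last r) (0, u, u')) (by simp [Addr.preds])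
    simp only [Addr.kind, Addr.preds, Gate.eval, List.map_cons, List.headD_cons, this]
    rw [Bool.eq_iff_iff, Bool.not_eq_true', ← Bool.not_eq_true, Addr.val_cmp]
    simp [Addr.val]
  · cases tc
    · refine hany.trans ?_
      rw [Bool.eq_iff_iff]
      simp only [Addr.preds, List.any_append, List.any_map, List.any_eq_true, mem_list, true_and,
        Function.comp_apply, Addr.val_cmp, Bool.or_eq_true, Bool.false_eq_true, if_false]
      simp [Addr.val]
    · simp only [Addr.kind, Gate.eval, if_true] at *
      rw [hcount]
      simp only [Addr.preds, List.countP_append, List.countP_map, countP_list, Addr.val_cmp,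
        Function.comp_apply, if_true]
      simp [Addr.val]
  · refine hany.trans ?_
    rw [Bool.eq_iff_iff]
    simp only [Addr.preds, List.any_map, List.any_eq_true, mem_list, true_and,
      Function.comp_apply, Addr.val_cmp]
    simp [Addr.val]
  · refine hall.trans ?_
    rw [Bool.eq_iff_iff]
    simp [Addr.preds, Addr.val, mem_list]

/-! ## Comparison of colors -/

-- The inequality says that the multiplicity of `f a` under `f`, which is `m` minus the number of
-- `a'` with another value, is at most its multiplicity under `g`. Domination of all multiplicities
-- forces equality since both multisets have `m` members. The second clause follows from the first;
-- with it, the criterion has the same shape as the one for sets.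
open Classical in
theorem map_univ_eq_iff {α β γ : Type} [Fintype α] [Fintype β] {m : ℕ} (hα : Fintype.card α = m)
    (hβ : Fintype.card β = m) (f : α → γ) (g : β → γ) :
    (Finset.univ : Finset α).val.map f = (Finset.univ : Finset β).val.map g ↔
      (∀ a, m ≤ (Finset.univ.filter fun b => f a = g b).card +
        (Finset.univ.filter fun a' => ¬ f a = f a').card) ∧ ∀ b, ∃ a, f a = g b := by
  have hcf : ∀ c, ((Finset.univ : Finset α).val.map f).count c =
      (Finset.univ.filter fun a => c = f a).card := fun c => by
    rw [Multiset.count_map]; rfl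
  have hcg : ∀ c, ((Finset.univ : Finset β).val.map g).count c =
      (Finset.univ.filter fun b => c = g b).card := fun c => by
    rw [Multiset.count_map]; rfl
  have hneg : ∀ a, (Finset.univ.filter fun a' => f a = f a').card +
      (Finset.univ.filter fun a' => ¬ f a = f a').card = m := fun a => by
    rw [Finset.card_filter_add_card_filter_not, Finset.card_univ, hα]
  constructor
  · intro h
    refine ⟨fun a => ?_, fun b => ?_⟩
    · rw [← hcg, ← h, hcf, hneg]
    · have : g b ∈ (Finset.univ : Finset α).val.map f := by
        rw [h]; exact Multiset.mem_map_of_mem g (Finset.mem_univ b)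
      obtain ⟨a, -, ha⟩ := Multiset.mem_map.1 this
      exact ⟨a, ha⟩
  · rintro ⟨h, -⟩
    refine Multiset.eq_of_le_of_card_le (Multiset.le_iff_count.2 fun c => ?_) ?_
    · by_cases hc : ∃ a, c = f a
      · obtain ⟨a, rfl⟩ := hc
        have := h a
        have := hneg a
        rw [hcf, hcg]
        omega
      · rw [hcf, Finset.filter_false_of_mem fun a _ ha => hc ⟨a, ha⟩]
        exact Nat.zero_le _
    · rw [Multiset.card_map, Multiset.card_map, Finset.card_val, Finset.card_val, Finset.card_univ,
        Finset.card_univ, hα, hβ]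

theorem range_eq_range_iff {α β γ : Type} (f : α → γ) (g : β → γ) :
    Set.range f = Set.range g ↔ (∀ a, ∃ b, f a = g b) ∧ ∀ b, ∃ a, f a = g b := by
  rw [Set.Subset.antisymm_iff, Set.range_subset_iff, Set.range_subset_iff]
  simp only [Set.mem_range, eq_comm]

/-- The first or the second graph. -/
def side (G H : SimpleGraph (Fin n)) (s : Fin 2) : SimpleGraph (Fin n) := if s = 0 then G else H

theorem isoType_eq_iff (G H : SimpleGraph (Fin n)) (u v : Tup k n) :
    isoType G u = isoType H v ↔
      ∀ i j, (u i = u j ↔ v i = v j) ∧ (G.Adj (u i) (u j) ↔ H.Adj (v i) (v j)) := by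
  simp only [isoType, Prod.mk.injEq, Set.ext_iff, Set.mem_ofPred_eq, Prod.forall, ← forall_and]

/-- Both multisets of a round are indexed by the `n` vertices, so the criterion applies with `m =
n`. Its members are `k`-tuples of colors, whose equality is a conjunction over the positions `j`. -/
theorem refines_color (G H : SimpleGraph (Fin n)) :
    Refines (k := k) true (fun s => (side G H s).Adj)
      fun i x => color G i x.2.1 = color (side G H x.1) i x.2.2 where
  zero s u v := isoType_eq_iff G (side G H s) u v
  succ i s u v := by
    simp only [if_true]
    change (_, _) = (_, _) ↔ _
    rw [Prod.mk.injEq, map_univ_eq_iff (Fintype.card_fin n) (Fintype.card_fin n)]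
    refine and_congr_right' (and_congr (forall_congr' fun w => ?_) (by simp only [funext_iff]))
    refine Iff.of_eq (congrArg₂ (fun a b => n ≤ a + b) (congrArg Finset.card ?_)
      (congrArg Finset.card ?_))
    · ext w'
      simp only [Finset.mem_filter, Finset.mem_univ, true_and]
      exact funext_iff
    · ext w'
      simp only [Finset.mem_filter, Finset.mem_univ, true_and]
      exact not_congr funext_iff

theorem refines_cfColor (G H : SimpleGraph (Fin n)) :
    Refines (k := k) false (fun s => (side G H s).Adj)
      fun i x => cfColor G i x.2.1 = cfColor (side G H x.1) i x.2.2 where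
  zero s u v := isoType_eq_iff G (side G H s) u v
  succ i s u v := by
    simp only [Bool.false_eq_true, if_false]
    change (_, _) = (_, _) ↔ _
    rw [Prod.mk.injEq, range_eq_range_iff]
    simp only [funext_iff]

theorem graphPairInput_apply (G H : SimpleGraph (Fin n)) (s : Fin 2) (a b : Fin n)
    [Decidable ((side G H s).Adj a b)] :
    graphPairInput G H (finProdFinEquiv (s, finProdFinEquiv (a, b))) =
      decide ((side G H s).Adj a b) := by
  rw [Bool.eq_iff_iff, decide_eq_true_iff]
  by_cases h : s = 0 <;> simp [graphPairInput, side, h]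

theorem card_tup (k n : ℕ) : Fintype.card (Tup k n) = n ^ k := by simp

theorem eval_network_eq_true_iff (G H : SimpleGraph (Fin n)) :
    (network true k n r).circuit.eval (graphPairInput G H) = true ↔ ReportsIso k r G H := by
  classical
  rw [eval_network true _ _ (refines_color G H) _ fun s a b => graphPairInput_apply G H s a b,
    ReportsIso, map_univ_eq_iff (card_tup k n) (card_tup k n)]
  simp only [if_true]
  rfl

theorem eval_network_false_eq_true_iff (G H : SimpleGraph (Fin n)) :
    (network false k n r).circuit.eval (graphPairInput G H) = true ↔ CFReportsIso k r G H := by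
  classical
  rw [eval_network false _ _ (refines_cfColor G H) _ fun s a b => graphPairInput_apply G H s a b,
    CFReportsIso, range_eq_range_iff]
  simp only [Bool.false_eq_true, if_false]
  rfl

end WL

/-! ## The size of the network -/

namespace Listing

variable {α β : Type} [Listing α] [Listing β]

/-- The sum of a function over all elements. -/
def total (f : α → ℕ) : ℕ := ((list (α := α)).map f).sum

theorem total_le {f : α → ℕ} {N c : ℕ} (hN : card α ≤ N) (h : ∀ a, f a ≤ c) : total f ≤ N * c := by
  refine le_trans ?_ (Nat.mul_le_mul_right c hN)
  rw [total, card]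
  generalize list (α := α) = l
  induction l with
  | nil => simp
  | cons a l ih =>
    simp only [List.map_cons, List.sum_cons, List.length_cons]
    rw [Nat.succ_mul]
    have := h a
    omega

theorem total_sum (f : α ⊕ β → ℕ) : total f = total (fun a => f (.inl a)) + total fun b => f (.inr b) := by
  simp [total, list, Function.comp_def]

theorem total_prod_le {f : α × β → ℕ} {N c : ℕ} (hN : card α ≤ N)
    (h : ∀ a, total (fun b => f (a, b)) ≤ c) : total f ≤ N * c := by
  refine le_trans (le_of_eq ?_) (total_le (f := fun a => total fun b => f (a, b)) hN h)
  simp only [total, list, List.map_flatMap, List.map_map, Function.comp_def]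
  rw [List.flatMap, List.sum_flatten, List.map_map]
  rfl

end Listing

namespace WL

open Listing

/-- With `U = n ^ k`, every group of gates is bounded by a multiple of `Y = U ^ 2 * n ^ 2`, the
order of a single round: `2 * U ^ 2` pairs with quadratically many gates and wires each. -/
theorem size_network (tc : Bool) {k n : ℕ} (r : ℕ) (hk : 2 ≤ k) (hn : 1 ≤ n) :
    (network tc k n r).circuit.size ≤
      (20 * k ^ 2 + 4 * k + 44) * (max 1 r * n ^ (3 * k)) := by
  set U := n ^ k with hU
  have hUn : card (Tup k n) = U := by rw [card_tuple, card_fin]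
  have hfin : ∀ m, (list (α := Fin m)).length = m := card_fin
  have hT : (list (α := Tup k n)).length = U := hUn
  have hP : card (Pair k n) ≤ 2 * U ^ 2 := by
    rw [card_prod, card_prod, hUn, card_fin, sq]
  have hU1 : 1 ≤ U := Nat.one_le_pow _ _ hn
  have hnn : n ≤ n ^ 2 := Nat.le_self_pow (by norm_num) n
  have hUU : U ≤ U ^ 2 := Nat.le_self_pow (by norm_num) U
  have h1 : total (fun p : Entry n => 1 + (Addr.preds (k := k) (r := r) tc (.entry p)).length) ≤
      2 * n ^ 2 * 1 :=
    total_le (by simp only [card_prod, card_fin, sq]; exact le_rfl) fun p => by simp [Addr.preds]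
  have h2 : total (fun p : Entry n => 1 + (Addr.preds (k := k) (r := r) tc (.negEntry p)).length) ≤
      2 * n ^ 2 * 2 :=
    total_le (by simp only [card_prod, card_fin, sq]; exact le_rfl) fun p => by simp [Addr.preds]
  have h3 : total (fun p : Pair k n × Fin k × Fin k × Fin 3 =>
      1 + (Addr.preds (r := r) tc (.adjCmp p.1 p.2.1 p.2.2.1 p.2.2.2)).length) ≤
      2 * U ^ 2 * (3 * k ^ 2) * 3 := by
    refine total_le ?_ ?_
    · rw [card_prod]
      refine Nat.mul_le_mul hP ?_
      simp only [card_prod, card_fin]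
      exact le_of_eq (by ring)
    · rintro ⟨⟨s, u, v⟩, i, j, c⟩
      fin_cases c
      · simp [Addr.preds]
      · simp [Addr.preds]
      · simp only [Addr.preds]
        split_ifs <;> simp
  have h4 : total (fun x : Pair k n => 1 + (Addr.preds (r := r) tc (.initial x)).length) ≤
      2 * U ^ 2 * (1 + k ^ 2) :=
    total_le hP fun p => by
      have : (list (α := Fin k × Fin k)).length = k ^ 2 := by
        rw [← card, card_prod, card_fin, sq]
      simp [Addr.preds, this]
  have h5 : total (fun p : Fin r × Round k n =>
      1 + (Addr.preds (r := r) tc (.round p.1 p.2)).length) ≤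
      r * (2 * U ^ 2 * (n ^ 2 * (1 + k) + (n ^ 2 * (1 + k) + (n ^ 2 * 2 +
        (n * (1 + 2 * n) + n * (1 + n))))) + 2 * U ^ 2 * (2 + 2 * n)) := by
    have hnn : card (Fin n × Fin n) ≤ n ^ 2 := by rw [card_prod, card_fin, sq]
    refine total_prod_le (card_fin r).le fun i => ?_
    rw [total_sum]
    refine Nat.add_le_add (total_prod_le hP fun x => ?_) (total_le hP fun x => ?_)
    · obtain ⟨s, u, v⟩ := x
      rw [total_sum, total_sum, total_sum, total_sum]
      refine Nat.add_le_add (total_le hnn fun p => ?_) (Nat.add_le_add (total_le hnn fun p => ?_)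
        (Nat.add_le_add (total_le hnn fun p => ?_) (Nat.add_le_add
        (total_le (card_fin n).le fun p => ?_) (total_le (card_fin n).le fun p => ?_))))
      · simp [Addr.preds, hfin]
      · simp [Addr.preds, hfin]
      · simp [Addr.preds]
      · cases tc <;> simp [Addr.preds, hfin] <;> omega
      · simp [Addr.preds, hfin]
    · simp [Addr.preds, hfin]; omega
  have h6 : total (fun p : Final k n => 1 + (Addr.preds (r := r) tc (.final p)).length) ≤
      U ^ 2 * 2 + (U * (1 + 2 * U) + (U * (1 + U) + 1 * (1 + 2 * U))) := by
    rw [total_sum, total_sum, total_sum]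
    refine Nat.add_le_add (total_le ?_ fun p => ?_) (Nat.add_le_add (total_le hUn.le fun p => ?_)
      (Nat.add_le_add (total_le hUn.le fun p => ?_) (total_le card_unit.le fun p => ?_)))
    · rw [card_prod, hUn, sq]
    · simp [Addr.preds]
    · cases tc <;> simp [Addr.preds, hT] <;> omega
    · simp [Addr.preds, hT]
    · simp [Addr.preds, hT]; omega
  have hsize : (network tc k n r).circuit.size ≤ 2 * n ^ 2 * 1 + (2 * n ^ 2 * 2 +
      (2 * U ^ 2 * (3 * k ^ 2) * 3 + (2 * U ^ 2 * (1 + k ^ 2) + (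
      r * (2 * U ^ 2 * (n ^ 2 * (1 + k) + (n ^ 2 * (1 + k) + (n ^ 2 * 2 +
        (n * (1 + 2 * n) + n * (1 + n))))) + 2 * U ^ 2 * (2 + 2 * n)) +
      (U ^ 2 * 2 + (U * (1 + 2 * U) + (U * (1 + U) + 1 * (1 + 2 * U)))))))) := by
    rw [Network.size_circuit]
    change total (fun a : Addr k n r => 1 + (Addr.preds tc a).length) ≤ _
    rw [total_sum, total_sum, total_sum, total_sum, total_sum]
    exact Nat.add_le_add h1 (Nat.add_le_add h2 (Nat.add_le_add h3 (Nat.add_le_add h4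
      (Nat.add_le_add h5 h6))))
  set Y := U ^ 2 * n ^ 2 with hY
  have hn2 : 1 ≤ n ^ 2 := Nat.one_le_pow _ _ hn
  have hU2 : 1 ≤ U ^ 2 := Nat.one_le_pow _ _ hU1
  have hY1 : n ^ 2 ≤ Y := Nat.le_mul_of_pos_left _ hU2
  have hY2 : U ^ 2 ≤ Y := Nat.le_mul_of_pos_right _ hn2
  have hYM : Y ≤ n ^ (3 * k) := by
    rw [hY, hU, ← pow_mul, ← pow_add]
    -- Here `k ≥ 2` enters, as `2 * k + 2 ≤ 3 * k`.
    exact Nat.pow_le_pow_right hn (by omega)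
  clear_value Y U
  have hround : 2 * U ^ 2 * (n ^ 2 * (1 + k) + (n ^ 2 * (1 + k) + (n ^ 2 * 2 +
        (n * (1 + 2 * n) + n * (1 + n))))) + 2 * U ^ 2 * (2 + 2 * n) ≤ (4 * k + 26) * Y := by
    have e1 : n ^ 2 * (1 + k) + (n ^ 2 * (1 + k) + (n ^ 2 * 2 +
        (n * (1 + 2 * n) + n * (1 + n)))) ≤ n ^ 2 * (2 * k + 9) := by nlinarith
    have e2 : 2 + 2 * n ≤ n ^ 2 * 4 := by nlinarith
    calc _ ≤ 2 * U ^ 2 * (n ^ 2 * (2 * k + 9)) + 2 * U ^ 2 * (n ^ 2 * 4) :=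
          Nat.add_le_add (Nat.mul_le_mul_left _ e1) (Nat.mul_le_mul_left _ e2)
      _ = _ := by rw [hY]; ring
  have hfinal : U ^ 2 * 2 + (U * (1 + 2 * U) + (U * (1 + U) + 1 * (1 + 2 * U))) ≤ 10 * Y := by
    nlinarith
  set R := max 1 r with hR
  have hR1 : 1 ≤ R := le_max_left _ _
  have hrest : 2 * n ^ 2 * 1 + 2 * n ^ 2 * 2 + 2 * U ^ 2 * (3 * k ^ 2) * 3 +
      2 * U ^ 2 * (1 + k ^ 2) ≤ (20 * k ^ 2 + 8) * Y := by
    have h7 : U ^ 2 * k ^ 2 ≤ Y * k ^ 2 := Nat.mul_le_mul_right _ hY2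
    calc _ = 6 * n ^ 2 + 20 * (U ^ 2 * k ^ 2) + 2 * U ^ 2 := by ring
      _ ≤ 6 * Y + 20 * (Y * k ^ 2) + 2 * Y := by omega
      _ = _ := by ring
  have hr : r * (2 * U ^ 2 * (n ^ 2 * (1 + k) + (n ^ 2 * (1 + k) + (n ^ 2 * 2 +
        (n * (1 + 2 * n) + n * (1 + n))))) + 2 * U ^ 2 * (2 + 2 * n)) ≤ R * ((4 * k + 26) * Y) :=
    Nat.mul_le_mul (le_max_right _ _) hround
  have hYR : Y ≤ R * Y := Nat.le_mul_of_pos_left _ hR1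
  have hRM : R * Y ≤ R * n ^ (3 * k) := Nat.mul_le_mul_left _ hYM
  -- The constant is the sum of `20 * k ^ 2 + 8` for the gates before the rounds, `4 * k + 26` for a
  -- round, and `10` for the final comparison.
  calc _ ≤ (20 * k ^ 2 + 8) * Y + (R * ((4 * k + 26) * Y) + 10 * Y) := by omega
    _ ≤ (20 * k ^ 2 + 8) * (R * Y) + ((4 * k + 26) * (R * Y) + 10 * (R * Y)) := by
        refine Nat.add_le_add (Nat.mul_le_mul_left _ hYR) (Nat.add_le_add (le_of_eq (by ring))
          (Nat.mul_le_mul_left _ hYR))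
    _ = (20 * k ^ 2 + 4 * k + 44) * (R * Y) := by ring
    _ ≤ _ := Nat.mul_le_mul_left _ hRM

end WL

/-! ## Programs that print listed data -/

/-- Polynomial expressions in the variables of a program. -/
inductive Expr : Type
  | const (c : ℕ)
  | var (x : ℕ)
  | add (a b : Expr)
  | mul (a b : Expr)

/-- The expression is defined in the environment and has the given value. -/
inductive Expr.Is (env : List ℕ) : Expr → ℕ → Prop
  | const (c : ℕ) : Is env (.const c) c
  | var {x v : ℕ} : env[x]? = some v → Is env (.var x) v
  | add {a b : Expr} {x y : ℕ} : Is env a x → Is env b y → Is env (.add a b) (x + y)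
  | mul {a b : Expr} {x y : ℕ} : Is env a x → Is env b y → Is env (.mul a b) (x * y)

theorem List.getElem?_append_of_eq_some {α : Type} {l : List α} {x : ℕ} {v : α}
    (h : l[x]? = some v) (l' : List α) : (l ++ l')[x]? = some v := by
  rw [List.getElem?_append_left]
  · exact h
  · by_contra hlt
    rw [List.getElem?_eq_none (by omega)] at h
    cases h

theorem Expr.Is.append {env : List ℕ} {e : Expr} {v : ℕ} (h : e.Is env v) (l : List ℕ) :
    e.Is (env ++ l) v := by
  induction h with
  | const c => exact .const c
  | var h => exact .var (List.getElem?_append_of_eq_some h l)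
  | add _ _ h h' => exact .add h h'
  | mul _ _ h h' => exact .mul h h'

theorem Expr.Is.last {env : List ℕ} {x : ℕ} (h : env.length = x) (v : ℕ) :
    (Expr.var x).Is (env ++ [v]) v :=
  .var (by subst h; simp)

namespace Cmd

/-- Repeats a program as many times as the value of an expression says. -/
def rep : Expr → Cmd → Cmd
  | .const c, body => (List.replicate c body).foldr seq skip
  | .var x, body => loop x body
  | .add a b, body => seq (rep a body) (rep b body)
  | .mul a b, body => rep a (rep b body)

/-- Products become nested repetitions, so the body runs under additional loop variables. It
therefore has to work in every extension of the environment, and the conclusion is stated for all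
extensions to be usable in turn as a hypothesis on a body. -/
theorem ev_rep {env : List ℕ} {e : Expr} {v d : ℕ} (h : e.Is env v) {body : Cmd}
    (hb : ∀ l a, Ev body (env ++ l) a [] (a + d)) :
    ∀ l a, Ev (rep e body) (env ++ l) a [] (a + v * d) := by
  induction h generalizing body d with
  | const c =>
    intro l a
    simp only [rep]
    induction c generalizing a with
    | zero => simpa using Ev.skip _ a
    | succ c ih =>
      have := (hb l a).seq (ih (a + d))
      rw [show a + d + c * d = a + (c + 1) * d by ring] at this
      exact this
  | @var x v h =>
    intro l a
    have := Ev.loop (c := body) (fun i => a + i * d) (fun _ => []) (b := v)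
      (List.getElem?_append_of_eq_some h l) fun i _ => by
        have := hb (l ++ [i]) (a + i * d)
        rw [← List.append_assoc, show a + i * d + d = a + (i + 1) * d by ring] at this
        exact this
    rw [List.flatMap_eq_nil_iff.2 fun _ _ => rfl] at this
    simpa [rep] using this
  | add _ _ h h' =>
    intro l a
    have := (h hb l a).seq (h' hb l _)
    rw [add_assoc, ← add_mul] at this
    exact this
  | mul _ _ h h' =>
    intro l a
    rw [mul_assoc]
    exact h (h' hb) l a

/-- The program writes `o`, where the accumulator has value `0` at the beginning and at the end. -/
def Outputs (c : Cmd) (env : List ℕ) (o : List DescSym) : Prop := Ev c env 0 o 0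

/-- Writes the value of an expression in binary, followed by a separator. -/
def num (e : Expr) : Cmd := seq (rep e inc) (seq flush (emit .sep))

/-- Runs the programs of a list. -/
def seqs {α : Type} (l : List α) (f : α → Cmd) : Cmd := (l.map f).foldr seq skip

/-- Runs a program for each tuple of `k` numbers below the value of `y`. -/
def loopTuple (y : ℕ) : ℕ → Cmd → Cmd
  | 0, body => body
  | k + 1, body => loopTuple y k (loop y body)

variable {env : List ℕ} {c d : Cmd} {o o' : List DescSym}

theorem outputs_num {e : Expr} {v : ℕ} (h : e.Is env v) : Outputs (num e) env (describeNat v) := by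
  have h1 := ev_rep h (body := inc) (d := 1) (fun l a => Ev.inc _ a) [] 0
  have h2 := h1.seq ((Ev.flush (env ++ []) _).seq (Ev.emit .sep _ 0))
  simpa [num, Outputs, describeNat] using h2

theorem Outputs.seq (h : Outputs c env o) (h' : Outputs d env o') :
    Outputs (seq c d) env (o ++ o') := Ev.seq h h'

theorem Outputs.cons (s : DescSym) (h : Outputs c env o) :
    Outputs (Cmd.seq (emit s) c) env (s :: o) :=
  Ev.seq (o := [s]) (.emit s env 0) h

theorem Outputs.seqs {α : Type} {l : List α} {f : α → Cmd} {g : α → List DescSym}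
    (h : ∀ a, Outputs (f a) env (g a)) : Outputs (seqs l f) env (l.flatMap g) := by
  induction l with
  | nil => exact .skip env 0
  | cons a l ih => exact Ev.seq (h a) ih

open Listing

theorem Outputs.loop {y n : ℕ} (hy : (Expr.var y).Is env n) {g : Fin n → List DescSym}
    (h : ∀ i : Fin n, Outputs c (env ++ [(i : ℕ)]) (g i)) :
    Outputs (loop y c) env ((list (α := Fin n)).flatMap g) := by
  cases hy with
  | var hy =>
    -- `Ev.loop` expects outputs for all numbers; the empty default beyond `n` is never written.
    have := Ev.loop (c := c) (fun _ => 0) (fun i => if h : i < n then g ⟨i, h⟩ else []) hy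
      fun i hi => by simpa [hi, Outputs] using h ⟨i, hi⟩
    rw [← List.map_coe_finRange_eq_range, List.flatMap_map] at this
    simpa [list, Outputs] using this

/-- The additional loop is the innermost one, in accordance with the listing of tuples, where the
last entry runs fastest. -/
theorem Outputs.loopTuple {y n k : ℕ} (hy : (Expr.var y).Is env n)
    {g : (Fin k → Fin n) → List DescSym}
    (h : ∀ u : Fin k → Fin n, Outputs c (env ++ List.ofFn fun j => (u j : ℕ)) (g u)) :
    Outputs (loopTuple y k c) env ((list (α := Fin k → Fin n)).flatMap g) := by
  induction k generalizing c with
  | zero =>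
    have := h Fin.elim0
    simpa [list_tuple_zero, loopTuple] using this
  | succ k ih =>
    rw [list_tuple_succ, List.flatMap_assoc]
    refine ih fun u => ?_
    rw [List.flatMap_map]
    refine Outputs.loop (hy.append _) fun i => ?_
    have := h (Fin.snoc u i)
    rw [List.ofFn_succ'] at this
    simpa using this

theorem Outputs.sum {α β : Type} [Listing α] [Listing β] {g : α ⊕ β → List DescSym}
    (h : Outputs c env ((list (α := α)).flatMap fun a => g (.inl a)))
    (h' : Outputs d env ((list (α := β)).flatMap fun a => g (.inr a))) :
    Outputs (Cmd.seq c d) env ((list (α := α ⊕ β)).flatMap g) := by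
  have := h.seq h'
  simpa [list, List.flatMap_append, List.flatMap_map] using this

theorem Outputs.prod {α β : Type} [Listing α] [Listing β] {g : α × β → List DescSym}
    (h : Outputs c env ((list (α := α)).flatMap fun a => (list (α := β)).flatMap fun b => g (a, b))) :
    Outputs c env ((list (α := α × β)).flatMap g) := by
  simpa [list, List.flatMap_assoc, List.flatMap_map] using h

theorem Outputs.unit {g : Unit → List DescSym} (h : Outputs c env (g ())) :
    Outputs c env ((list (α := Unit)).flatMap g) := by
  simpa [list] using h

theorem Outputs.ifEq {x y v v' : ℕ} (hx : (Expr.var x).Is env v) (hy : (Expr.var y).Is env v')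
    (h : v = v' → Outputs c env o) (h' : v ≠ v' → Outputs d env o) :
    Outputs (ifEq x y c d) env o := by
  cases hx with
  | var hx =>
    cases hy with
    | var hy =>
      refine Ev.ifEq hx hy ?_
      split_ifs with heq
      · exact h heq
      · exact h' heq

end Cmd

/-! ## A program that writes the network -/

theorem Expr.Is.mono {env env' : List ℕ} {e : Expr} {v : ℕ} (h : e.Is env v) (he : env <+: env') :
    e.Is env' v := by
  obtain ⟨l, rfl⟩ := he
  exact h.append l

instance : Add Expr := ⟨.add⟩
instance : Mul Expr := ⟨.mul⟩

namespace WL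

open Listing Cmd

/-- The environment has length `d` and begins with `n` and `r`. -/
structure Ctx (env : List ℕ) (n r d : ℕ) : Prop where
  order : (Expr.var 0).Is env n
  rounds : (Expr.var 1).Is env r
  length : env.length = d

/-- The expressions have the entries of the tuple as values. -/
def IsTup {k n : ℕ} (env : List ℕ) (e : Fin k → Expr) (u : Tup k n) : Prop :=
  ∀ j, (e j).Is env (u j)

/-- Consecutive variables. -/
def vars (k d : ℕ) (j : Fin k) : Expr := .var (d + j)

variable {k n r d : ℕ} {env env' : List ℕ}

theorem IsTup.mono {e : Fin k → Expr} {u : Tup k n} (h : IsTup env e u) (he : env <+: env') :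
    IsTup env' e u := fun j => (h j).mono he

theorem IsTup.update {e : Fin k → Expr} {u : Tup k n} (h : IsTup env e u) (j : Fin k) {a : Expr}
    {w : Fin n} (ha : a.Is env w) :
    IsTup env (Function.update e j a) (Function.update u j w) := by
  intro i
  by_cases hi : i = j
  · subst hi; simpa using ha
  · simpa [hi] using h i

theorem Ctx.append (h : Ctx env n r d) {l : List ℕ} {m : ℕ} (hl : l.length = m) :
    Ctx (env ++ l) n r (d + m) :=
  ⟨h.order.append l, h.rounds.append l, by rw [List.length_append, h.length, hl]⟩

theorem isTup_vars (h : env.length = d) (u : Tup k n) :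
    IsTup (env ++ List.ofFn fun j => (u j : ℕ)) (vars k d) u := by
  subst h
  exact fun j => .var (by simp)

theorem Ctx.outputs_loop (h : Ctx env n r d) {c : Cmd} {g : Fin n → List DescSym}
    (H : ∀ (i : Fin n) (env' : List ℕ), env <+: env' → Ctx env' n r (d + 1) →
      (Expr.var d).Is env' i → Outputs c env' (g i)) :
    Outputs (loop 0 c) env ((list (α := Fin n)).flatMap g) :=
  Outputs.loop h.order fun i => H i _ (List.prefix_append _ _) (h.append rfl) (.last h.length i)

theorem Ctx.outputs_loop_rounds (h : Ctx env n r d) {c : Cmd} {g : Fin r → List DescSym}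
    (H : ∀ (i : Fin r) (env' : List ℕ), env <+: env' → Ctx env' n r (d + 1) →
      (Expr.var d).Is env' i → Outputs c env' (g i)) :
    Outputs (loop 1 c) env ((list (α := Fin r)).flatMap g) :=
  Outputs.loop h.rounds fun i => H i _ (List.prefix_append _ _) (h.append rfl) (.last h.length i)

theorem Ctx.outputs_loopTuple (h : Ctx env n r d) {c : Cmd} {g : Tup k n → List DescSym}
    (H : ∀ (u : Tup k n) (env' : List ℕ), env <+: env' → Ctx env' n r (d + k) →
      IsTup env' (vars k d) u → Outputs c env' (g u)) :
    Outputs (loopTuple 0 k c) env ((list (α := Tup k n)).flatMap g) :=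
  Outputs.loopTuple h.order fun u => H u _ (List.prefix_append _ _)
    (h.append (List.length_ofFn ..)) (isTup_vars h.length u)

/-- Runs a program for each pair of tuples. -/
def pairs (k : ℕ) (c : Fin 2 → Cmd) : Cmd :=
  seqs (List.finRange 2) fun s => loopTuple 0 k (loopTuple 0 k (c s))

/-- The number `s` of the graph is unrolled into two copies of the body, so it enters expressions as
a constant and occupies no variable. -/
theorem Ctx.outputs_pairs (h : Ctx env n r d) {c : Fin 2 → Cmd} {g : Pair k n → List DescSym}
    (H : ∀ (s : Fin 2) (u v : Tup k n) (env' : List ℕ), env <+: env' → Ctx env' n r (d + k + k) →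
      IsTup env' (vars k d) u → IsTup env' (vars k (d + k)) v → Outputs (c s) env' (g (s, u, v))) :
    Outputs (pairs k c) env ((list (α := Pair k n)).flatMap g) := by
  refine Outputs.prod (Outputs.seqs fun s => Outputs.prod ?_)
  refine h.outputs_loopTuple fun u env₁ h₁ c₁ hu => ?_
  refine c₁.outputs_loopTuple fun v env₂ h₂ c₂ hv => ?_
  exact H s u v env₂ (h₁.trans h₂) c₂ (hu.mono h₂) hv

namespace Addr

/-! ### Positions of the gates -/

/-- The number of vertices. -/
def orderE : Expr := .var 0

def cardTupE : ℕ → Expr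
  | 0 => .const 1
  | k + 1 => cardTupE k * orderE

def cardEntryE : Expr := .const 2 * (orderE * orderE)
def cardPairE (k : ℕ) : Expr := .const 2 * (cardTupE k * cardTupE k)
def cardAdjE (k : ℕ) : Expr := cardPairE k * (.const k * (.const k * .const 3))
def cardAuxE : Expr :=
  orderE * orderE + (orderE * orderE + (orderE * orderE + (orderE + orderE)))
def cardRoundE (k : ℕ) : Expr := cardPairE k * cardAuxE + cardPairE k

theorem is_cardTupE (h : Ctx env n r d) : (cardTupE k).Is env (card (Tup k n)) := by
  rw [card_tuple, card_fin]
  induction k with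
  | zero => exact .const 1
  | succ k ih => exact .mul ih h.order

theorem is_cardEntryE (h : Ctx env n r d) : cardEntryE.Is env (card (Entry n)) := by
  rw [card_prod, card_prod, card_fin, card_fin]
  exact .mul (.const 2) (.mul h.order h.order)

theorem is_cardPairE (h : Ctx env n r d) : (cardPairE k).Is env (card (Pair k n)) := by
  rw [card_prod, card_prod, card_fin]
  exact .mul (.const 2) (.mul (is_cardTupE h) (is_cardTupE h))

theorem is_cardAdjE (h : Ctx env n r d) :
    (cardAdjE k).Is env (card (Pair k n × Fin k × Fin k × Fin 3)) := by
  rw [card_prod, card_prod (α := Fin k), card_prod (α := Fin k), card_fin, card_fin]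
  exact .mul (is_cardPairE h) (.mul (.const k) (.mul (.const k) (.const 3)))

theorem is_cardAuxE (h : Ctx env n r d) : cardAuxE.Is env (card (Aux n)) := by
  simp only [card_sum, card_prod, card_fin]
  have h := h.order
  exact .add (.mul h h) (.add (.mul h h) (.add (.mul h h) (.add h h)))

theorem is_cardRoundE (h : Ctx env n r d) : (cardRoundE k).Is env (card (Round k n)) := by
  rw [card_sum, card_prod (α := Pair k n)]
  exact .add (.mul (is_cardPairE h) (is_cardAuxE h)) (is_cardPairE h)

/-- Horner's scheme: a tuple is read as a number in base `n`. -/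
def tupE : (k : ℕ) → (Fin k → Expr) → Expr
  | 0, _ => .const 0
  | k + 1, e => tupE k (fun j => e (Fin.castSucc j)) * orderE + e (Fin.last k)

def pairE {k : ℕ} (s : Fin 2) (e e' : Fin k → Expr) : Expr :=
  .const s * (cardTupE k * cardTupE k) + (tupE k e * cardTupE k + tupE k e')

def entryE (s : Fin 2) (a b : Expr) : Expr := .const s * (orderE * orderE) + (a * orderE + b)

def negEntryE (s : Fin 2) (a b : Expr) : Expr := cardEntryE + entryE s a b

def adjCmpE (k : ℕ) (x : Expr) (i j : Fin k) (c : Fin 3) : Expr :=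
  cardEntryE + (cardEntryE + (x * (.const k * (.const k * .const 3)) +
    (.const i * (.const k * .const 3) + (.const j * .const 3 + .const c))))

def cmpE (k : ℕ) (i x : Expr) : Expr :=
  cardEntryE + (cardEntryE + (cardAdjE k + (i * cardRoundE k + x)))

/-- The position of an auxiliary gate, given that of the round, the pair, and the gate within its
group. -/
def auxE (k : ℕ) (i x p : Expr) : Expr :=
  cardEntryE + (cardEntryE + (cardAdjE k + (cardPairE k + (i * cardRoundE k + (x * cardAuxE + p)))))

def substE (k : ℕ) (i x w w' : Expr) : Expr := auxE k i x (w * orderE + w')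

def substFstE (k : ℕ) (i x w w' : Expr) : Expr :=
  auxE k i x (orderE * orderE + (w * orderE + w'))

def negSubstFstE (k : ℕ) (i x w w' : Expr) : Expr :=
  auxE k i x (orderE * orderE + (orderE * orderE + (w * orderE + w')))

def testFstE (k : ℕ) (i x w : Expr) : Expr :=
  auxE k i x (orderE * orderE + (orderE * orderE + (orderE * orderE + w)))

def testSndE (k : ℕ) (i x w : Expr) : Expr :=
  auxE k i x (orderE * orderE + (orderE * orderE + (orderE * orderE + (orderE + w))))

/-- The position of a gate of the final comparison, given that within its group. -/
def finalE (k : ℕ) (p : Expr) : Expr :=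
  cardEntryE + (cardEntryE + (cardAdjE k + (cardPairE k + (.var 1 * cardRoundE k + p))))

def negFinalE {k : ℕ} (e e' : Fin k → Expr) : Expr := finalE k (tupE k e * cardTupE k + tupE k e')

def finalFstE {k : ℕ} (e : Fin k → Expr) : Expr := finalE k (cardTupE k * cardTupE k + tupE k e)

def finalSndE {k : ℕ} (e : Fin k → Expr) : Expr :=
  finalE k (cardTupE k * cardTupE k + (cardTupE k + tupE k e))

theorem is_tupE (h : Ctx env n r d) {e : Fin k → Expr} {u : Tup k n} (hu : IsTup env e u) :
    (tupE k e).Is env (idx u) := by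
  induction k with
  | zero => exact .const 0
  | succ k ih =>
    rw [idx_tuple_succ, card_fin]
    exact .add (.mul (ih fun j => hu _) h.order) (hu _)

theorem is_pairE (h : Ctx env n r d) (s : Fin 2) {e e' : Fin k → Expr} {u v : Tup k n}
    (hu : IsTup env e u) (hv : IsTup env e' v) : (pairE s e e').Is env (idx (s, u, v)) := by
  rw [idx_prod, idx_prod, card_prod]
  exact .add (.mul (.const s) (.mul (is_cardTupE h) (is_cardTupE h)))
    (.add (.mul (is_tupE h hu) (is_cardTupE h)) (is_tupE h hv))

theorem is_entryE (h : Ctx env n r d) (s : Fin 2) {a b : Expr} {v w : Fin n} (ha : a.Is env v)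
    (hb : b.Is env w) : (entryE s a b).Is env (idx (entry (s, v, w) : Addr k n r)) := by
  rw [idx_inl, idx_prod, idx_prod, card_prod, card_fin]
  exact .add (.mul (.const s) (.mul h.order h.order)) (.add (.mul ha h.order) hb)

theorem is_negEntryE (h : Ctx env n r d) (s : Fin 2) {a b : Expr} {v w : Fin n} (ha : a.Is env v)
    (hb : b.Is env w) : (negEntryE s a b).Is env (idx (negEntry (s, v, w) : Addr k n r)) := by
  rw [idx_inr]
  exact .add (is_cardEntryE h) (is_entryE (k := k) h s ha hb)

theorem is_adjCmpE (h : Ctx env n r d) {e : Expr} {x : Pair k n} (hx : e.Is env (idx x))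
    (i j : Fin k) (c : Fin 3) :
    (adjCmpE k e i j c).Is env (idx (adjCmp x i j c : Addr k n r)) := by
  rw [idx_inr, idx_inr, idx_inl, idx_prod x, idx_prod i, idx_prod j,
    card_prod (α := Fin k) (β := Fin k × Fin 3), card_prod (α := Fin k) (β := Fin 3), card_fin, card_fin]
  exact .add (is_cardEntryE h) (.add (is_cardEntryE h)
    (.add (.mul hx (.mul (.const k) (.mul (.const k) (.const 3))))
      (.add (.mul (.const i) (.mul (.const k) (.const 3)))
        (.add (.mul (.const j) (.const 3)) (.const c)))))

/-- `castSucc` preserves values and `Fin.last r` has the value `r`. The round variable and variable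
1 can thus be used directly for `a`. -/
theorem is_cmpE (h : Ctx env n r d) {a e : Expr} {i : Fin (r + 1)} {x : Pair k n}
    (hi : a.Is env i) (hx : e.Is env (idx x)) :
    (cmpE k a e).Is env (idx (cmp i x)) := by
  rw [idx_cmp]
  exact .add (is_cardEntryE h) (.add (is_cardEntryE h) (.add (is_cardAdjE h)
    (.add (.mul hi (is_cardRoundE h)) hx)))

theorem is_auxE (h : Ctx env n r d) {a e p : Expr} {i : Fin r} {x : Pair k n} {y : Aux n}
    (hi : a.Is env i) (hx : e.Is env (idx x)) (hp : p.Is env (idx y)) :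
    (auxE k a e p).Is env (idx (round i (.inl (x, y)))) := by
  rw [idx_inr, idx_inr, idx_inr, idx_inr, idx_inl, idx_prod i, idx_inl, idx_prod x]
  exact .add (is_cardEntryE h) (.add (is_cardEntryE h) (.add (is_cardAdjE h) (.add (is_cardPairE h)
    (.add (.mul hi (is_cardRoundE h)) (.add (.mul hx (is_cardAuxE h)) hp)))))

variable {a e b b' : Expr} {i : Fin r} {x : Pair k n} {w w' : Fin n}

theorem is_card_sq (h : Ctx env n r d) : (orderE * orderE).Is env (card (Fin n × Fin n)) := by
  rw [card_prod, card_fin]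
  exact .mul h.order h.order

theorem is_vertices (h : Ctx env n r d) (hw : b.Is env w) (hw' : b'.Is env w') :
    (b * orderE + b').Is env (idx (w, w')) := by
  rw [idx_prod, card_fin]
  exact .add (.mul hw h.order) hw'

theorem is_substE (h : Ctx env n r d) (hi : a.Is env i) (hx : e.Is env (idx x))
    (hw : b.Is env w) (hw' : b'.Is env w') :
    (substE k a e b b').Is env (idx (subst i x w w')) :=
  is_auxE h hi hx (is_vertices h hw hw')

theorem is_substFstE (h : Ctx env n r d) (hi : a.Is env i) (hx : e.Is env (idx x))
    (hw : b.Is env w) (hw' : b'.Is env w') :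
    (substFstE k a e b b').Is env (idx (substFst i x w w')) :=
  is_auxE h hi hx (.add (is_card_sq h) (is_vertices h hw hw'))

theorem is_negSubstFstE (h : Ctx env n r d) (hi : a.Is env i) (hx : e.Is env (idx x))
    (hw : b.Is env w) (hw' : b'.Is env w') :
    (negSubstFstE k a e b b').Is env (idx (negSubstFst i x w w')) :=
  is_auxE h hi hx (.add (is_card_sq h) (.add (is_card_sq h) (is_vertices h hw hw')))

theorem is_testFstE (h : Ctx env n r d) (hi : a.Is env i) (hx : e.Is env (idx x))
    (hw : b.Is env w) : (testFstE k a e b).Is env (idx (testFst i x w)) :=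
  is_auxE h hi hx (.add (is_card_sq h) (.add (is_card_sq h) (.add (is_card_sq h) hw)))

theorem is_testSndE (h : Ctx env n r d) (hi : a.Is env i) (hx : e.Is env (idx x))
    (hw : b.Is env w) : (testSndE k a e b).Is env (idx (testSnd i x w)) := by
  refine is_auxE h hi hx (.add (is_card_sq h) (.add (is_card_sq h) (.add (is_card_sq h) ?_)))
  change Expr.Is env _ (card (Fin n) + idx w)
  rw [card_fin]
  exact .add h.order hw

theorem is_finalE (h : Ctx env n r d) {p : Expr} {y : Final k n} (hp : p.Is env (idx y)) :
    (finalE k p).Is env (idx (final y : Addr k n r)) := by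
  rw [idx_inr, idx_inr, idx_inr, idx_inr, idx_inr, card_prod (α := Fin r), card_fin]
  exact .add (is_cardEntryE h) (.add (is_cardEntryE h) (.add (is_cardAdjE h) (.add (is_cardPairE h)
    (.add (.mul h.rounds (is_cardRoundE h)) hp))))

variable {f f' : Fin k → Expr} {u u' : Tup k n}

theorem is_cardTup_sq (h : Ctx env n r d) :
    (Addr.cardTupE k * Addr.cardTupE k).Is env (card (Tup k n × Tup k n)) := by
  rw [card_prod]
  exact .mul (is_cardTupE h) (is_cardTupE h)

theorem is_negFinalE (h : Ctx env n r d) (hu : IsTup env f u) (hu' : IsTup env f' u') :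
    (negFinalE f f').Is env (idx (negFinal u u' : Addr k n r)) :=
  is_finalE h (y := .inl (u, u')) (.add (.mul (is_tupE h hu) (is_cardTupE h)) (is_tupE h hu'))

theorem is_finalFstE (h : Ctx env n r d) (hu : IsTup env f u) :
    (finalFstE f).Is env (idx (finalFst u : Addr k n r)) :=
  is_finalE h (y := .inr (.inl u)) (.add (is_cardTup_sq h) (is_tupE h hu))

theorem is_finalSndE (h : Ctx env n r d) (hu : IsTup env f u) :
    (finalSndE f).Is env (idx (finalSnd u : Addr k n r)) :=
  is_finalE h (y := .inr (.inr (.inl u))) (.add (is_cardTup_sq h) (.add (is_cardTupE h) (is_tupE h hu)))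

end Addr

end WL

namespace WL

open Listing Cmd

variable {k n r d : ℕ} {env : List ℕ}

/-- The description of a gate of the network. -/
def gateDescr (tc : Bool) (a : Addr k n r) : List DescSym := ((network tc k n r).gate a).describe

/-! ### Programs for the groups of gates -/

namespace Addr

def entryProg (s : Fin 2) : Cmd :=
  loop 0 (loop 0 (seq (emit .input) (num (entryE s (.var 2) (.var 3)))))

theorem outputs_entryProg (tc : Bool) (h : Ctx env n r 2) : Outputs (seqs (List.finRange 2) entryProg)
    env ((list (α := Entry n)).flatMap fun p => gateDescr tc (entry p : Addr k n r)) := by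
  refine Outputs.prod (Outputs.seqs fun s => Outputs.prod ?_)
  refine h.outputs_loop fun v env₁ _ c₁ hv => ?_
  refine c₁.outputs_loop fun w env₂ h₂ c₂ hw => ?_
  refine Outputs.cons _ (outputs_num ?_)
  rw [← idx_entry (k := k) (r := r) (s, v, w)]
  exact is_entryE c₂ s (hv.mono h₂) hw

def negEntryProg (s : Fin 2) : Cmd :=
  loop 0 (loop 0 (seq (emit .not) (num (entryE s (.var 2) (.var 3)))))

theorem outputs_negEntryProg (tc : Bool) (h : Ctx env n r 2) :
    Outputs (seqs (List.finRange 2) negEntryProg) env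
      ((list (α := Entry n)).flatMap fun p => gateDescr tc (negEntry p : Addr k n r)) := by
  refine Outputs.prod (Outputs.seqs fun s => Outputs.prod ?_)
  refine h.outputs_loop fun v env₁ _ c₁ hv => ?_
  refine c₁.outputs_loop fun w env₂ h₂ c₂ hw => ?_
  exact Outputs.cons _ (outputs_num (is_entryE c₂ s (hv.mono h₂) hw))

/-- The pair of tuples in the variables that begin with `d`. -/
def varPairE (k d : ℕ) (s : Fin 2) : Expr := pairE s (vars k d) (vars k (d + k))

/-- For `c = 2` the nested tests decide the equality pattern while printing: the wires are written
if both pairs of entries are equal or both are different. -/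
def adjCmpProg (k : ℕ) (s : Fin 2) (i j : Fin k) (c : Fin 3) : Cmd :=
  match c with
  | 0 => seq (emit .and) (seq (num (entryE 0 (.var (2 + i)) (.var (2 + j))))
      (num (entryE s (.var (2 + k + i)) (.var (2 + k + j)))))
  | 1 => seq (emit .and) (seq (num (negEntryE 0 (.var (2 + i)) (.var (2 + j))))
      (num (negEntryE s (.var (2 + k + i)) (.var (2 + k + j)))))
  | 2 =>
    let wires := seq (num (adjCmpE k (varPairE k 2 s) i j 0)) (num (adjCmpE k (varPairE k 2 s) i j 1))
    seq (emit .or) (ifEq (2 + i) (2 + j) (ifEq (2 + k + i) (2 + k + j) wires skip)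
      (ifEq (2 + k + i) (2 + k + j) skip wires))

theorem outputs_adjCmpProg (tc : Bool) (h : Ctx env n r 2) :
    Outputs (pairs k fun s => seqs (List.finRange k) fun i => seqs (List.finRange k) fun j =>
        seqs (List.finRange 3) fun c => adjCmpProg k s i j c) env
      ((list (α := Pair k n × Fin k × Fin k × Fin 3)).flatMap fun p =>
        gateDescr tc (adjCmp p.1 p.2.1 p.2.2.1 p.2.2.2 : Addr k n r)) := by
  refine Outputs.prod (h.outputs_pairs fun s u v env' _ h' hu hv => ?_)
  refine Outputs.prod (Outputs.seqs fun i => Outputs.prod (Outputs.seqs fun j =>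
    Outputs.seqs fun c => ?_))
  fin_cases c
  · refine Outputs.cons _ ?_
    simpa [preds, vars] using (outputs_num (is_entryE (k := k) h' 0 (hu i) (hu j))).seq
      (outputs_num (is_entryE (k := k) h' s (hv i) (hv j)))
  · refine Outputs.cons _ ?_
    simpa [preds, vars] using (outputs_num (is_negEntryE (k := k) h' 0 (hu i) (hu j))).seq
      (outputs_num (is_negEntryE (k := k) h' s (hv i) (hv j)))
  · refine Outputs.cons _ ?_
    have key : Outputs (seq (num (adjCmpE k (varPairE k 2 s) i j 0))
        (num (adjCmpE k (varPairE k 2 s) i j 1))) env'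
        ((([adjCmp (s, u, v) i j 0, adjCmp (s, u, v) i j 1] : List (Addr k n r)).map idx).flatMap
          describeNat) := by
      simpa [varPairE] using (outputs_num (is_adjCmpE h' (is_pairE h' s hu hv) i j 0)).seq
        (outputs_num (is_adjCmpE h' (is_pairE h' s hu hv) i j 1))
    change Outputs _ _ (((preds tc (adjCmp (s, u, v) i j 2 : Addr k n r)).map idx).flatMap describeNat)
    refine Outputs.ifEq (hu i) (hu j) (fun h₁ => Outputs.ifEq (hv i) (hv j) (fun h₂ => ?_)
      fun h₂ => ?_) (fun h₁ => Outputs.ifEq (hv i) (hv j) (fun h₂ => ?_) fun h₂ => ?_) <;>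
    simp only [ne_eq, Fin.val_inj] at h₁ h₂ <;> simp only [preds, h₁, h₂, iff_self, iff_false,
      not_true, false_iff, if_true, if_false] <;>
    first | exact key | exact Ev.skip env' 0

def initialProg (k : ℕ) (s : Fin 2) : Cmd :=
  seq (emit .and) (seqs (List.finRange k) fun i => seqs (List.finRange k) fun j =>
    num (adjCmpE k (varPairE k 2 s) i j 2))

theorem outputs_initialProg (tc : Bool) (h : Ctx env n r 2) :
    Outputs (pairs k (initialProg k)) env
      ((list (α := Pair k n)).flatMap fun x => gateDescr tc (initial x : Addr k n r)) := by
  refine h.outputs_pairs fun s u v env' _ h' hu hv => Outputs.cons _ ?_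
  simp only [preds, List.flatMap_map]
  exact Outputs.prod (Outputs.seqs fun i => Outputs.seqs fun j =>
    outputs_num (is_adjCmpE h' (is_pairE h' s hu hv) i j 2))

def substProg (k : ℕ) (s : Fin 2) : Cmd :=
  loop 0 (loop 0 (seq (emit .and) (seqs (List.finRange k) fun j => num (cmpE k (.var 2)
    (pairE s (Function.update (vars k 3) j (.var (3 + k + k)))
      (Function.update (vars k (3 + k)) j (.var (3 + k + k + 1))))))))

def substFstProg (k : ℕ) : Cmd :=
  loop 0 (loop 0 (seq (emit .and) (seqs (List.finRange k) fun j => num (cmpE k (.var 2)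
    (pairE 0 (Function.update (vars k 3) j (.var (3 + k + k)))
      (Function.update (vars k 3) j (.var (3 + k + k + 1))))))))

def negSubstFstProg (k : ℕ) (s : Fin 2) : Cmd :=
  loop 0 (loop 0 (seq (emit .not) (num (substFstE k (.var 2) (varPairE k 3 s) (.var (3 + k + k))
    (.var (3 + k + k + 1))))))

def testFstProg (tc : Bool) (k : ℕ) (s : Fin 2) : Cmd :=
  let wires := loop 0 (num (substE k (.var 2) (varPairE k 3 s) (.var (3 + k + k))
    (.var (3 + k + k + 1))))
  let negWires := loop 0 (num (negSubstFstE k (.var 2) (varPairE k 3 s) (.var (3 + k + k))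
    (.var (3 + k + k + 1))))
  loop 0 (if tc then seq (emit .threshold) (seq (num orderE) (seq wires negWires))
    else seq (emit .or) wires)

def testSndProg (k : ℕ) (s : Fin 2) : Cmd :=
  loop 0 (seq (emit .or) (loop 0 (num (substE k (.var 2) (varPairE k 3 s) (.var (3 + k + k + 1))
    (.var (3 + k + k))))))

def auxProg (tc : Bool) (k : ℕ) (s : Fin 2) : Cmd :=
  seq (substProg k s) (seq (substFstProg k) (seq (negSubstFstProg k s)
    (seq (testFstProg tc k s) (testSndProg k s))))

def roundCmpProg (k : ℕ) (s : Fin 2) : Cmd :=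
  seq (emit .and) (seq (num (cmpE k (.var 2) (varPairE k 3 s)))
    (seq (loop 0 (num (testFstE k (.var 2) (varPairE k 3 s) (.var (3 + k + k)))))
      (loop 0 (num (testSndE k (.var 2) (varPairE k 3 s) (.var (3 + k + k)))))))

variable {i : Fin r} {s : Fin 2} {u v : Tup k n}

theorem outputs_substProg (tc : Bool) (h : Ctx env n r (3 + k + k)) (hi : (Expr.var 2).Is env i)
    (hu : IsTup env (vars k 3) u) (hv : IsTup env (vars k (3 + k)) v) :
    Outputs (substProg k s) env ((list (α := Fin n × Fin n)).flatMap fun p =>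
      gateDescr tc (subst i (s, u, v) p.1 p.2)) := by
  refine Outputs.prod (h.outputs_loop fun w env₁ h₁ c₁ hw => c₁.outputs_loop fun w' env₂ h₂ c₂ hw' =>
    Outputs.cons _ ?_)
  have h₃ := h₁.trans h₂
  simp only [preds, List.flatMap_map]
  exact Outputs.seqs fun j => outputs_num (is_cmpE c₂ (hi.mono h₃)
    (is_pairE c₂ s ((hu.mono h₃).update j (hw.mono h₂)) ((hv.mono h₃).update j hw')))

theorem outputs_substFstProg (tc : Bool) (h : Ctx env n r (3 + k + k)) (hi : (Expr.var 2).Is env i)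
    (hu : IsTup env (vars k 3) u) :
    Outputs (substFstProg k) env ((list (α := Fin n × Fin n)).flatMap fun p =>
      gateDescr tc (substFst i (s, u, v) p.1 p.2)) := by
  refine Outputs.prod (h.outputs_loop fun w env₁ h₁ c₁ hw => c₁.outputs_loop fun w' env₂ h₂ c₂ hw' =>
    Outputs.cons _ ?_)
  have h₃ := h₁.trans h₂
  simp only [preds, List.flatMap_map]
  exact Outputs.seqs fun j => outputs_num (is_cmpE c₂ (hi.mono h₃)
    (is_pairE c₂ 0 ((hu.mono h₃).update j (hw.mono h₂)) ((hu.mono h₃).update j hw')))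

theorem outputs_negSubstFstProg (tc : Bool) (h : Ctx env n r (3 + k + k))
    (hi : (Expr.var 2).Is env i) (hu : IsTup env (vars k 3) u) (hv : IsTup env (vars k (3 + k)) v) :
    Outputs (negSubstFstProg k s) env ((list (α := Fin n × Fin n)).flatMap fun p =>
      gateDescr tc (negSubstFst i (s, u, v) p.1 p.2)) := by
  refine Outputs.prod (h.outputs_loop fun w env₁ h₁ c₁ hw => c₁.outputs_loop fun w' env₂ h₂ c₂ hw' =>
    Outputs.cons _ ?_)
  have h₃ := h₁.trans h₂
  exact outputs_num (is_substFstE c₂ (hi.mono h₃) (is_pairE c₂ s (hu.mono h₃) (hv.mono h₃))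
    (hw.mono h₂) hw')

theorem outputs_testFstProg (tc : Bool) (h : Ctx env n r (3 + k + k))
    (hi : (Expr.var 2).Is env i) (hu : IsTup env (vars k 3) u) (hv : IsTup env (vars k (3 + k)) v) :
    Outputs (testFstProg tc k s) env ((list (α := Fin n)).flatMap fun w =>
      gateDescr tc (testFst i (s, u, v) w)) := by
  refine h.outputs_loop fun w env₁ h₁ c₁ hw => ?_
  have hwires : Outputs (loop 0 (num (substE k (.var 2) (varPairE k 3 s) (.var (3 + k + k))
      (.var (3 + k + k + 1))))) env₁ ((list (α := Fin n)).flatMap fun w' =>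
        describeNat (idx (subst i (s, u, v) w w'))) :=
    c₁.outputs_loop fun w' env₂ h₂ c₂ hw' => by
      have h₃ := h₁.trans h₂
      exact outputs_num (is_substE c₂ (hi.mono h₃) (is_pairE c₂ s (hu.mono h₃) (hv.mono h₃))
        (hw.mono h₂) hw')
  cases tc
  · refine Outputs.cons _ ?_
    simpa [preds, List.flatMap_map] using hwires
  · have hneg : Outputs (loop 0 (num (negSubstFstE k (.var 2) (varPairE k 3 s) (.var (3 + k + k))
        (.var (3 + k + k + 1))))) env₁ ((list (α := Fin n)).flatMap fun w' =>
          describeNat (idx (negSubstFst i (s, u, v) w w'))) :=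
      c₁.outputs_loop fun w' env₂ h₂ c₂ hw' => by
        have h₃ := h₁.trans h₂
        exact outputs_num (is_negSubstFstE c₂ (hi.mono h₃)
          (is_pairE c₂ s (hu.mono h₃) (hv.mono h₃)) (hw.mono h₂) hw')
    refine Outputs.cons _ ((outputs_num c₁.order).seq ?_)
    simp only [preds, if_true, List.map_append, List.flatMap_append, List.map_map, List.flatMap_map]
    exact hwires.seq hneg

theorem outputs_testSndProg (tc : Bool) (h : Ctx env n r (3 + k + k))
    (hi : (Expr.var 2).Is env i) (hu : IsTup env (vars k 3) u) (hv : IsTup env (vars k (3 + k)) v) :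
    Outputs (testSndProg k s) env ((list (α := Fin n)).flatMap fun w =>
      gateDescr tc (testSnd i (s, u, v) w)) := by
  refine h.outputs_loop fun w env₁ h₁ c₁ hw => Outputs.cons _ ?_
  simp only [preds, List.flatMap_map]
  refine c₁.outputs_loop fun w' env₂ h₂ c₂ hw' => ?_
  have h₃ := h₁.trans h₂
  exact outputs_num (is_substE c₂ (hi.mono h₃) (is_pairE c₂ s (hu.mono h₃) (hv.mono h₃))
    hw' (hw.mono h₂))

theorem outputs_roundCmpProg (tc : Bool) (h : Ctx env n r (3 + k + k))
    (hi : (Expr.var 2).Is env i) (hu : IsTup env (vars k 3) u) (hv : IsTup env (vars k (3 + k)) v) :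
    Outputs (roundCmpProg k s) env (gateDescr tc (round i (.inr (s, u, v)))) := by
  refine Outputs.cons _ ?_
  simp only [preds, List.map_cons, List.flatMap_cons, List.map_append, List.flatMap_append,
    List.flatMap_map]
  refine (outputs_num (is_cmpE h hi (is_pairE h s hu hv))).seq (Outputs.seq ?_ ?_)
  · exact h.outputs_loop fun w env₁ h₁ c₁ hw => outputs_num (is_testFstE c₁ (hi.mono h₁)
      (is_pairE c₁ s (hu.mono h₁) (hv.mono h₁)) hw)
  · exact h.outputs_loop fun w env₁ h₁ c₁ hw => outputs_num (is_testSndE c₁ (hi.mono h₁)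
      (is_pairE c₁ s (hu.mono h₁) (hv.mono h₁)) hw)

theorem outputs_rounds (tc : Bool) (h : Ctx env n r 2) :
    Outputs (loop 1 (seq (pairs k (auxProg tc k)) (pairs k (roundCmpProg k)))) env
      ((list (α := Fin r × Round k n)).flatMap fun p => gateDescr tc (round p.1 p.2)) := by
  refine Outputs.prod (h.outputs_loop_rounds fun i env₁ _ c₁ hi => Outputs.sum (Outputs.prod ?_) ?_)
  · refine c₁.outputs_pairs fun s u v env₂ h₂ c₂ hu hv => ?_
    replace hi := hi.mono h₂
    exact Outputs.sum (outputs_substProg tc c₂ hi hu hv)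
      (Outputs.sum (outputs_substFstProg tc c₂ hi hu) (Outputs.sum
        (outputs_negSubstFstProg tc c₂ hi hu hv) (Outputs.sum (outputs_testFstProg tc c₂ hi hu hv)
          (outputs_testSndProg tc c₂ hi hu hv))))
  · exact c₁.outputs_pairs fun s u v env₂ h₂ c₂ hu hv =>
      outputs_roundCmpProg tc c₂ (hi.mono h₂) hu hv

def negFinalProg (k : ℕ) : Cmd :=
  loopTuple 0 k (loopTuple 0 k (seq (emit .not) (num (cmpE k (.var 1) (varPairE k 2 0)))))

def finalFstProg (tc : Bool) (k : ℕ) : Cmd :=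
  let wires := loopTuple 0 k (num (cmpE k (.var 1) (varPairE k 2 1)))
  let negWires := loopTuple 0 k (num (negFinalE (vars k 2) (vars k (2 + k))))
  loopTuple 0 k (if tc then seq (emit .threshold) (seq (num (cardTupE k)) (seq wires negWires))
    else seq (emit .or) wires)

def finalSndProg (k : ℕ) : Cmd :=
  loopTuple 0 k (seq (emit .or) (loopTuple 0 k
    (num (cmpE k (.var 1) (pairE 1 (vars k (2 + k)) (vars k 2))))))

def outProg (k : ℕ) : Cmd :=
  seq (emit .and) (seq (loopTuple 0 k (num (finalFstE (vars k 2))))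
    (loopTuple 0 k (num (finalSndE (vars k 2)))))

theorem outputs_finalFstProg (tc : Bool) (h : Ctx env n r 2) :
    Outputs (finalFstProg tc k) env ((list (α := Tup k n)).flatMap fun u =>
      gateDescr tc (finalFst u : Addr k n r)) := by
  refine h.outputs_loopTuple fun u env₁ h₁ c₁ hu => ?_
  have hwires : Outputs (loopTuple 0 k (num (cmpE k (.var 1) (varPairE k 2 1)))) env₁
      ((list (α := Tup k n)).flatMap fun v => describeNat (idx (cmp (Fin.last r) (1, u, v)))) :=
    c₁.outputs_loopTuple fun v env₂ h₂ c₂ hv =>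
      outputs_num (is_cmpE c₂ c₂.rounds (is_pairE c₂ 1 (hu.mono h₂) hv))
  cases tc
  · refine Outputs.cons _ ?_
    simpa [preds, List.flatMap_map] using hwires
  · have hneg : Outputs (loopTuple 0 k (num (negFinalE (vars k 2) (vars k (2 + k))))) env₁
        ((list (α := Tup k n)).flatMap fun u' => describeNat (idx (negFinal u u' : Addr k n r))) :=
      c₁.outputs_loopTuple fun v env₂ h₂ c₂ hv => outputs_num (is_negFinalE c₂ (hu.mono h₂) hv)
    have hcard := is_cardTupE (k := k) c₁
    rw [card_tuple, card_fin] at hcard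
    refine Outputs.cons _ ((outputs_num hcard).seq ?_)
    simp only [preds, if_true, List.map_append, List.flatMap_append, List.map_map, List.flatMap_map]
    exact hwires.seq hneg

theorem outputs_final (tc : Bool) (h : Ctx env n r 2) :
    Outputs (seq (negFinalProg k) (seq (finalFstProg tc k) (seq (finalSndProg k) (outProg k)))) env
      ((list (α := Final k n)).flatMap fun p => gateDescr tc (final p : Addr k n r)) := by
  refine Outputs.sum (Outputs.prod ?_) (Outputs.sum (outputs_finalFstProg tc h)
    (Outputs.sum ?_ (Outputs.unit ?_)))
  · exact h.outputs_loopTuple fun u env₁ _ c₁ hu => c₁.outputs_loopTuple fun u' env₂ h₂ c₂ hu' =>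
      Outputs.cons _ (outputs_num (is_cmpE c₂ c₂.rounds (is_pairE c₂ 0 (hu.mono h₂) hu')))
  · refine h.outputs_loopTuple fun v env₁ _ c₁ hv => Outputs.cons _ ?_
    simp only [preds, List.flatMap_map]
    exact c₁.outputs_loopTuple fun u env₂ h₂ c₂ hu =>
      outputs_num (is_cmpE c₂ c₂.rounds (is_pairE c₂ 1 hu (hv.mono h₂)))
  · refine Outputs.cons _ ?_
    simp only [preds, List.map_append, List.flatMap_append, List.flatMap_map]
    exact Outputs.seq
      (h.outputs_loopTuple fun u env₁ _ c₁ hu => outputs_num (is_finalFstE c₁ hu))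
      (h.outputs_loopTuple fun u env₁ _ c₁ hu => outputs_num (is_finalSndE c₁ hu))

end Addr

open Addr in
/-- The program that describes the network. -/
def prog (tc : Bool) (k : ℕ) : Cmd :=
  seq (seqs (List.finRange 2) entryProg) (seq (seqs (List.finRange 2) negEntryProg)
    (seq (pairs k fun s => seqs (List.finRange k) fun i => seqs (List.finRange k) fun j =>
        seqs (List.finRange 3) fun c => adjCmpProg k s i j c)
      (seq (pairs k (initialProg k))
        (seq (loop 1 (seq (pairs k (auxProg tc k)) (pairs k (roundCmpProg k))))
          (seq (negFinalProg k) (seq (finalFstProg tc k) (seq (finalSndProg k) (outProg k))))))))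

/-- The description is a concatenation along the listing of `Addr`, a nested sum whose summands are
printed one after the other. -/
theorem outputs_prog (tc : Bool) (k n r : ℕ) :
    Outputs (prog tc k) [n, r] (network tc k n r).circuit.describe := by
  have h : Ctx [n, r] n r 2 := ⟨.var rfl, .var rfl, rfl⟩
  rw [Network.describe_circuit]
  exact Outputs.sum (Addr.outputs_entryProg tc h) (Outputs.sum (Addr.outputs_negEntryProg tc h)
    (Outputs.sum (Addr.outputs_adjCmpProg tc h) (Outputs.sum (Addr.outputs_initialProg tc h)
      (Outputs.sum (Addr.outputs_rounds tc h) (Addr.outputs_final tc h)))))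

theorem logspaceUniform_network (tc : Bool) (k : ℕ) {r : ℕ → ℕ} (hr : LogspaceConstructible r) :
    LogspaceUniform fun n => (network tc k n (r n)).circuit :=
  logspaceComputable_of_ev hr (prog tc k) _ fun n => ⟨0, outputs_prog tc k n (r n)⟩

end WL

/-! ### The bounds and the theorem -/

theorem WL.exists_bound (k : ℕ) (hk : 2 ≤ k) (tc : Bool) : ∃ C : ℕ, ∀ n r : ℕ, 1 ≤ n →
    (network tc k n r).circuit.depth ≤ C * max 1 r ∧
    (network tc k n r).circuit.size ≤ C * (max 1 r * n ^ (3 * k)) := by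
  refine ⟨20 * k ^ 2 + 4 * k + 44, fun n r hn => ⟨?_, size_network tc r hk hn⟩⟩
  calc (network tc k n r).circuit.depth ≤ 4 * r + 7 := depth_network tc k n r
    -- The maximum absorbs the constant depth of the initial and final comparisons, also for `r =
    -- 0`.
    _ ≤ 11 * max 1 r := by omega
    _ ≤ _ := Nat.mul_le_mul_right _ (by omega)

theorem theorem3p2 (k : ℕ) (hk : 2 ≤ k) :
    (∃ C : ℕ, ∀ r : ℕ → ℕ, ∃ D : (n : ℕ) → Circuit (2 * (n * n)),
      (LogspaceConstructible r → LogspaceUniform D) ∧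
      ∀ n : ℕ, 1 ≤ n →
        (∀ G H : SimpleGraph (Fin n),
          (D n).eval (graphPairInput G H) = true ↔ WL.ReportsIso k (r n) G H) ∧
        (D n).depth ≤ C * max 1 (r n) ∧
        (D n).size ≤ C * (max 1 (r n) * n ^ (3 * k))) ∧
    (∃ C : ℕ, ∀ r : ℕ → ℕ, ∃ D : (n : ℕ) → Circuit (2 * (n * n)),
      (LogspaceConstructible r → LogspaceUniform D) ∧
      ∀ n : ℕ, 1 ≤ n →
        (D n).IsAC ∧
        (∀ G H : SimpleGraph (Fin n),
          (D n).eval (graphPairInput G H) = true ↔ WL.CFReportsIso k (r n) G H) ∧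
        (D n).depth ≤ C * max 1 (r n) ∧
        (D n).size ≤ C * (max 1 (r n) * n ^ (3 * k))) := by
  obtain ⟨C, hC⟩ := WL.exists_bound k hk true
  obtain ⟨C', hC'⟩ := WL.exists_bound k hk false
  refine ⟨⟨C, fun r => ⟨fun n => (WL.network true k n (r n)).circuit,
    WL.logspaceUniform_network true k, fun n hn => ⟨?_, hC n (r n) hn⟩⟩⟩,
    ⟨C', fun r => ⟨fun n => (WL.network false k n (r n)).circuit,
    WL.logspaceUniform_network false k, fun n hn => ⟨WL.isAC_network k n (r n), ?_, hC' n (r n) hn⟩⟩⟩⟩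
  · exact fun G H => WL.eval_network_eq_true_iff G H
  · exact fun G H => WL.eval_network_false_eq_true_iff G H
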